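/- Let $n\ge 1$ and let $\Omega\subset\mathbb{R}^n$ be a bounded domain (nonempty, open, connected) with $C^2$-smooth boundary $\partial\Omega$ of codimension one, that is, near each boundary point $\Omega$ coincides with the set $\{\rho<0\}$ for some $C^2$ function $\rho$ with nowhere vanishing gradient. Put $d(x)=\operatorname{dist}(x,\partial\Omega)$. For $t>0$ small define the iterated logarithms $L_1(t)=\ln(1/t)$ and $L_k(t)=\ln L_{k-1}(t)$ for $k\ge 2$. Let $V\in L^\infty_{\mathrm{loc}}(\Omega)$ be real-valued and let $p\ge 2$ be an integer. Assume that $V=V_1+V_2$ almost everywhere on $\Omega$, where $V_1,V_2$ are real-valued, $V_1\ge 0$ almost everywhere on $\Omega$, $V_2\in L^\infty(\Omega)$, and that for some $\delta>0$ $$V_1(x)\ \ge\ \frac34\cdot\frac1{d(x)^2}-\frac1{d(x)^2}\sum_{j=2}^{p}\Bigl(\prod_{k=1}^{j-1}L_k(d(x))\Bigr)^{-1}-\frac1{d(x)}\,f(d(x))$$ for almost every $x\in\Omega$ with $d(x)<\delta$, where $f$ is a real-valued function which near $0^+$ satisfies $f\ge 0$, $\lim_{u\to0+}u f(u)=0$,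 and is (Lebesgue) integrable on $(0,\varepsilon)$ for some $\varepsilon>0$. Then the Schrödinger operator $H=-\Delta+V$ in the complex Hilbert space $L^2(\Omega)$, with domain $\mathcal D(H)=C_0^\infty(\Omega)$, is essentially self-adjoint; that is, $H$ is densely defined and symmetric, and its closure is self-adjoint. -/

import Mathlib

open MeasureTheory TopologicalSpace Filter Topology Distributions
open scoped ENNReal Laplacian

noncomputable section

namespace SchrodingerESA

/-- `ℝⁿ` with its Euclidean norm. -/
abbrev Rn (n : ℕ) : Type := EuclideanSpace ℝ (Fin n)

/-- The complex Hilbert space `L²(Ω)`, with respect to Lebesgue measure on `Ω`. -/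
abbrev L2 {n : ℕ} (Ω : Opens (Rn n)) : Type :=
  Lp ℂ 2 (volume.restrict (Ω : Set (Rn n)))

/-- `Ω` has a `C²`-smooth boundary (of codimension one): near each of its boundary points, `Ω` is
the sublevel set `{ρ < 0}` of a `C²` function `ρ` without critical points. -/
def HasC2Boundary {n : ℕ} (Ω : Opens (Rn n)) : Prop :=
  ∀ x₀ ∈ frontier (Ω : Set (Rn n)), ∃ (U : Set (Rn n)) (ρ : Rn n → ℝ),
    IsOpen U ∧ x₀ ∈ U ∧ ContDiffOn ℝ 2 ρ U ∧ (∀ x ∈ U, fderiv ℝ ρ x ≠ 0) ∧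
      ∀ x ∈ U, x ∈ Ω ↔ ρ x < 0

/-- The distance `d(x) = dist(x, ∂Ω)`. -/
def bdist {n : ℕ} (Ω : Opens (Rn n)) (x : Rn n) : ℝ :=
  Metric.infDist x (frontier (Ω : Set (Rn n)))

/-- `V ∈ L^∞_loc(Ω)`. -/
def LocEssBdd {n : ℕ} (Ω : Opens (Rn n)) (V : Rn n → ℝ) : Prop :=
  ∀ K : Set (Rn n), IsCompact K → K ⊆ Ω → MemLp V (⊤ : ℝ≥0∞) (volume.restrict K)

/-- The iterated logarithms of `1 / t`: `L₁(t) = ln (1 / t)` and `L_{k+1}(t) = ln L_k(t)`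
(the value `L₀(t) = 1 / t` only starts the recursion). -/
def iterLog : ℕ → ℝ → ℝ
  | 0, t => 1 / t
  | k + 1, t => Real.log (iterLog k t)

variable {n : ℕ} {Ω : Opens (Rn n)}

lemma two_le_smooth : (2 : WithTop ℕ∞) ≤ ((⊤ : ℕ∞) : WithTop ℕ∞) := by
  exact WithTop.coe_le_coe.2 (le_top : (2 : ℕ∞) ≤ ⊤)

lemma testFunction_memLp (φ : 𝓓(Ω, ℂ)) :
    MemLp φ 2 (volume.restrict (Ω : Set (Rn n))) :=
  (φ.continuous.memLp_of_hasCompactSupport φ.hasCompactSupport).restrict _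

lemma laplacian_memLp (φ : 𝓓(Ω, ℂ)) :
    MemLp (Δ (φ : Rn n → ℂ)) 2 (volume.restrict (Ω : Set (Rn n))) := by
  have h2 : ContDiff ℝ 2 (φ : Rn n → ℂ) := φ.contDiff.of_le two_le_smooth
  have hc : Continuous (iteratedFDeriv ℝ 2 (φ : Rn n → ℂ)) :=
    h2.continuous_iteratedFDeriv (le_refl _)
  have hs : HasCompactSupport (iteratedFDeriv ℝ 2 (φ : Rn n → ℂ)) :=
    φ.hasCompactSupport.iteratedFDeriv (𝕜 := ℝ) 2
  have hΔ := InnerProductSpace.laplacian_eq_iteratedFDeriv_stdOrthonormalBasis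
    (φ : Rn n → ℂ)
  refine (Continuous.memLp_of_hasCompactSupport ?_ ?_).restrict _
  · rw [hΔ]
    fun_prop
  · refine hs.mono' (fun x hx => ?_)
    refine subset_tsupport _ ?_
    intro h0
    apply hx
    rw [hΔ]
    simp [h0]

lemma potential_memLp {V : Rn n → ℝ} (hV : LocEssBdd Ω V) (φ : 𝓓(Ω, ℂ)) :
    MemLp (fun x => (V x : ℂ) * φ x) 2 (volume.restrict (Ω : Set (Rn n))) := by
  set K : Set (Rn n) := tsupport (φ : Rn n → ℂ) with hK
  have hVK : MemLp (fun x => (V x : ℂ)) (⊤ : ℝ≥0∞) (volume.restrict K) :=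
    (hV K φ.hasCompactSupport φ.tsupport_subset).ofReal
  have hφ : MemLp (φ : Rn n → ℂ) 2 (volume.restrict K) :=
    (φ.continuous.memLp_of_hasCompactSupport φ.hasCompactSupport).restrict _
  have hprod : MemLp (fun x => (V x : ℂ) * φ x) 2 (volume.restrict K) :=
    hφ.mul hVK
  have hind : K.indicator (fun x => (V x : ℂ) * φ x) = fun x => (V x : ℂ) * φ x := by
    ext x
    by_cases hx : x ∈ K
    · simp [hx]
    · simp [hx, image_eq_zero_of_notMem_tsupport hx]
  rw [← hind]
  exact ((memLp_indicator_iff_restrict (isClosed_tsupport _).measurableSet).2 hprod).restrict _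

variable (Ω) in
/-- The embedding of `C₀^∞(Ω)` into `L²(Ω)`. -/
def testToL2 : 𝓓(Ω, ℂ) →ₗ[ℂ] L2 Ω where
  toFun φ := (testFunction_memLp φ).toLp φ
  map_add' _ _ := rfl
  map_smul' _ _ := rfl

lemma testToL2_injective : Function.Injective (testToL2 Ω) := by
  intro φ ψ h
  have hae : (φ : Rn n → ℂ) =ᵐ[volume.restrict (Ω : Set (Rn n))] ψ :=
    (MemLp.toLp_eq_toLp_iff (testFunction_memLp φ) (testFunction_memLp ψ)).1 h
  have hEq := Measure.eqOn_open_of_ae_eq hae Ω.isOpen φ.continuous.continuousOn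
    ψ.continuous.continuousOn
  ext x
  by_cases hx : x ∈ (Ω : Set (Rn n))
  · exact hEq hx
  · rw [image_eq_zero_of_notMem_tsupport (fun h => hx (φ.tsupport_subset h)),
      image_eq_zero_of_notMem_tsupport (fun h => hx (ψ.tsupport_subset h))]

/-- The map `φ ↦ -Δφ + Vφ` from `C₀^∞(Ω)` to `L²(Ω)`. -/
def schrodingerMap (V : Rn n → ℝ) (hV : LocEssBdd Ω V) : 𝓓(Ω, ℂ) →ₗ[ℂ] L2 Ω where
  toFun φ := ((laplacian_memLp φ).neg.add (potential_memLp hV φ)).toLp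
    (-Δ (φ : Rn n → ℂ) + fun x => (V x : ℂ) * φ x)
  map_add' φ ψ := by
    rw [← MemLp.toLp_add]
    refine (MemLp.toLp_eq_toLp_iff _ _).2 (Eventually.of_forall fun x => ?_)
    have h2 (χ : 𝓓(Ω, ℂ)) : ContDiffAt ℝ 2 (χ : Rn n → ℂ) x :=
      (χ.contDiff.of_le two_le_smooth).contDiffAt
    have := (h2 φ).laplacian_add (h2 ψ)
    simp only [Pi.add_apply, Pi.neg_apply, FunLike.coe_add, this]
    ring
  map_smul' c φ := by
    rw [RingHom.id_apply, ← MemLp.toLp_const_smul]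
    refine (MemLp.toLp_eq_toLp_iff _ _).2 (Eventually.of_forall fun x => ?_)
    have h2 : ContDiff ℝ 2 (φ : Rn n → ℂ) := φ.contDiff.of_le two_le_smooth
    have := h2.contDiffAt (x := x) |>.laplacian_CLM_comp_left
      (l := (ContinuousLinearMap.mul ℝ ℂ c))
    have h3 : Δ (c • (φ : Rn n → ℂ)) x = c * Δ (φ : Rn n → ℂ) x := this
    simp only [Pi.add_apply, Pi.neg_apply, Pi.smul_apply, FunLike.coe_smul, h3, smul_eq_mul]
    ring

variable (Ω) in
/-- The Schrödinger operator `H = -Δ + V` in `L²(Ω)` with domain `D(H) = C₀^∞(Ω)`. -/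
def schrodinger (V : Rn n → ℝ) (hV : LocEssBdd Ω V) : L2 Ω →ₗ.[ℂ] L2 Ω where
  domain := LinearMap.range (testToL2 Ω)
  toFun := schrodingerMap V hV ∘ₗ
    (LinearEquiv.ofInjective (testToL2 Ω) testToL2_injective).symm.toLinearMap

/-- A densely defined symmetric operator in a complex Hilbert space is essentially self-adjoint if
its closure is self-adjoint. -/
def IsEssentiallySelfAdjoint {E : Type*} [NormedAddCommGroup E] [InnerProductSpace ℂ E]
    [CompleteSpace E] (A : E →ₗ.[ℂ] E) : Prop :=
  Dense (A.domain : Set E) ∧ A.IsFormalAdjoint A ∧ A.IsClosable ∧ IsSelfAdjoint A.closure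

end SchrodingerESA

end

/-! Let K bound |V₂|. Since V + K + 1 ≥ V₁ + 1 ≥ 1, essential self-adjointness reduces
(`isEssentiallySelfAdjoint_of_coercive`) to this: an L² function u orthogonal to the range of H + K
+ 1 vanishes. The conjugate w of u, extended by zero, is a weak solution of -Δw + c w = 0 in Ω with
c = V + K + 1.

Kato's inequality Δ|w| ≥ c|w| (`kato_inequality`) discards the phase of w: if χ ≥ 0 has compact
support in Ω and Δχ ≤ b, then ∫ c|w|χ ≤ ∫ |w|b. The test function is χ = H(d) with H nondecreasing.
A C² boundary admits exterior balls of one radius r, so at every point of Ω the function d is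
touched from above by the distance to such a ball (`exists_touching_ball`). Hence Δd ≤ n/r in the
barrier sense, and Δχ ≤ H''(d) + C H'(d) with C = n/r. Neither d nor χ has to be smooth, because the
argument runs on second differences.

The rest is one-dimensional. Let W(t) be the lower bound for V₁ at d = t, P = L₁⋯L_{p-1} and σ = ∑
(L₁⋯L_i)⁻¹. The function (tP)^(-1/2) has logarithmic derivative -(1-σ)/(2t) and nearly solves φ'' =
(3/4 - σ)t⁻²φ. Adding a correction g to the logarithmic derivative, with ∫g bounded near 0, absorbs
both the defect and f/t. This gives φ > 0 with φ'' ≤ Wφ and φ² ≥ const/(tP) (`exists_comparison`).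
As (tP)⁻¹ = -L_p', φ is not square integrable at 0 (`exists_comparison_iterLog`).

By reduction of order, H is built as φ times a primitive of θφ⁻²e^(-Ct), where the cutoff θ rises
from 0 at ε₀ to 1 at ε₁ with density φ²/M, M = ∫φ² over (ε₀, ε₁). Then H'' + CH' ≤ WH + φ/M, the
last term being present only on (ε₀, ε₁) (`ae_hasDerivAt_cutSol'`). Since c ≥ W(d) + 1 near the
boundary, Kato's inequality yields ∫|w|H(d) ≤ M⁻¹∫|w|φ(d) over ε₀ < d < ε₁. Near the boundary the
distribution of d is at most A times Lebesgue measure (`exists_tube_bound`), so ∫φ(d)² ≤ AM and the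
right side is O(M^(-1/2)). As ε₀ → 0, M tends to infinity, while H(d) stays above a fixed positive
function on {d > ε₁}. So w = 0 there, for every ε₁ (`ae_eq_zero_of_weak_solution`). -/

namespace SchrodingerESA

noncomputable section

/-! ### Abstract criterion for essential self-adjointness -/

section AbstractCriterion

variable {E : Type*} [NormedAddCommGroup E] [InnerProductSpace ℂ E]

lemma mem_graph_closure_iff {A : E →ₗ.[ℂ] E} (hA : A.IsClosable) (z : E × E) :
    z ∈ A.closure.graph ↔ z ∈ closure (A.graph : Set (E × E)) := by
  rw [← hA.graph_closure_eq_closure_graph]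
  exact Iff.rfl

variable [CompleteSpace E]

lemma isClosable_of_isFormalAdjoint {A : E →ₗ.[ℂ] E} (hd : Dense (A.domain : Set E))
    (hs : A.IsFormalAdjoint A) : A.IsClosable :=
  (LinearPMap.adjoint_isClosed hd).isClosable.leIsClosable (hs.le_adjoint hd)

lemma isFormalAdjoint_closure {A : E →ₗ.[ℂ] E} (hd : Dense (A.domain : Set E))
    (hs : A.IsFormalAdjoint A) : A.closure.IsFormalAdjoint A.closure := by
  have hc := isClosable_of_isFormalAdjoint hd hs
  have h1 : ∀ z ∈ closure (A.graph : Set (E × E)), ∀ y : A.domain,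
      inner ℂ z.2 (y : E) = inner ℂ z.1 (A y) := by
    intro z hz y
    refine closure_minimal (t := {z : E × E | inner ℂ z.2 (y : E) = inner ℂ z.1 (A y)}) ?_
      (isClosed_eq (by fun_prop) (by fun_prop)) hz
    rintro ⟨a, b⟩ hab
    obtain ⟨x, rfl, rfl⟩ := (LinearPMap.mem_graph_iff A).1 hab
    exact hs x y
  have h2 : ∀ z ∈ closure (A.graph : Set (E × E)), ∀ w ∈ closure (A.graph : Set (E × E)),
      inner ℂ z.2 w.1 = inner ℂ z.1 w.2 := by
    intro z hz w hw
    refine closure_minimal (t := {w : E × E | inner ℂ z.2 w.1 = inner ℂ z.1 w.2}) ?_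
      (isClosed_eq (by fun_prop) (by fun_prop)) hw
    rintro ⟨a, b⟩ hab
    obtain ⟨x, rfl, rfl⟩ := (LinearPMap.mem_graph_iff A).1 hab
    exact h1 z hz x
  intro x y
  exact h2 _ ((mem_graph_closure_iff hc _).1 (LinearPMap.mem_graph _ x)) _
    ((mem_graph_closure_iff hc _).1 (LinearPMap.mem_graph _ y))

/-- A densely defined symmetric operator `A` with `A + lam ≥ 1` is essentially self-adjoint if
`A + lam` has dense range. -/
theorem isEssentiallySelfAdjoint_of_coercive {A : E →ₗ.[ℂ] E}
    (hd : Dense (A.domain : Set E)) (hs : A.IsFormalAdjoint A) (lam : ℝ)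
    (hlow : ∀ x : A.domain, ‖(x : E)‖ ^ 2 ≤ (inner ℂ (x : E) (A x + (lam : ℂ) • (x : E))).re)
    (hker : ∀ u : E, (∀ x : A.domain, inner ℂ u (A x + (lam : ℂ) • (x : E)) = 0) → u = 0) :
    IsEssentiallySelfAdjoint A := by
  have hc := isClosable_of_isFormalAdjoint hd hs
  have hsT := isFormalAdjoint_closure hd hs
  set T := A.closure with hT
  have hAT : A ≤ T := A.le_closure
  have hdT : Dense (T.domain : Set E) := hd.mono hAT.1
  refine ⟨hd, hs, hc, ?_⟩
  rw [LinearPMap.isSelfAdjoint_def]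
  let L : E × E →L[ℂ] E :=
    ContinuousLinearMap.snd ℂ E E + (lam : ℂ) • ContinuousLinearMap.fst ℂ E E
  have hL : ∀ z : E × E, L z = z.2 + (lam : ℂ) • z.1 := fun z => rfl
  -- Coercivity is a closed condition on the graph, so it passes from `A` to its closure.
  have hnorm : ∀ z ∈ T.graph, ‖z.1‖ ≤ ‖L z‖ := by
    intro z hz
    have hsq : ‖z.1‖ ^ 2 ≤ (inner ℂ z.1 (L z)).re := by
      refine closure_minimal (t := {z : E × E | ‖z.1‖ ^ 2 ≤ (inner ℂ z.1 (L z)).re}) ?_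
        (isClosed_le (by fun_prop) (by fun_prop)) ((mem_graph_closure_iff hc z).1 hz)
      rintro ⟨a, b⟩ hab
      obtain ⟨x, rfl, rfl⟩ := (LinearPMap.mem_graph_iff A).1 hab
      exact hlow x
    have h2 : (inner ℂ z.1 (L z)).re ≤ ‖z.1‖ * ‖L z‖ := re_inner_le_norm (𝕜 := ℂ) _ _
    by_contra! hlt
    nlinarith [norm_nonneg (L z), norm_nonneg z.1]
  have hclosed : IsClosed (T.graph : Set (E × E)) := hc.closure_isClosed
  have : CompleteSpace T.graph := hclosed.completeSpace_coe
  let Lg : T.graph →L[ℂ] E := L.comp T.graph.subtypeL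
  have hanti : AntilipschitzWith (2 + ‖lam‖₊) Lg := by
    refine ContinuousLinearMap.antilipschitz_of_bound _ fun z => ?_
    have h1 := hnorm z z.2
    have h2 : ‖(z : E × E).2‖ ≤ ‖L z‖ + ‖lam‖ * ‖(z : E × E).1‖ := by
      have : (z : E × E).2 = L z - (lam : ℂ) • (z : E × E).1 := by rw [hL]; abel
      rw [this]
      refine (norm_sub_le _ _).trans ?_
      simp [norm_smul]
    change max ‖(z : E × E).1‖ ‖(z : E × E).2‖ ≤ (2 + ‖lam‖) * ‖L z‖
    have := norm_nonneg lam
    have h3 := norm_nonneg (L z)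
    refine max_le (by nlinarith) ?_
    nlinarith [mul_le_mul_of_nonneg_left h1 this]
  -- T + lam is bounded below on a complete graph, so its range is closed; `hker` then leaves no
  -- room for an orthogonal complement.
  have hrange : IsClosed (Set.range Lg) := hanti.isClosed_range Lg.uniformContinuous
  have htop : LinearMap.range (Lg : T.graph →ₗ[ℂ] E) = ⊤ := by
    have hcl : IsClosed (LinearMap.range (Lg : T.graph →ₗ[ℂ] E) : Set E) := by
      rw [LinearMap.coe_range]; exact hrange
    have : CompleteSpace (LinearMap.range (Lg : T.graph →ₗ[ℂ] E)) := hcl.completeSpace_coe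
    rw [← Submodule.orthogonal_eq_bot_iff, Submodule.eq_bot_iff]
    intro u hu
    refine hker u fun x => ?_
    have hx : ((x : E), A x) ∈ T.graph := LinearPMap.le_graph_of_le hAT (LinearPMap.mem_graph _ x)
    exact (Submodule.mem_orthogonal' _ u).1 hu _ ⟨⟨_, hx⟩, rfl⟩
  refine (LinearPMap.eq_of_le_of_domain_eq (hsT.le_adjoint hdT) ?_).symm
  refine le_antisymm (hsT.le_adjoint hdT).1 fun x hx => ?_
  -- Surjectivity provides y in the domain of T with (T + lam)y = (T* + lam)x. Then x - y is
  -- orthogonal to the range of A + lam, so x = y.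
  obtain ⟨⟨z, hz⟩, hz'⟩ : (T.adjoint ⟨x, hx⟩ + (lam : ℂ) • x : E) ∈
      LinearMap.range (Lg : T.graph →ₗ[ℂ] E) := htop ▸ Submodule.mem_top
  obtain ⟨y, hy1, hy2⟩ := (LinearPMap.mem_graph_iff T).1 hz
  have hzeq : T y + (lam : ℂ) • (y : E) = T.adjoint ⟨x, hx⟩ + (lam : ℂ) • x := by
    rw [← hz', hy1, hy2]; rfl
  have hxy : x - y = 0 := by
    refine hker _ fun a => ?_
    obtain ⟨a', ha'⟩ : ∃ a' : T.domain, (a' : E) = a := ⟨⟨a, hAT.1 a.2⟩, rfl⟩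
    have hTa : A a = T a' := hAT.2 ha'.symm
    have e1 : inner ℂ (T.adjoint ⟨x, hx⟩) (a' : E) = inner ℂ x (T a') :=
      LinearPMap.adjoint_isFormalAdjoint hdT ⟨x, hx⟩ a'
    have e2 : inner ℂ (T y) (a' : E) = inner ℂ (y : E) (T a') := hsT y a'
    have e3 := congrArg (fun w => inner ℂ w (a' : E)) hzeq
    simp only [inner_add_left, inner_smul_left, Complex.conj_ofReal] at e3
    rw [hTa, ← ha']
    simp only [inner_add_right, inner_sub_left, inner_smul_right, ← e1, ← e2]
    linear_combination -e3
  rw [sub_eq_zero] at hxy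
  exact hxy ▸ y.2

end AbstractCriterion

/-! ### Symmetry, density and coercivity on test functions -/

section TestFunctions

variable {n : ℕ} {Ω : Opens (Rn n)}

/-- A test function on `Ω`, regarded as a Schwartz function on `ℝⁿ`. -/
def toSchwartz (φ : 𝓓(Ω, ℂ)) : SchwartzMap (Rn n) ℂ :=
  φ.hasCompactSupport.toSchwartzMap φ.contDiff

lemma toSchwartz_apply (φ : 𝓓(Ω, ℂ)) (x : Rn n) : toSchwartz φ x = φ x := rfl

lemma laplacian_toSchwartz (φ : 𝓓(Ω, ℂ)) (x : Rn n) :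
    Δ (toSchwartz φ) x = Δ (φ : Rn n → ℂ) x :=
  SchwartzMap.laplacian_apply _ _

/-- The real bilinear map `(z, w) ↦ conj z * w`. -/
def conjMul : ℂ →L[ℝ] ℂ →L[ℝ] ℂ :=
  (ContinuousLinearMap.mul ℝ ℂ).comp (Complex.conjCLE : ℂ →L[ℝ] ℂ)

lemma conjMul_apply (z w : ℂ) : conjMul z w = (starRingEnd ℂ) z * w := rfl

lemma integral_conj_laplacian_symm (φ ψ : 𝓓(Ω, ℂ)) :
    ∫ x, (starRingEnd ℂ) (φ x) * Δ (ψ : Rn n → ℂ) x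
      = ∫ x, (starRingEnd ℂ) (Δ (φ : Rn n → ℂ) x) * ψ x := by
  have h := SchwartzMap.integral_bilinear_laplacian_right_eq_left (μ := volume) (toSchwartz φ)
    (toSchwartz ψ) conjMul
  simpa only [conjMul_apply, laplacian_toSchwartz, toSchwartz_apply] using h

/-- Integration by parts in each coordinate direction turns the integral into -∑ ∫ |∂ᵢφ|²; on
Schwartz functions there are no boundary terms. -/
lemma integral_conj_laplacian_self_nonpos (φ : 𝓓(Ω, ℂ)) :
    (∫ x, (starRingEnd ℂ) (φ x) * Δ (φ : Rn n → ℂ) x).re ≤ 0 := by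
  have h : ∫ x, (starRingEnd ℂ) (φ x) * Δ (φ : Rn n → ℂ) x
      = ∫ x, conjMul (toSchwartz φ x) (Δ (toSchwartz φ) x) := by
    simp only [conjMul_apply, laplacian_toSchwartz, toSchwartz_apply]
  rw [h]
  simp_rw [SchwartzMap.laplacian_eq_sum (stdOrthonormalBasis ℝ (Rn n)), sum_apply,
    map_sum]
  rw [MeasureTheory.integral_finsetSum, Complex.re_sum]
  · refine Finset.sum_nonpos fun i _ => ?_
    rw [SchwartzMap.integral_bilinear_lineDerivOp_right_eq_neg_left]
    simp_rw [conjMul_apply, ← Complex.normSq_eq_conj_mul_self]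
    rw [integral_complex_ofReal, Complex.neg_re, Complex.ofReal_re]
    exact neg_nonpos.2 (integral_nonneg fun x => Complex.normSq_nonneg _)
  · exact fun _ _ => (SchwartzMap.pairing conjMul (toSchwartz φ) _).integrable

lemma schrodinger_apply (V : Rn n → ℝ) (hV : LocEssBdd Ω V) (φ : 𝓓(Ω, ℂ))
    (h : testToL2 Ω φ ∈ (schrodinger Ω V hV).domain) :
    schrodinger Ω V hV ⟨testToL2 Ω φ, h⟩ = schrodingerMap V hV φ := by
  change schrodingerMap V hV ((LinearEquiv.ofInjective (testToL2 Ω) testToL2_injective).symm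
    ⟨testToL2 Ω φ, h⟩) = _
  congr 1
  rw [LinearEquiv.symm_apply_eq]
  rfl

lemma coeFn_testToL2 (φ : 𝓓(Ω, ℂ)) :
    testToL2 Ω φ =ᵐ[volume.restrict (Ω : Set (Rn n))] φ :=
  MemLp.coeFn_toLp (testFunction_memLp φ)

lemma coeFn_schrodingerMap (V : Rn n → ℝ) (hV : LocEssBdd Ω V) (φ : 𝓓(Ω, ℂ)) :
    schrodingerMap V hV φ =ᵐ[volume.restrict (Ω : Set (Rn n))]
      fun x => -Δ (φ : Rn n → ℂ) x + (V x : ℂ) * φ x :=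
  MemLp.coeFn_toLp ((laplacian_memLp φ).neg.add (potential_memLp hV φ))

/-- This is the fundamental lemma of the calculus of variations applied to a function orthogonal to
all test functions; real-valued ones already suffice. -/
lemma dense_range_testToL2 : Dense (LinearMap.range (testToL2 Ω) : Set (L2 Ω)) := by
  rw [Submodule.dense_iff_topologicalClosure_eq_top, Submodule.topologicalClosure_eq_top_iff,
    Submodule.eq_bot_iff]
  intro u hu
  have hloc : LocallyIntegrableOn (u : Rn n → ℂ) (Ω : Set (Rn n)) volume := by
    intro x hx
    obtain ⟨K, hK, hxK, hKΩ⟩ := exists_compact_subset Ω.isOpen hx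
    refine ⟨K, mem_nhdsWithin_of_mem_nhds (mem_interior_iff_mem_nhds.1 hxK), ?_⟩
    have h2 : MemLp u 2 (volume.restrict K) :=
      (Lp.memLp u).mono_measure (Measure.restrict_mono hKΩ le_rfl)
    have : IsFiniteMeasure (volume.restrict K) := ⟨by simpa using hK.measure_lt_top⟩
    exact h2.integrable (by norm_num)
  have h0 : ∀ᵐ x ∂volume, x ∈ (Ω : Set (Rn n)) → (u : Rn n → ℂ) x = 0 := by
    refine Ω.isOpen.ae_eq_zero_of_integral_contDiff_smul_eq_zero hloc fun g hg hgc hgs => ?_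
    let φ : 𝓓(Ω, ℂ) := ⟨fun x => (g x : ℂ), Complex.ofRealCLM.contDiff.comp hg,
      hgc.comp_left (g := fun y : ℝ => (y : ℂ)) (by simp),
      (tsupport_comp_subset (g := fun y : ℝ => (y : ℂ)) (by simp) g).trans hgs⟩
    have h1 := (Submodule.mem_orthogonal _ u).1 hu _ ⟨φ, rfl⟩
    rw [L2.inner_def] at h1
    rw [← h1, ← setIntegral_eq_integral_of_forall_compl_eq_zero (s := (Ω : Set (Rn n)))]
    · refine integral_congr_ae ?_
      filter_upwards [coeFn_testToL2 φ] with x hx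
      rw [hx, RCLike.inner_apply]
      change (g x) • u x = u x * (starRingEnd ℂ) (g x : ℂ)
      simp [mul_comm]
    · intro x hx
      rw [image_eq_zero_of_notMem_tsupport fun h => hx (hgs h), zero_smul]
  refine (Lp.eq_zero_iff_ae_eq_zero).2 ?_
  rw [EventuallyEq, ae_restrict_iff' Ω.isOpen.measurableSet]
  exact h0

lemma inner_schrodingerMap (V : Rn n → ℝ) (hV : LocEssBdd Ω V) (lam : ℝ) (u : L2 Ω)
    (φ : 𝓓(Ω, ℂ)) :
    inner ℂ u (schrodingerMap V hV φ + (lam : ℂ) • testToL2 Ω φ)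
      = ∫ x in (Ω : Set (Rn n)), (starRingEnd ℂ) (u x) *
          (-Δ (φ : Rn n → ℂ) x + ((V x + lam : ℝ) : ℂ) * φ x) := by
  rw [L2.inner_def]
  refine integral_congr_ae ?_
  filter_upwards [coeFn_testToL2 φ, coeFn_schrodingerMap V hV φ,
    Lp.coeFn_add (schrodingerMap V hV φ) ((lam : ℂ) • testToL2 Ω φ),
    Lp.coeFn_smul (lam : ℂ) (testToL2 Ω φ)] with x h1 h2 h3 h4
  rw [h3, Pi.add_apply, h4, Pi.smul_apply, h1, h2, RCLike.inner_apply]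
  push_cast
  simp only [smul_eq_mul]
  ring

lemma laplacian_eq_zero_of_notMem (φ : 𝓓(Ω, ℂ)) {x : Rn n} (hx : x ∉ Ω) :
    Δ (φ : Rn n → ℂ) x = 0 := by
  have h : (φ : Rn n → ℂ) =ᶠ[𝓝 x] fun _ => 0 :=
    notMem_tsupport_iff_eventuallyEq.1 fun h => hx (φ.tsupport_subset h)
  rw [(InnerProductSpace.laplacian_congr_nhds h).self_of_nhds]
  simp

lemma integrable_conj_mul_laplacian (φ ψ : 𝓓(Ω, ℂ)) :
    Integrable (fun x => (starRingEnd ℂ) (φ x) * Δ (ψ : Rn n → ℂ) x) := by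
  have := (SchwartzMap.pairing conjMul (toSchwartz φ) (Δ (toSchwartz ψ))).integrable
    (μ := (volume : Measure (Rn n)))
  refine this.congr (Eventually.of_forall fun x => ?_)
  simp only [SchwartzMap.pairing_apply_apply, conjMul_apply, laplacian_toSchwartz,
    toSchwartz_apply]

lemma integrable_potential (V : Rn n → ℝ) (hV : LocEssBdd Ω V) (lam : ℝ) (φ ψ : 𝓓(Ω, ℂ)) :
    IntegrableOn (fun x => (starRingEnd ℂ) (φ x) * (((V x + lam : ℝ) : ℂ) * ψ x))
      (Ω : Set (Rn n)) := by
  have h1 : MemLp (fun x => ((V x + lam : ℝ) : ℂ) * ψ x) 2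
      (volume.restrict (Ω : Set (Rn n))) := by
    refine ((potential_memLp hV ψ).add ((testFunction_memLp ψ).const_mul (lam : ℂ))).ae_eq
      (Eventually.of_forall fun x => ?_)
    simp only [Pi.add_apply]
    push_cast
    ring
  exact (testFunction_memLp φ).star.integrable_mul h1

lemma inner_testToL2_schrodingerMap (V : Rn n → ℝ) (hV : LocEssBdd Ω V) (lam : ℝ)
    (φ ψ : 𝓓(Ω, ℂ)) :
    inner ℂ (testToL2 Ω φ) (schrodingerMap V hV ψ + (lam : ℂ) • testToL2 Ω ψ)
      = -(∫ x, (starRingEnd ℂ) (φ x) * Δ (ψ : Rn n → ℂ) x)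
        + ∫ x in (Ω : Set (Rn n)), (starRingEnd ℂ) (φ x) * (((V x + lam : ℝ) : ℂ) * ψ x) := by
  have h0 : ∫ x, (starRingEnd ℂ) (φ x) * Δ (ψ : Rn n → ℂ) x
      = ∫ x in (Ω : Set (Rn n)), (starRingEnd ℂ) (φ x) * Δ (ψ : Rn n → ℂ) x :=
    (setIntegral_eq_integral_of_forall_compl_eq_zero
      (fun x hx => by rw [laplacian_eq_zero_of_notMem ψ hx, mul_zero])).symm
  rw [inner_schrodingerMap, h0, neg_add_eq_sub, ← integral_sub (integrable_potential V hV lam φ ψ)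
    (integrable_conj_mul_laplacian φ ψ).integrableOn]
  refine integral_congr_ae ?_
  filter_upwards [coeFn_testToL2 φ] with x hx
  rw [hx]
  ring

lemma exists_testFunction (V : Rn n → ℝ) (hV : LocEssBdd Ω V)
    (x : (schrodinger Ω V hV).domain) :
    ∃ φ : 𝓓(Ω, ℂ), (x : L2 Ω) = testToL2 Ω φ ∧ schrodinger Ω V hV x = schrodingerMap V hV φ := by
  obtain ⟨x, hx⟩ := x
  obtain ⟨φ, hφ⟩ := id hx
  subst hφ
  exact ⟨φ, rfl, schrodinger_apply V hV φ hx⟩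

lemma isFormalAdjoint_schrodinger (V : Rn n → ℝ) (hV : LocEssBdd Ω V) :
    (schrodinger Ω V hV).IsFormalAdjoint (schrodinger Ω V hV) := by
  intro x y
  obtain ⟨φ, hφ, hφ'⟩ := exists_testFunction V hV x
  obtain ⟨ψ, hψ, hψ'⟩ := exists_testFunction V hV y
  rw [hφ, hφ', hψ, hψ', ← inner_conj_symm]
  have h1 := inner_testToL2_schrodingerMap V hV 0 φ ψ
  have h2 := inner_testToL2_schrodingerMap V hV 0 ψ φ
  simp only [Complex.ofReal_zero, zero_smul, add_zero] at h1 h2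
  rw [h1, h2, map_add, map_neg, ← integral_conj, ← integral_conj, integral_conj_laplacian_symm]
  simp only [map_mul, Complex.conj_conj, Complex.conj_ofReal]
  congr 1
  · simp only [mul_comm]
  · refine integral_congr_ae (Eventually.of_forall fun x => ?_)
    ring

lemma coercive_schrodinger (V : Rn n → ℝ) (hV : LocEssBdd Ω V) (lam : ℝ)
    (hlam : ∀ᵐ x ∂volume.restrict (Ω : Set (Rn n)), 1 ≤ V x + lam)
    (x : (schrodinger Ω V hV).domain) :
    ‖(x : L2 Ω)‖ ^ 2 ≤ (inner ℂ (x : L2 Ω) (schrodinger Ω V hV x + (lam : ℂ) • (x : L2 Ω))).re := by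
  obtain ⟨φ, hφ, hφ'⟩ := exists_testFunction V hV x
  rw [hφ, hφ', inner_testToL2_schrodingerMap, Complex.add_re, Complex.neg_re]
  have h1 := integral_conj_laplacian_self_nonpos φ
  have e1 : ∀ x, (starRingEnd ℂ) (φ x) * (((V x + lam : ℝ) : ℂ) * φ x)
      = (((V x + lam) * ‖φ x‖ ^ 2 : ℝ) : ℂ) := fun x => by
    rw [mul_left_comm, Complex.conj_mul']
    push_cast
    ring
  have hint := integrable_potential V hV lam φ φ
  simp_rw [e1] at hint ⊢
  rw [integral_complex_ofReal, Complex.ofReal_re]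
  have h2 : ‖testToL2 Ω φ‖ ^ 2 = ∫ x in (Ω : Set (Rn n)), ‖φ x‖ ^ 2 := by
    rw [← inner_self_eq_norm_sq (𝕜 := ℂ), L2.inner_def, ← integral_re (L2.integrable_inner _ _)]
    refine integral_congr_ae ?_
    filter_upwards [coeFn_testToL2 φ] with x hx
    rw [hx, inner_self_eq_norm_sq]
  have h3 : ∫ x in (Ω : Set (Rn n)), ‖φ x‖ ^ 2
      ≤ ∫ x in (Ω : Set (Rn n)), (V x + lam) * ‖φ x‖ ^ 2 := by
    refine integral_mono_ae ((testFunction_memLp φ).integrable_norm_pow (by norm_num))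
      hint.re ?_
    filter_upwards [hlam] with x hx
    exact le_mul_of_one_le_left (sq_nonneg _) hx
  linarith

end TestFunctions

/-! ### Convergence of mollifications in L¹ -/

section Mollification

open scoped Convolution
open ContinuousLinearMap (lsmul)

variable {n : ℕ}

/-- Translations act continuously on L¹. -/
lemma tendsto_lintegral_translate_sub {g : Rn n → ℂ} (hg : Integrable g) :
    Tendsto (fun y => ∫⁻ x, ‖g (x - y) - g x‖ₑ) (𝓝 0) (𝓝 0) := by
  have hm : MemLp g 1 volume := memLp_one_iff_integrable.2 hg
  have : Fact ((1 : ℝ≥0∞) ≠ ∞) := ⟨by simp⟩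
  have hF : Continuous fun y : Rn n =>
      edist ((DomAddAct.mk (-y)) +ᵥ hm.toLp g : Lp ℂ 1 (volume : Measure (Rn n))) (hm.toLp g) := by
    have h1 : Continuous fun y : Rn n => DomAddAct.mk (-y) :=
      DomAddAct.continuous_mk.comp continuous_neg
    exact (h1.vadd continuous_const).edist continuous_const
  have h0 : edist ((DomAddAct.mk (-(0 : Rn n))) +ᵥ hm.toLp g : Lp ℂ 1 (volume : Measure (Rn n)))
      (hm.toLp g) = 0 := by
    rw [neg_zero, DomAddAct.mk_zero, zero_vadd, edist_self]
  have h1 := hF.tendsto 0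
  rw [h0] at h1
  refine h1.congr fun y => ?_
  rw [DomAddAct.mk_vadd_toLp, Lp.edist_toLp_toLp, eLpNorm_one_eq_lintegral_enorm]
  refine lintegral_congr fun x => ?_
  simp only [Pi.sub_apply, vadd_eq_add, neg_add_eq_sub]

/-- The mollification minus g is an average of translates of g minus g, with weights of total mass
one; Tonelli moves the L¹ norm inside the average. -/
lemma lintegral_mollify_sub_le {g : Rn n → ℂ} (hg : Integrable g) (φ : ContDiffBump (0 : Rn n))
    {ε : ℝ≥0∞} (hε : ∀ y, ‖y‖ < φ.rOut → ∫⁻ x, ‖g (x - y) - g x‖ₑ ≤ ε) :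
    ∫⁻ x, ‖(φ.normed volume ⋆[lsmul ℝ ℝ, volume] g) x - g x‖ₑ ≤ ε := by
  have hex : ∀ x, Integrable fun y => φ.normed volume y • g (x - y) := fun x =>
    φ.hasCompactSupport_normed.convolutionExists_left (lsmul ℝ ℝ) φ.continuous_normed
      hg.locallyIntegrable x
  have hconst : ∀ x, Integrable fun y => φ.normed volume y • g x := fun x =>
    φ.integrable_normed.smul_const _
  have h1 : ∀ x, ‖(φ.normed volume ⋆[lsmul ℝ ℝ, volume] g) x - g x‖ₑ
      ≤ ∫⁻ y, ‖φ.normed volume y‖ₑ * ‖g (x - y) - g x‖ₑ := by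
    intro x
    have : (φ.normed volume ⋆[lsmul ℝ ℝ, volume] g) x - g x
        = ∫ y, φ.normed volume y • (g (x - y) - g x) := by
      simp_rw [smul_sub]
      rw [integral_sub (hex x) (hconst x), φ.integral_normed_smul]
      rfl
    rw [this]
    refine (enorm_integral_le_lintegral_enorm _).trans_eq ?_
    simp_rw [enorm_smul]
  have hmeas : AEMeasurable (Function.uncurry fun x y =>
      ‖φ.normed volume y‖ₑ * ‖g (x - y) - g x‖ₑ)
      ((volume : Measure (Rn n)).prod (volume : Measure (Rn n))) := by
    have e1 : AEStronglyMeasurable (fun p : Rn n × Rn n => g (p.1 - p.2)) (volume.prod volume) :=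
      hg.1.comp_quasiMeasurePreserving
        (quasiMeasurePreserving_sub_of_right_invariant volume volume)
    have e2 : AEStronglyMeasurable (fun p : Rn n × Rn n => g p.1) (volume.prod volume) :=
      hg.1.comp_fst
    have e3 : Measurable fun p : Rn n × Rn n => ‖φ.normed volume p.2‖ₑ :=
      (φ.continuous_normed.comp continuous_snd).enorm.measurable
    exact e3.aemeasurable.mul (e1.sub e2).enorm
  calc ∫⁻ x, ‖(φ.normed volume ⋆[lsmul ℝ ℝ, volume] g) x - g x‖ₑ
      ≤ ∫⁻ x, ∫⁻ y, ‖φ.normed volume y‖ₑ * ‖g (x - y) - g x‖ₑ := lintegral_mono h1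
    _ = ∫⁻ y, ∫⁻ x, ‖φ.normed volume y‖ₑ * ‖g (x - y) - g x‖ₑ := lintegral_lintegral_swap hmeas
    _ ≤ ∫⁻ y, ‖φ.normed volume y‖ₑ * ε := by
        refine lintegral_mono fun y => ?_
        simp only
        rw [lintegral_const_mul' _ _ enorm_ne_top]
        by_cases hy : ‖y‖ < φ.rOut
        · gcongr
          exact hε y hy
        · have : φ.normed volume y = 0 := by
            rw [← Function.notMem_support, φ.support_normed_eq]
            simpa using hy
          simp [this]
    _ = ε := by
        rw [lintegral_mul_const _ φ.continuous_normed.enorm.measurable]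
        have : ∫⁻ y, ‖φ.normed volume y‖ₑ = 1 := by
          simp_rw [Real.enorm_eq_ofReal (φ.nonneg_normed _)]
          rw [← ofReal_integral_eq_lintegral_ofReal φ.integrable_normed
            (Eventually.of_forall φ.nonneg_normed), φ.integral_normed, ENNReal.ofReal_one]
        rw [this, one_mul]

/-- Mollifications of an integrable function converge to it in `L¹`. -/
lemma tendsto_integral_norm_mollify_sub {g : Rn n → ℂ} (hg : Integrable g)
    {φ : ℕ → ContDiffBump (0 : Rn n)} (hφ : Tendsto (fun k => (φ k).rOut) atTop (𝓝 0)) :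
    Tendsto (fun k => ∫ x, ‖((φ k).normed volume ⋆[lsmul ℝ ℝ, volume] g) x - g x‖)
      atTop (𝓝 0) := by
  have hint : ∀ k, Integrable ((φ k).normed volume ⋆[lsmul ℝ ℝ, volume] g) := fun k =>
    (φ k).integrable_normed.integrable_convolution _ hg
  have hE : Tendsto (fun k => ∫⁻ x, ‖((φ k).normed volume ⋆[lsmul ℝ ℝ, volume] g) x - g x‖ₑ)
      atTop (𝓝 0) := by
    rw [ENNReal.tendsto_nhds_zero]
    intro ε hε
    have h1 := (ENNReal.tendsto_nhds_zero.1 (tendsto_lintegral_translate_sub hg)) ε hε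
    obtain ⟨δ, hδ, hδε⟩ := Metric.eventually_nhds_iff.1 h1
    filter_upwards [hφ.eventually (gt_mem_nhds hδ)] with k hk
    exact lintegral_mollify_sub_le hg (φ k) fun y hy => hδε (by simpa using hy.trans hk)
  have := (ENNReal.tendsto_toReal (ENNReal.zero_ne_top)).comp hE
  refine this.congr fun k => ?_
  exact (integral_norm_eq_lintegral_enorm ((hint k).sub hg).1).symm

end Mollification

/-! ### Second differences and discrete summation by parts -/

section DiscreteLaplacian

variable {n : ℕ}

/-- The discrete Laplacian with step `h`. -/
def dlap {F : Type*} [AddCommGroup F] [Module ℝ F] (h : ℝ) (g : Rn n → F) (x : Rn n) : F :=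
  (h ^ 2)⁻¹ • ∑ i, (g (x + h • EuclideanSpace.single i (1 : ℝ))
    + g (x - h • EuclideanSpace.single i (1 : ℝ)) - (2 : ℝ) • g x)

/-- One application of l'Hôpital's rule leaves the difference quotient of `k'` at 0, so `k'` needs
to be differentiable at that point only. -/
lemma tendsto_second_difference {k k' : ℝ → ℝ} {c : ℝ} (hk : ∀ s, HasDerivAt k (k' s) s)
    (h0 : k' 0 = 0) (hc : HasDerivAt k' c 0) :
    Tendsto (fun h => (k h - k 0) / h ^ 2) (𝓝[>] 0) (𝓝 (c / 2)) := by
  refine HasDerivAt.lhopital_zero_nhdsGT (f := fun h => k h - k 0) (f' := k')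
    (g' := fun h => 2 * h)
    (Eventually.of_forall fun s => (hk s).sub_const _) (Eventually.of_forall fun s => ?_) ?_ ?_ ?_ ?_
  · simpa using hasDerivAt_pow 2 s
  · filter_upwards [self_mem_nhdsWithin] with s hs
    have : (0 : ℝ) < s := hs
    positivity
  · have := (hk 0).continuousAt.tendsto.mono_left (nhdsWithin_le_nhds (s := Set.Ioi 0))
    simpa using this.sub_const (k 0)
  · have : Tendsto (fun h : ℝ => h ^ 2) (𝓝 0) (𝓝 0) := by
      have h2 : Continuous fun h : ℝ => h ^ 2 := by fun_prop
      simpa using h2.tendsto 0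
    exact this.mono_left nhdsWithin_le_nhds
  · have h1 := hc.tendsto_slope.mono_left
      (nhdsWithin_mono 0 (fun x (hx : 0 < x) => (hx.ne' : x ≠ 0)))
    refine (h1.div_const 2).congr' ?_
    filter_upwards [self_mem_nhdsWithin] with s hs
    have hs0 : (0 : ℝ) < s := hs
    have : s ≠ 0 := hs0.ne'
    rw [slope_def_field, h0]
    field_simp
    ring

variable {g : Rn n → ℝ}

lemma hasDerivAt_line (hg : Differentiable ℝ g) (x e : Rn n) (s : ℝ) :
    HasDerivAt (fun s : ℝ => g (x + s • e)) (fderiv ℝ g (x + s • e) e) s := by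
  have h1 : HasDerivAt (fun s : ℝ => x + s • e) e s := by
    simpa using ((hasDerivAt_id s).smul_const e).const_add x
  exact (hg (x + s • e)).hasFDerivAt.comp_hasDerivAt s h1

lemma hasDerivAt_symm_sum (hg : Differentiable ℝ g) (x e : Rn n) (s : ℝ) :
    HasDerivAt (fun s : ℝ => g (x + s • e) + g (x - s • e))
      (fderiv ℝ g (x + s • e) e - fderiv ℝ g (x - s • e) e) s := by
  have h1 := hasDerivAt_line hg x e s
  have h2 := hasDerivAt_line hg x (-e) s
  simp only [smul_neg, ← sub_eq_add_neg, map_neg] at h2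
  rw [sub_eq_add_neg]
  exact h1.add h2

lemma tendsto_dlap (hg : ContDiff ℝ 2 g) (x : Rn n) :
    Tendsto (fun h => dlap h g x) (𝓝[>] 0) (𝓝 (Δ g x)) := by
  have hd : Differentiable ℝ g := hg.differentiable (by norm_num)
  have hd2 : Differentiable ℝ (fderiv ℝ g) :=
    (hg.fderiv_right (m := 1) (by norm_num)).differentiable (by norm_num)
  have hmain : ∀ e : Rn n, Tendsto (fun h : ℝ => (h ^ 2)⁻¹ *
      (g (x + h • e) + g (x - h • e) - 2 * g x)) (𝓝[>] 0) (𝓝 (iteratedFDeriv ℝ 2 g x ![e, e])) := by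
    intro e
    have hl : ∀ e' : Rn n, HasDerivAt (fun s : ℝ => fderiv ℝ g (x + s • e') e)
        (fderiv ℝ (fderiv ℝ g) x e' e) 0 := by
      intro e'
      have h1 : HasDerivAt (fun s : ℝ => x + s • e') e' 0 := by
        simpa using ((hasDerivAt_id (0 : ℝ)).smul_const e').const_add x
      have h2 : HasFDerivAt (fderiv ℝ g) (fderiv ℝ (fderiv ℝ g) x) (x + (0 : ℝ) • e') := by
        simpa using (hd2 x).hasFDerivAt
      have h3 := h2.comp_hasDerivAt (0 : ℝ) h1
      exact (ContinuousLinearMap.apply ℝ ℝ e).hasFDerivAt.comp_hasDerivAt 0 h3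
    have h4 := (hl e).sub (hl (-e))
    simp only [smul_neg, ← sub_eq_add_neg] at h4
    have h5 := tendsto_second_difference (hasDerivAt_symm_sum hd x e) (by simp) h4
    rw [iteratedFDeriv_two_apply]
    convert h5 using 1
    · ext h
      simp
      ring
    · simp
  rw [InnerProductSpace.laplacian_eq_iteratedFDeriv_orthonormalBasis g
    (EuclideanSpace.basisFun (Fin n) ℝ)]
  simp only [dlap, smul_eq_mul, Finset.mul_sum]
  refine tendsto_finsetSum _ fun i _ => ?_
  simpa using hmain (EuclideanSpace.single i 1)

/-- The gradient of g is Lipschitz, so s ↦ g(x + se) + g(x - se) has derivative at most 2Ks. A bound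
uniform in the step is what dominated convergence needs as the step tends to 0. -/
lemma exists_bound_dlap (hg : ContDiff ℝ 2 g) (hc : HasCompactSupport g) :
    ∃ M : ℝ, ∀ h > 0, ∀ x, |dlap h g x| ≤ M := by
  have hd : Differentiable ℝ g := hg.differentiable (by norm_num)
  obtain ⟨K, hK⟩ := ContDiff.lipschitzWith_of_hasCompactSupport (n := 1) (hc.fderiv ℝ)
    (hg.fderiv_right (m := 1) (by norm_num)) (by norm_num)
  have hmain : ∀ h > 0, ∀ x e : Rn n, ‖e‖ = 1 →
      |g (x + h • e) + g (x - h • e) - 2 * g x| ≤ 2 * K * h ^ 2 := by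
    intro h hh x e he
    have hb : ∀ s ∈ Set.Ico (0 : ℝ) h,
        ‖fderiv ℝ g (x + s • e) e - fderiv ℝ g (x - s • e) e‖ ≤ 2 * K * h := by
      intro s hs
      rw [← sub_apply]
      refine (ContinuousLinearMap.le_opNorm _ _).trans ?_
      rw [he, mul_one]
      refine (hK.norm_sub_le _ _).trans ?_
      have e1 : x + s • e - (x - s • e) = (2 * s) • e := by module
      rw [e1, norm_smul, he, mul_one, Real.norm_of_nonneg (by linarith [hs.1])]
      have := K.2
      have h4 : (K : ℝ) * s ≤ K * h := mul_le_mul_of_nonneg_left hs.2.le this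
      change (K : ℝ) * (2 * s) ≤ _
      linarith
    have := norm_image_sub_le_of_norm_deriv_le_segment'
      (f := fun s : ℝ => g (x + s • e) + g (x - s • e))
      (fun s _ => (hasDerivAt_symm_sum hd x e s).hasDerivWithinAt) hb h ⟨hh.le, le_rfl⟩
    simp only [zero_smul, add_zero, sub_zero, Real.norm_eq_abs] at this
    calc _ = |g (x + h • e) + g (x - h • e) - (g x + g x)| := by ring_nf
      _ ≤ _ := this
      _ = _ := by ring
  refine ⟨n * (2 * K), fun h hh x => ?_⟩
  rw [dlap, smul_eq_mul, abs_mul, abs_of_pos (by positivity), inv_mul_le_iff₀ (by positivity)]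
  refine (Finset.abs_sum_le_sum_abs _ _).trans ?_
  refine (Finset.sum_le_card_nsmul _ _ (2 * K * h ^ 2) fun i _ => ?_).trans_eq ?_
  · exact hmain h hh x _ (by simp)
  · simp
    ring

lemma integrable_bdd_mul {a : Rn n → ℝ} {b : Rn n → ℝ} (ha : Integrable a)
    (hb : AEStronglyMeasurable b) {C : ℝ} (hC : ∀ x, |b x| ≤ C) : Integrable fun x => a x * b x :=
  ha.mul_bdd hb (Eventually.of_forall hC)

/-- Discrete summation by parts. -/
lemma integral_mul_dlap {a b : Rn n → ℝ} (ha : Integrable a) (hb : Continuous b) {C : ℝ}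
    (hC : ∀ x, |b x| ≤ C) (h : ℝ) :
    ∫ x, a x * dlap h b x = ∫ x, dlap h a x * b x := by
  have hshift : ∀ e : Rn n, Integrable fun x => a x * b (x + e) := fun e =>
    integrable_bdd_mul ha (by fun_prop) fun x => hC _
  have hshift' : ∀ e : Rn n, Integrable fun x => a (x + e) * b x := fun e =>
    integrable_bdd_mul (ha.comp_add_right e) (by fun_prop) fun x => hC _
  have key : ∀ e : Rn n, ∫ x, a x * b (x + e) = ∫ x, a (x - e) * b x := by
    intro e
    rw [← integral_sub_right_eq_self (fun x => a x * b (x + e)) e]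
    simp
  have hI : ∀ e : Rn n, ∫ x, a x * (b (x + e) + b (x - e) - (2 : ℝ) • b x)
      = ∫ x, (a (x + e) + a (x - e) - (2 : ℝ) • a x) * b x := by
    intro e
    have h1 := hshift e
    have h2 := hshift (-e)
    have h3 := hshift' e
    have h4 := hshift' (-e)
    have h5 := hshift 0
    have k1 := key e
    have k2 := key (-e)
    simp only [← sub_eq_add_neg, add_zero, sub_neg_eq_add] at h1 h2 h3 h4 h5 k1 k2
    have e1 : ∀ x, a x * (b (x + e) + b (x - e) - (2 : ℝ) • b x)
        = (a x * b (x + e) + a x * b (x - e)) - 2 * (a x * b x) := fun x => by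
      simp only [smul_eq_mul]; ring
    have e2 : ∀ x, (a (x + e) + a (x - e) - (2 : ℝ) • a x) * b x
        = (a (x - e) * b x + a (x + e) * b x) - 2 * (a x * b x) := fun x => by
      simp only [smul_eq_mul]; ring
    have s1 : Integrable fun x => a x * b (x + e) + a x * b (x - e) := h1.add h2
    have s2 : Integrable fun x => a (x - e) * b x + a (x + e) * b x := h4.add h3
    simp_rw [e1, e2]
    rw [integral_sub s1 (h5.const_mul 2), integral_sub s2 (h5.const_mul 2),
      integral_add h1 h2, integral_add h4 h3, k1, k2]
  have hi1 : ∀ e : Rn n, Integrable fun x => a x * (b (x + e) + b (x - e) - (2 : ℝ) • b x) := by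
    intro e
    have h1 := hshift e
    have h2 := hshift (-e)
    have h5 := hshift 0
    simp only [← sub_eq_add_neg, add_zero] at h1 h2 h5
    refine ((h1.add h2).sub (h5.const_mul 2)).congr (Eventually.of_forall fun x => ?_)
    simp only [Pi.sub_apply, Pi.add_apply, smul_eq_mul]; ring
  have hi2 : ∀ e : Rn n, Integrable fun x => (a (x + e) + a (x - e) - (2 : ℝ) • a x) * b x := by
    intro e
    have h1 := hshift' e
    have h2 := hshift' (-e)
    have h5 := hshift 0
    simp only [← sub_eq_add_neg, add_zero] at h1 h2 h5
    refine ((h1.add h2).sub (h5.const_mul 2)).congr (Eventually.of_forall fun x => ?_)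
    simp only [Pi.sub_apply, Pi.add_apply, smul_eq_mul]; ring
  simp only [dlap, smul_eq_mul (a := (h ^ 2)⁻¹), mul_left_comm _ (h ^ 2)⁻¹, mul_assoc, Finset.mul_sum,
    Finset.sum_mul]
  rw [integral_finsetSum _ fun i _ => (hi1 _).const_mul _,
    integral_finsetSum _ fun i _ => (hi2 _).const_mul _]
  refine Finset.sum_congr rfl fun i _ => ?_
  rw [integral_const_mul, integral_const_mul, hI]

end DiscreteLaplacian

/-! ### Kato's inequality for weak solutions -/

section KatoInequality

open scoped Convolution
open ContinuousLinearMap (lsmul)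

variable {n : ℕ} {Ω : Opens (Rn n)}

/-- The complex sign `z / |z|`, with value `0` at `0`. -/
def csgn (z : ℂ) : ℂ := z / (‖z‖ : ℂ)

lemma norm_csgn_le_one (z : ℂ) : ‖csgn z‖ ≤ 1 := by
  rw [csgn, norm_div, Complex.norm_real, norm_norm]
  exact div_self_le_one _

lemma conj_csgn_mul_self (z : ℂ) : (starRingEnd ℂ) (csgn z) * z = ‖z‖ := by
  rw [csgn, map_div₀, Complex.conj_ofReal, div_mul_eq_mul_div, Complex.conj_mul']
  by_cases hz : z = 0
  · simp [hz]
  · have : (‖z‖ : ℂ) ≠ 0 := by simpa using hz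
    field_simp

lemma measurable_csgn : Measurable csgn := by
  unfold csgn
  fun_prop

lemma re_conj_csgn_mul_le (z a : ℂ) : ((starRingEnd ℂ) (csgn z) * a).re ≤ ‖a‖ := by
  refine (Complex.re_le_norm _).trans ?_
  rw [norm_mul, RCLike.norm_conj]
  exact mul_le_of_le_one_left (norm_nonneg _) (norm_csgn_le_one z)

/-- Kato's inequality is elementary at the discrete level: each neighbouring value contributes at
most its modulus, while the central one contributes exactly -2|v|. Zeros of v cause no trouble and
no regularisation of |v| is needed. -/
lemma re_conj_csgn_mul_dlap_le (h : ℝ) (v : Rn n → ℂ) (x : Rn n) :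
    ((starRingEnd ℂ) (csgn (v x)) * dlap h v x).re ≤ dlap h (fun y => ‖v y‖) x := by
  have key : ∀ a b : ℂ, ((starRingEnd ℂ) (csgn (v x)) * (a + b - (2 : ℝ) • v x)).re
      ≤ ‖a‖ + ‖b‖ - (2 : ℝ) • ‖v x‖ := by
    intro a b
    have h1 := re_conj_csgn_mul_le (v x) a
    have h2 := re_conj_csgn_mul_le (v x) b
    have h3 : ((starRingEnd ℂ) (csgn (v x)) * ((2 : ℝ) • v x)).re = 2 * ‖v x‖ := by
      rw [mul_smul_comm, conj_csgn_mul_self]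
      simp
    rw [mul_sub, mul_add, Complex.sub_re, Complex.add_re, h3, smul_eq_mul]
    linarith
  rw [dlap, dlap, mul_smul_comm, Complex.smul_re, Finset.mul_sum, Complex.re_sum]
  refine smul_le_smul_of_nonneg_left (Finset.sum_le_sum fun i _ => key _ _) (by positivity)

lemma continuous_dlap {F : Type*} [NormedAddCommGroup F] [NormedSpace ℝ F] {g : Rn n → F}
    (hg : Continuous g) (h : ℝ) : Continuous (dlap h g) := by
  unfold dlap
  fun_prop

lemma dlap_comp_sub (h : ℝ) (ρ : Rn n → ℝ) (x y : Rn n) :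
    dlap h (fun y => ρ (x - y)) y = dlap h ρ (x - y) := by
  simp only [dlap]
  congr 1
  refine Finset.sum_congr rfl fun i _ => ?_
  rw [add_comm (ρ _)]
  congr 3 <;> abel_nf

lemma dlap_convolution {ρ : Rn n → ℝ} (hρ : Continuous ρ) (hρc : HasCompactSupport ρ)
    {w : Rn n → ℂ} (hw : Integrable w) (h : ℝ) (x : Rn n) :
    dlap h (ρ ⋆[lsmul ℝ ℝ, volume] w) x = ∫ y, dlap h ρ (x - y) • w y := by
  have hex : ∀ x, Integrable fun y => ρ (x - y) • w y := fun x =>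
    (convolutionExistsAt_iff_integrable_swap (L := lsmul ℝ ℝ)).1
      (hρc.convolutionExists_left (lsmul ℝ ℝ) hρ hw.locallyIntegrable x)
  have e1 : ∀ e y : Rn n, (ρ (x - y + e) + ρ (x - y - e) - (2 : ℝ) • ρ (x - y)) • w y
      = (ρ (x + e - y) • w y + ρ (x - e - y) • w y) - (2 : ℝ) • (ρ (x - y) • w y) := by
    intro e y
    rw [show x - y + e = x + e - y by abel, show x - y - e = x - e - y by abel, sub_smul, add_smul,
      smul_assoc]
  have hs : ∀ e : Rn n, Integrable fun y => ρ (x + e - y) • w y + ρ (x - e - y) • w y :=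
    fun e => (hex _).add (hex _)
  have e2 : ∀ e : Rn n, ∫ y, (ρ (x - y + e) + ρ (x - y - e) - (2 : ℝ) • ρ (x - y)) • w y
      = (∫ y, ρ (x + e - y) • w y) + (∫ y, ρ (x - e - y) • w y)
        - (2 : ℝ) • ∫ y, ρ (x - y) • w y := by
    intro e
    simp_rw [e1]
    have h2 : Integrable fun y => (2 : ℝ) • (ρ (x - y) • w y) := (hex x).smul (2 : ℝ)
    rw [integral_sub (hs e) h2, integral_add (hex _) (hex _), integral_smul]
  have e3 : ∀ e : Rn n,
      Integrable fun y => (ρ (x - y + e) + ρ (x - y - e) - (2 : ℝ) • ρ (x - y)) • w y := by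
    intro e
    simp_rw [e1]
    exact (hs e).sub ((hex x).smul (2 : ℝ))
  simp only [dlap, smul_assoc, Finset.sum_smul]
  rw [integral_smul, integral_finsetSum _ fun i _ => e3 _]
  congr 1
  refine Finset.sum_congr rfl fun i _ => ?_
  rw [e2, convolution_lsmul_swap, convolution_lsmul_swap, convolution_lsmul_swap]

lemma laplacian_ofReal {g : Rn n → ℝ} (hg : ContDiff ℝ 2 g) (x : Rn n) :
    Δ (fun y => (g y : ℂ)) x = (Δ g x : ℂ) :=
  hg.contDiffAt.laplacian_CLM_comp_left (l := Complex.ofRealCLM)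

/-- The discrete Laplacians of a mollified weak solution converge to the mollified equation. -/
lemma tendsto_dlap_convolution {w : Rn n → ℂ} (hw : Integrable w) {c c' : Rn n → ℝ}
    (hsol : ∀ φ : 𝓓(Ω, ℂ), ∫ x, w x * (-Δ (φ : Rn n → ℂ) x + (c x : ℂ) * φ x) = 0)
    {ρ : Rn n → ℝ} (hρ : ContDiff ℝ (⊤ : ℕ∞) ρ) (hρc : HasCompactSupport ρ)
    {x : Rn n} (hx : tsupport (fun y => ρ (x - y)) ⊆ Ω) (hc'm : Measurable c') {C : ℝ}
    (hc'b : ∀ y, |c' y| ≤ C) (hcc' : ∀ᵐ y, ρ (x - y) ≠ 0 → c y = c' y) :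
    Tendsto (fun h => dlap h (ρ ⋆[lsmul ℝ ℝ, volume] w) x) (𝓝[>] 0)
      (𝓝 ((ρ ⋆[lsmul ℝ ℝ, volume] fun y => (c' y : ℂ) * w y) x)) := by
  have hρ2 : ContDiff ℝ 2 ρ := hρ.of_le two_le_smooth
  have hψ : ContDiff ℝ (⊤ : ℕ∞) fun y => ρ (x - y) := hρ.comp (contDiff_const.sub contDiff_id)
  have hψ2 : ContDiff ℝ 2 fun y => ρ (x - y) := hψ.of_le two_le_smooth
  have hψc : HasCompactSupport fun y => ρ (x - y) :=
    hρc.comp_homeomorph (Homeomorph.subLeft x)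
  let φ : 𝓓(Ω, ℂ) := ⟨fun y => (ρ (x - y) : ℂ), Complex.ofRealCLM.contDiff.comp hψ,
    hψc.comp_left (g := fun y : ℝ => (y : ℂ)) (by simp),
    (tsupport_comp_subset (g := fun y : ℝ => (y : ℂ)) (by simp) _).trans hx⟩
  obtain ⟨M, hM⟩ := exists_bound_dlap hρ2 hρc
  have hlim : ∀ y, Tendsto (fun h => dlap h ρ (x - y)) (𝓝[>] 0)
      (𝓝 (Δ (fun y => ρ (x - y)) y)) := fun y =>
    (tendsto_dlap hψ2 y).congr fun h => dlap_comp_sub h ρ x y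
  have h1 : Tendsto (fun h => ∫ y, dlap h ρ (x - y) • w y) (𝓝[>] 0)
      (𝓝 (∫ y, (Δ (fun y => ρ (x - y)) y) • w y)) := by
    refine tendsto_integral_filter_of_dominated_convergence (fun y => M * ‖w y‖) ?_ ?_
      (hw.norm.const_mul M) (Eventually.of_forall fun y => (hlim y).smul_const _)
    · refine Eventually.of_forall fun h => ?_
      have : Continuous fun y => dlap h ρ (x - y) :=
        (continuous_dlap hρ.continuous h).comp (continuous_const.sub continuous_id)
      exact this.aestronglyMeasurable.smul hw.1
    · filter_upwards [self_mem_nhdsWithin] with h hh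
      refine Eventually.of_forall fun y => ?_
      rw [norm_smul]
      exact mul_le_mul_of_nonneg_right (hM h hh _) (norm_nonneg _)
  have hΔM : ∀ y, |Δ (fun y => ρ (x - y)) y| ≤ M := fun y =>
    le_of_tendsto (hlim y).abs (by filter_upwards [self_mem_nhdsWithin] with h hh using hM h hh _)
  have hΔc : Continuous fun y => Δ (fun y => ρ (x - y)) y := by
    have hI : Continuous (iteratedFDeriv ℝ 2 fun y => ρ (x - y)) :=
      hψ2.continuous_iteratedFDeriv le_rfl
    rw [InnerProductSpace.laplacian_eq_iteratedFDeriv_stdOrthonormalBasis]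
    fun_prop
  have hi1 : Integrable fun y => (Δ (fun y => ρ (x - y)) y) • w y :=
    hw.bdd_smul M hΔc.aestronglyMeasurable (Eventually.of_forall hΔM)
  have hcw : Integrable fun y => (c' y : ℂ) * w y :=
    hw.bdd_mul (c := C) (by fun_prop) (Eventually.of_forall fun y => by simpa using hc'b y)
  have hi2 : Integrable fun y => ρ (x - y) • ((c' y : ℂ) * w y) :=
    (convolutionExistsAt_iff_integrable_swap (L := lsmul ℝ ℝ)).1
      (hρc.convolutionExists_left (lsmul ℝ ℝ) hρ.continuous hcw.locallyIntegrable x)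
  -- This is the weak equation tested against y ↦ ρ(x - y); c and c' agree wherever that function
  -- does not vanish.
  have h2 : ∫ y, (Δ (fun y => ρ (x - y)) y) • w y = ∫ y, ρ (x - y) • ((c' y : ℂ) * w y) := by
    rw [eq_comm, ← sub_eq_zero, ← integral_sub hi2 hi1, ← hsol φ]
    refine integral_congr_ae ?_
    filter_upwards [hcc'] with y hy
    have e1 : Δ (φ : Rn n → ℂ) y = (Δ (fun y => ρ (x - y)) y : ℂ) := laplacian_ofReal hψ2 y
    have e2 : φ y = (ρ (x - y) : ℂ) := rfl
    rw [e1, e2]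
    simp only [Complex.real_smul]
    by_cases h0 : ρ (x - y) = 0
    · simp [h0]
      ring
    · rw [hy h0]
      ring
  rw [convolution_lsmul_swap, ← h2]
  exact h1.congr fun h => (dlap_convolution hρ.continuous hρc hw h x).symm

/-- Kato's inequality for a mollified weak solution, tested against a function `χ` whose discrete
Laplacians are asymptotically bounded above by `b`. -/
lemma kato_mollified {w : Rn n → ℂ} (hw : Integrable w) {ρ : Rn n → ℝ} (hρ : Continuous ρ)
    (hρc : HasCompactSupport ρ) (hρ2 : ContDiff ℝ 2 ρ)
    {χ : Rn n → ℝ} (hχ0 : ∀ x, 0 ≤ χ x) (hχ : Continuous χ) (hχc : HasCompactSupport χ)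
    {b : Rn n → ℝ} (hbm : Measurable b) {Mb : ℝ} (hbb : ∀ x, |b x| ≤ Mb)
    {M h₀ : ℝ} (hh₀ : 0 < h₀) (hM : ∀ h, 0 < h → h < h₀ → ∀ x, dlap h χ x ≤ M)
    (hlim : ∀ᵐ x, ∀ ε > 0, ∀ᶠ h in 𝓝[>] (0 : ℝ), dlap h χ x ≤ b x + ε)
    {G : Rn n → ℂ} (hG : ∀ x, χ x ≠ 0 →
      Tendsto (fun h => dlap h (ρ ⋆[lsmul ℝ ℝ, volume] w) x) (𝓝[>] 0) (𝓝 (G x))) :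
    ∫ x, χ x * ((starRingEnd ℂ) (csgn ((ρ ⋆[lsmul ℝ ℝ, volume] w) x)) * G x).re
      ≤ ∫ x, ‖(ρ ⋆[lsmul ℝ ℝ, volume] w) x‖ * b x := by
  set v := ρ ⋆[lsmul ℝ ℝ, volume] w with hv
  have hvc : Continuous v := hρc.continuous_convolution_left _ hρ hw.locallyIntegrable
  have hvi : Integrable v :=
    (hρ.integrable_of_hasCompactSupport hρc).integrable_convolution _ hw
  obtain ⟨X, hX⟩ := hχc.exists_bound_of_continuous hχ
  obtain ⟨N, hN⟩ := exists_bound_dlap hρ2 hρc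
  have hN0 : 0 ≤ N := (abs_nonneg _).trans (hN 1 one_pos 0)
  have hdv : ∀ h > 0, ∀ x, ‖dlap h v x‖ ≤ N * ∫ y, ‖w y‖ := by
    intro h hh x
    rw [hv, dlap_convolution hρ hρc hw, ← integral_const_mul]
    refine norm_integral_le_of_norm_le (hw.norm.const_mul N) (Eventually.of_forall fun y => ?_)
    rw [norm_smul]
    exact mul_le_mul_of_nonneg_right (hN h hh _) (norm_nonneg _)
  set I : ℝ → ℝ := fun h =>
    ∫ x, χ x * ((starRingEnd ℂ) (csgn (v x)) * dlap h v x).re with hI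
  -- Only an upper bound on the second differences of χ is available. The positive part of their
  -- excess over b is dominated and tends to 0 almost everywhere, which makes `R` vanish in the
  -- limit.
  set R : ℝ → ℝ := fun h => ∫ x, ‖v x‖ * max (dlap h χ x - b x) 0 with hR
  have hbint : Integrable fun x => ‖v x‖ * b x :=
    integrable_bdd_mul hvi.norm hbm.aestronglyMeasurable hbb
  have hI_lim : Tendsto I (𝓝[>] 0)
      (𝓝 (∫ x, χ x * ((starRingEnd ℂ) (csgn (v x)) * G x).re)) := by
    refine tendsto_integral_filter_of_dominated_convergence
      (fun x => χ x * (N * ∫ y, ‖w y‖)) ?_ ?_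
      ((hχ.integrable_of_hasCompactSupport hχc).mul_const _) ?_
    · refine Eventually.of_forall fun h => ?_
      have h1 : Measurable fun x => csgn (v x) := measurable_csgn.comp hvc.measurable
      have h2 := (continuous_dlap hvc h).measurable
      have h3 := hχ.measurable
      exact (h3.mul (Complex.measurable_re.comp
        ((Complex.continuous_conj.measurable.comp h1).mul h2))).aestronglyMeasurable
    · filter_upwards [self_mem_nhdsWithin] with h hh
      refine Eventually.of_forall fun x => ?_
      rw [norm_mul, Real.norm_of_nonneg (hχ0 x)]
      refine mul_le_mul_of_nonneg_left ?_ (hχ0 x)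
      refine (Complex.abs_re_le_norm _).trans ?_
      rw [norm_mul, RCLike.norm_conj]
      exact (mul_le_of_le_one_left (norm_nonneg _) (norm_csgn_le_one _)).trans (hdv h hh x)
    · refine Eventually.of_forall fun x => ?_
      by_cases hx : χ x = 0
      · simp [hx]
      · exact ((Complex.continuous_re.tendsto _).comp ((hG x hx).const_mul _)).const_mul _
  have hR_lim : Tendsto R (𝓝[>] 0) (𝓝 0) := by
    have : Tendsto R (𝓝[>] 0) (𝓝 (∫ x : Rn n, (0 : ℝ))) := by
      refine tendsto_integral_filter_of_dominated_convergence
        (fun x => ‖v x‖ * (|M| + Mb)) ?_ ?_ (hvi.norm.mul_const _) ?_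
      · refine Eventually.of_forall fun h => ?_
        have h2 := (continuous_dlap hχ h).measurable
        exact (hvc.norm.measurable.mul
          ((h2.sub hbm).max measurable_const)).aestronglyMeasurable
      · filter_upwards [Ioo_mem_nhdsGT hh₀] with h hh
        refine Eventually.of_forall fun x => ?_
        rw [norm_mul, norm_norm, Real.norm_of_nonneg (le_max_right _ _)]
        refine mul_le_mul_of_nonneg_left (max_le ?_ ?_) (norm_nonneg _)
        · have := hM h hh.1 hh.2 x
          have h3 := neg_abs_le (b x)
          linarith [le_abs_self M, hbb x]
        · linarith [abs_nonneg M, (abs_nonneg _).trans (hbb x)]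
      · filter_upwards [hlim] with x hx
        have h0 : Tendsto (fun h => max (dlap h χ x - b x) 0) (𝓝[>] 0) (𝓝 0) := by
          refine tendsto_order.2 ⟨fun a ha => Eventually.of_forall fun h =>
            lt_of_lt_of_le ha (le_max_right _ _), fun a ha => ?_⟩
          filter_upwards [hx (a / 2) (by positivity)] with h hh
          exact max_lt (by linarith) ha
        simpa using h0.const_mul ‖v x‖
    simpa using this
  have hle : ∀ᶠ h in 𝓝[>] (0 : ℝ), I h ≤ (∫ x, ‖v x‖ * b x) + R h := by
    filter_upwards [Ioo_mem_nhdsGT hh₀] with h hh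
    have hda : Continuous fun x => dlap h χ x := continuous_dlap hχ h
    have hdn : Continuous fun x => dlap h (fun y => ‖v y‖) x := continuous_dlap hvc.norm h
    have hdvc : Continuous fun x => dlap h v x := continuous_dlap hvc h
    have hdχ : ∃ D, ∀ x, |dlap h χ x| ≤ D := by
      refine ⟨(h ^ 2)⁻¹ * (n * (4 * X)), fun x => ?_⟩
      rw [dlap, smul_eq_mul, abs_mul, abs_of_nonneg (by positivity : 0 ≤ (h ^ 2)⁻¹)]
      refine mul_le_mul_of_nonneg_left ?_ (by positivity)
      refine (Finset.abs_sum_le_sum_abs _ _).trans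
        ((Finset.sum_le_card_nsmul _ _ (4 * X) fun i _ => ?_).trans_eq (by simp))
      have h1 := hX (x + h • EuclideanSpace.single i (1 : ℝ))
      have h2 := hX (x - h • EuclideanSpace.single i (1 : ℝ))
      have h3 := hX x
      simp only [Real.norm_eq_abs, abs_le, smul_eq_mul] at h1 h2 h3 ⊢
      constructor <;> linarith
    obtain ⟨D, hD⟩ := hdχ
    have hRi : Integrable fun x => ‖v x‖ * max (dlap h χ x - b x) 0 := by
      refine integrable_bdd_mul (C := D + Mb) hvi.norm
        ((hda.measurable.sub hbm).max measurable_const).aestronglyMeasurable fun x => ?_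
      rw [abs_of_nonneg (le_max_right _ _)]
      have h1 := abs_le.1 (hD x)
      have h2 := abs_le.1 (hbb x)
      exact max_le (by linarith) (by linarith)
    calc I h ≤ ∫ x, dlap h (fun y => ‖v y‖) x * χ x := by
          refine integral_mono ?_ ((hdn.mul hχ).integrable_of_hasCompactSupport hχc.mul_left)
            fun x => ?_
          · refine integrable_bdd_mul (C := N * ∫ y, ‖w y‖)
              (hχ.integrable_of_hasCompactSupport hχc) ?_ fun x => ?_
            · have h1 : Measurable fun x => csgn (v x) := measurable_csgn.comp hvc.measurable
              exact (Complex.measurable_re.comp ((Complex.continuous_conj.measurable.comp h1).mul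
                hdvc.measurable)).aestronglyMeasurable
            · refine (Complex.abs_re_le_norm _).trans ?_
              rw [norm_mul, RCLike.norm_conj]
              exact (mul_le_of_le_one_left (norm_nonneg _) (norm_csgn_le_one _)).trans
                (hdv h hh.1 x)
          · simp only
            rw [mul_comm]
            exact mul_le_mul_of_nonneg_right (re_conj_csgn_mul_dlap_le h v x) (hχ0 x)
      -- Summation by parts is done before the limit in the step, so neither |v| nor χ is ever
      -- differentiated.
      _ = ∫ x, ‖v x‖ * dlap h χ x :=
          (integral_mul_dlap hvi.norm hχ (fun x => hX x) h).symm
      _ ≤ ∫ x, (‖v x‖ * b x + ‖v x‖ * max (dlap h χ x - b x) 0) := by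
          refine integral_mono (integrable_bdd_mul hvi.norm hda.aestronglyMeasurable hD)
            (hbint.add hRi) fun x => ?_
          simp only
          rw [← mul_add]
          refine mul_le_mul_of_nonneg_left ?_ (norm_nonneg _)
          linarith [le_max_left (dlap h χ x - b x) 0]
      _ = _ := integral_add hbint hRi
  have := le_of_tendsto_of_tendsto hI_lim (hR_lim.const_add (∫ x, ‖v x‖ * b x)) hle
  simpa using this

/-- A measurable modification of c, clipped to [-C, C], is bounded everywhere. This makes c'w
integrable on the whole space, so it can be mollified. -/
lemma exists_bounded_representative {K : Set (Rn n)} (hK : MeasurableSet K) {c : Rn n → ℝ}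
    (hc : MemLp c (⊤ : ℝ≥0∞) (volume.restrict K)) :
    ∃ c' : Rn n → ℝ, ∃ C : ℝ, Measurable c' ∧ (∀ x, |c' x| ≤ C) ∧ ∀ᵐ x, x ∈ K → c x = c' x := by
  have hfin : eLpNormEssSup c (volume.restrict K) ≠ ⊤ := by
    simpa [eLpNorm_exponent_top] using hc.2.ne
  set C := (eLpNormEssSup c (volume.restrict K)).toReal with hC
  have hC0 : 0 ≤ C := ENNReal.toReal_nonneg
  have hb : ∀ᵐ x ∂volume.restrict K, |c x| ≤ C := by
    filter_upwards [enorm_ae_le_eLpNormEssSup c (volume.restrict K)] with x hx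
    rw [← Real.norm_eq_abs, ← toReal_enorm]
    exact ENNReal.toReal_mono hfin hx
  refine ⟨fun x => max (-C) (min C (hc.1.aemeasurable.mk c x)), C, ?_, fun x => ?_, ?_⟩
  · exact measurable_const.max (measurable_const.min hc.1.aemeasurable.measurable_mk)
  · rw [abs_le]
    exact ⟨le_max_left _ _, max_le (by linarith) (min_le_left _ _)⟩
  · rw [← ae_restrict_iff' hK]
    filter_upwards [hb, hc.1.aemeasurable.ae_eq_mk] with x h1 h2
    rw [← h2, min_eq_right (abs_le.1 h1).2, max_eq_right (abs_le.1 h1).1]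

/-- Kato's inequality for an integrable weak solution of `-Δw + c w = 0` in `Ω`, tested against a
function `χ` whose discrete Laplacians are asymptotically bounded above by `b`. -/
theorem kato_inequality {w : Rn n → ℂ} (hw : Integrable w) {c : Rn n → ℝ} (hc : LocEssBdd Ω c)
    (hsol : ∀ φ : 𝓓(Ω, ℂ), ∫ x, w x * (-Δ (φ : Rn n → ℂ) x + (c x : ℂ) * φ x) = 0)
    {χ : Rn n → ℝ} (hχ0 : ∀ x, 0 ≤ χ x) (hχ : Continuous χ) (hχc : HasCompactSupport χ)
    (hχΩ : tsupport χ ⊆ Ω)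
    {b : Rn n → ℝ} (hbm : Measurable b) {Mb : ℝ} (hbb : ∀ x, |b x| ≤ Mb)
    {M h₀ : ℝ} (hh₀ : 0 < h₀) (hM : ∀ h, 0 < h → h < h₀ → ∀ x, dlap h χ x ≤ M)
    (hlim : ∀ᵐ x, ∀ ε > 0, ∀ᶠ h in 𝓝[>] (0 : ℝ), dlap h χ x ≤ b x + ε) :
    Integrable (fun x => c x * ‖w x‖ * χ x) ∧
      ∫ x, c x * ‖w x‖ * χ x ≤ ∫ x, ‖w x‖ * b x := by
  -- A margin r around the support of χ keeps the mollifying balls centred at points where χ ≠ 0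
  -- inside a compact subset of Ω.
  obtain ⟨r, hr, hrΩ⟩ := hχc.exists_cthickening_subset_open Ω.isOpen hχΩ
  set K := Metric.cthickening r (tsupport χ) with hKdef
  have hK : IsCompact K := hχc.cthickening
  obtain ⟨c', C, hc'm, hc'b, hcc'⟩ := exists_bounded_representative hK.measurableSet (hc K hK hrΩ)
  have hC0 : 0 ≤ C := (abs_nonneg _).trans (hc'b 0)
  obtain ⟨X, hX⟩ := hχc.exists_bound_of_continuous hχ
  have hX0 : 0 ≤ X := (norm_nonneg _).trans (hX 0)
  have hMb0 : 0 ≤ Mb := (abs_nonneg _).trans (hbb 0)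
  have hcongr : (fun x => c' x * ‖w x‖ * χ x) =ᵐ[volume] fun x => c x * ‖w x‖ * χ x := by
    filter_upwards [hcc'] with x hx
    by_cases h0 : χ x = 0
    · simp [h0]
    · rw [hx (Metric.self_subset_cthickening _ (subset_tsupport _ h0))]
  have hcχ : ∀ x, |c' x * χ x| ≤ C * X := fun x => by
    rw [abs_mul]
    exact mul_le_mul (hc'b x) (hX x) (abs_nonneg _) hC0
  have hint : ∀ {g : Rn n → ℝ}, Integrable g → Integrable fun x => g x * (c' x * χ x) :=
    fun hg => integrable_bdd_mul hg (hc'm.mul hχ.measurable).aestronglyMeasurable hcχ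
  have hintb : ∀ {g : Rn n → ℝ}, Integrable g → Integrable fun x => g x * b x :=
    fun hg => integrable_bdd_mul hg hbm.aestronglyMeasurable hbb
  have hwi : Integrable fun x => c' x * ‖w x‖ * χ x :=
    (hint hw.norm).congr (Eventually.of_forall fun x => by simp only; ring)
  refine ⟨hwi.congr hcongr, ?_⟩
  rw [← integral_congr_ae hcongr]
  let φ : ℕ → ContDiffBump (0 : Rn n) := fun k =>
    ⟨r / (k + 3), r / (k + 2), by positivity, by gcongr; norm_num⟩
  have hφ : Tendsto (fun k => (φ k).rOut) atTop (𝓝 0) := by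
    have : Tendsto (fun k : ℕ => (k : ℝ) + 2) atTop atTop :=
      tendsto_atTop_add_const_right _ _ tendsto_natCast_atTop_atTop
    exact tendsto_const_nhds.div_atTop this
  have hφr : ∀ k, (φ k).rOut ≤ r := fun k => by
    change r / ((k : ℝ) + 2) ≤ r
    refine div_le_self hr.le ?_
    have : (0 : ℝ) ≤ k := k.cast_nonneg
    linarith
  have hcw : Integrable fun y => (c' y : ℂ) * w y :=
    hw.bdd_mul (c := C) (by fun_prop) (Eventually.of_forall fun y => by simpa using hc'b y)
  set v : ℕ → Rn n → ℂ := fun k => (φ k).normed volume ⋆[lsmul ℝ ℝ, volume] w with hv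
  set G : ℕ → Rn n → ℂ :=
    fun k => (φ k).normed volume ⋆[lsmul ℝ ℝ, volume] (fun y => (c' y : ℂ) * w y) with hG
  have hvi : ∀ k, Integrable (v k) := fun k =>
    (φ k).integrable_normed.integrable_convolution _ hw
  have hGi : ∀ k, Integrable (G k) := fun k =>
    (φ k).integrable_normed.integrable_convolution _ hcw
  have hvlim := tendsto_integral_norm_mollify_sub hw hφ
  have hGlim := tendsto_integral_norm_mollify_sub hcw hφ
  have hkato : ∀ k, ∫ x, χ x * ((starRingEnd ℂ) (csgn (v k x)) * G k x).re
      ≤ ∫ x, ‖v k x‖ * b x := by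
    intro k
    refine kato_mollified hw (φ k).continuous_normed (φ k).hasCompactSupport_normed
      (φ k).contDiff_normed hχ0 hχ hχc hbm hbb hh₀ hM hlim fun x hx => ?_
    have hball : ∀ y, (φ k).normed volume (x - y) ≠ 0 → y ∈ Metric.closedBall x (φ k).rOut := by
      intro y hy
      have : x - y ∈ Metric.ball (0 : Rn n) (φ k).rOut := by
        rw [← (φ k).support_normed_eq (μ := volume)]
        exact hy
      rw [mem_ball_zero_iff] at this
      rw [Metric.mem_closedBall, dist_comm, dist_eq_norm]
      exact this.le
    have hsub : Metric.closedBall x (φ k).rOut ⊆ K :=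
      (Metric.closedBall_subset_cthickening (subset_tsupport _ hx) _).trans
        (Metric.cthickening_mono (hφr k) _)
    refine tendsto_dlap_convolution hw hsol (φ k).contDiff_normed (φ k).hasCompactSupport_normed
      ?_ hc'm hc'b ?_
    · exact (closure_minimal hball Metric.isClosed_closedBall).trans (hsub.trans hrΩ)
    · filter_upwards [hcc'] with y hy h0
      exact hy (hsub (hball y h0))
  set E : ℕ → ℝ := fun k => (2 * (C * X) + Mb) * (∫ x, ‖v k x - w x‖)
    + X * ∫ x, ‖G k x - (c' x : ℂ) * w x‖ with hE
  have hElim : Tendsto E atTop (𝓝 0) := by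
    simpa using (hvlim.const_mul (2 * (C * X) + Mb)).add (hGlim.const_mul X)
  have hdv : ∀ k, Integrable fun x => ‖v k x - w x‖ := fun k => ((hvi k).sub hw).norm
  have hdG : ∀ k, Integrable fun x => ‖G k x - (c' x : ℂ) * w x‖ := fun k =>
    ((hGi k).sub hcw).norm
  have hmain : ∀ k, ∫ x, c' x * ‖w x‖ * χ x ≤ (∫ x, ‖w x‖ * b x) + E k := by
    intro k
    have hi : Integrable fun x => χ x * ((starRingEnd ℂ) (csgn (v k x)) * G k x).re := by
      have hvc : Continuous (v k) := (φ k).hasCompactSupport_normed.continuous_convolution_left _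
        (φ k).continuous_normed hw.locallyIntegrable
      have h1 : Measurable fun x => (starRingEnd ℂ) (csgn (v k x)) :=
        Complex.continuous_conj.measurable.comp (measurable_csgn.comp hvc.measurable)
      have h2 : Integrable fun x => (starRingEnd ℂ) (csgn (v k x)) * G k x :=
        (hGi k).bdd_mul (c := 1) h1.aestronglyMeasurable (Eventually.of_forall fun x => by
          rw [RCLike.norm_conj]; exact norm_csgn_le_one _)
      exact h2.re.bdd_mul hχ.aestronglyMeasurable (Eventually.of_forall hX)
    have hi2 : Integrable fun x => 2 * (C * X) * ‖v k x - w x‖ + X * ‖G k x - (c' x : ℂ) * w x‖ :=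
      ((hdv k).const_mul _).add ((hdG k).const_mul _)
    have h1 : ∫ x, c' x * ‖w x‖ * χ x ≤ ∫ x, (χ x * ((starRingEnd ℂ) (csgn (v k x)) * G k x).re
        + (2 * (C * X) * ‖v k x - w x‖ + X * ‖G k x - (c' x : ℂ) * w x‖)) := by
      refine integral_mono hwi
        (hi.add hi2) fun x => ?_
      -- The signs of the mollifications need not converge where w = 0. They are eliminated by
      -- splitting off c'v, for which conj(sgn v)·v = |v|; the remainder G - c'v is small in L¹.
      have e1 : ((starRingEnd ℂ) (csgn (v k x)) * G k x).re
          = c' x * ‖v k x‖ + ((starRingEnd ℂ) (csgn (v k x)) * (G k x - (c' x : ℂ) * v k x)).re := by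
        have : ((starRingEnd ℂ) (csgn (v k x)) * ((c' x : ℂ) * v k x)) = ((c' x * ‖v k x‖ : ℝ) : ℂ) := by
          rw [mul_left_comm, conj_csgn_mul_self]
          push_cast
          ring
        rw [mul_sub, Complex.sub_re, this, Complex.ofReal_re]
        ring
      have e2 : -‖G k x - (c' x : ℂ) * v k x‖
          ≤ ((starRingEnd ℂ) (csgn (v k x)) * (G k x - (c' x : ℂ) * v k x)).re := by
        have := re_conj_csgn_mul_le (v k x) (-(G k x - (c' x : ℂ) * v k x))
        rw [mul_neg, Complex.neg_re, norm_neg] at this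
        linarith
      have e3 : ‖G k x - (c' x : ℂ) * v k x‖
          ≤ ‖G k x - (c' x : ℂ) * w x‖ + C * ‖v k x - w x‖ := by
        have : G k x - (c' x : ℂ) * v k x
            = (G k x - (c' x : ℂ) * w x) - (c' x : ℂ) * (v k x - w x) := by ring
        rw [this]
        refine (norm_sub_le _ _).trans ?_
        rw [norm_mul, Complex.norm_real]
        gcongr
        exact hc'b x
      have e4 : c' x * ‖w x‖ ≤ c' x * ‖v k x‖ + C * ‖v k x - w x‖ := by
        have h5 : c' x * (‖w x‖ - ‖v k x‖) ≤ C * ‖v k x - w x‖ := by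
          refine (le_abs_self _).trans ?_
          rw [abs_mul]
          refine mul_le_mul (hc'b x) ?_ (abs_nonneg _) hC0
          rw [norm_sub_rev (v k x)]
          exact abs_norm_sub_norm_le _ _
        linarith
      have hχX : χ x ≤ X := (le_abs_self _).trans (hX x)
      have e5 : c' x * ‖w x‖ ≤ ((starRingEnd ℂ) (csgn (v k x)) * G k x).re
          + (2 * C * ‖v k x - w x‖ + ‖G k x - (c' x : ℂ) * w x‖) := by linarith
      have e6 := mul_le_mul_of_nonneg_left e5 (hχ0 x)
      have e7 : χ x * (2 * C * ‖v k x - w x‖ + ‖G k x - (c' x : ℂ) * w x‖)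
          ≤ X * (2 * C * ‖v k x - w x‖ + ‖G k x - (c' x : ℂ) * w x‖) :=
        mul_le_mul_of_nonneg_right hχX (by positivity)
      simp only
      nlinarith
    rw [integral_add hi hi2, integral_add ((hdv k).const_mul _) ((hdG k).const_mul _),
      integral_const_mul, integral_const_mul] at h1
    have h2 : ∫ x, ‖v k x‖ * b x ≤ ∫ x, (‖w x‖ * b x + Mb * ‖v k x - w x‖) := by
      refine integral_mono (hintb (hvi k).norm) ((hintb hw.norm).add ((hdv k).const_mul _))
        fun x => ?_
      have h3 : (‖v k x‖ - ‖w x‖) * b x ≤ ‖v k x - w x‖ * Mb := by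
        refine (le_abs_self _).trans ?_
        rw [abs_mul]
        exact mul_le_mul (abs_norm_sub_norm_le _ _) (hbb x) (abs_nonneg _) (norm_nonneg _)
      simp only
      linarith
    rw [integral_add (hintb hw.norm) ((hdv k).const_mul _), integral_const_mul] at h2
    have h3 := hkato k
    simp only [hE]
    linarith
  have := ge_of_tendsto' (hElim.const_add (∫ x, ‖w x‖ * b x)) hmain
  simpa using this

end KatoInequality

/-! ### Exterior balls and the distance to the boundary -/

section BoundaryGeometry

variable {n : ℕ} {Ω : Opens (Rn n)}

lemma isCompact_frontier (hb : Bornology.IsBounded (Ω : Set (Rn n))) :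
    IsCompact (frontier (Ω : Set (Rn n))) :=
  Metric.isCompact_of_isClosed_isBounded isClosed_frontier
    (hb.closure.subset frontier_subset_closure)

lemma notMem_of_mem_frontier {x : Rn n} (hx : x ∈ frontier (Ω : Set (Rn n))) : x ∉ Ω := by
  rw [Ω.isOpen.frontier_eq] at hx
  exact hx.2

lemma frontier_nonempty (hn : 1 ≤ n) (hne : (Ω : Set (Rn n)).Nonempty)
    (hb : Bornology.IsBounded (Ω : Set (Rn n))) : (frontier (Ω : Set (Rn n))).Nonempty := by
  rw [nonempty_frontier_iff]
  refine ⟨hne, fun h => ?_⟩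
  have : Nonempty (Fin n) := ⟨⟨0, hn⟩⟩
  rw [h] at hb
  exact NormedSpace.unbounded_univ ℝ (Rn n) hb

/-- A segment missing the frontier would be disconnected by Ω and the complement of its closure. -/
lemma exists_segment_mem_frontier {x z : Rn n} (hx : x ∈ Ω) (hz : z ∉ Ω) :
    ∃ w ∈ segment ℝ x z, w ∈ frontier (Ω : Set (Rn n)) := by
  by_contra! h
  have hconn : IsPreconnected (segment ℝ x z) := (convex_segment x z).isPreconnected
  have h2 : segment ℝ x z ⊆ (Ω : Set (Rn n)) ∪ (closure (Ω : Set (Rn n)))ᶜ := by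
    intro w hw
    by_cases hwΩ : w ∈ (Ω : Set (Rn n))
    · exact Or.inl hwΩ
    · refine Or.inr fun hcl => h w hw ?_
      rw [Ω.isOpen.frontier_eq]
      exact ⟨hcl, hwΩ⟩
  have hzc : z ∈ (closure (Ω : Set (Rn n)))ᶜ :=
    (h2 (right_mem_segment ℝ x z)).resolve_left hz
  obtain ⟨w, -, hw1, hw2⟩ := hconn _ _ Ω.isOpen isClosed_closure.isOpen_compl h2
    ⟨x, left_mem_segment ℝ x z, hx⟩ ⟨z, right_mem_segment ℝ x z, hzc⟩
  exact hw2 (subset_closure hw1)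

lemma bdist_nonneg (x : Rn n) : 0 ≤ bdist Ω x := Metric.infDist_nonneg

lemma lipschitz_bdist : LipschitzWith 1 (bdist Ω) := Metric.lipschitz_infDist_pt _

lemma continuous_bdist : Continuous (bdist Ω) := lipschitz_bdist.continuous

lemma bdist_pos (hne : (frontier (Ω : Set (Rn n))).Nonempty) {x : Rn n} (hx : x ∈ Ω) :
    0 < bdist Ω x := by
  refine (isClosed_frontier.notMem_iff_infDist_pos hne).1 fun h => notMem_of_mem_frontier h hx

lemma ball_bdist_subset {x : Rn n} (hx : x ∈ Ω) :
    Metric.ball x (bdist Ω x) ⊆ (Ω : Set (Rn n)) := by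
  intro z hz
  by_contra hzΩ
  obtain ⟨w, hw, hwf⟩ := exists_segment_mem_frontier hx hzΩ
  have h1 : bdist Ω x ≤ dist x w := Metric.infDist_le_dist_of_mem hwf
  have h2 : dist x w ≤ dist x z := by
    rw [← dist_add_dist_of_mem_segment hw]
    linarith [dist_nonneg (x := w) (y := z)]
  rw [Metric.mem_ball, dist_comm] at hz
  linarith

lemma le_bdist_of_ball_subset (hne : (frontier (Ω : Set (Rn n))).Nonempty) {x : Rn n} {R : ℝ}
    (h : Metric.ball x R ⊆ (Ω : Set (Rn n))) : R ≤ bdist Ω x := by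
  rw [bdist, Metric.le_infDist hne]
  intro y hy
  by_contra! hlt
  exact notMem_of_mem_frontier hy (h (by rwa [Metric.mem_ball, dist_comm]))

/-- A Euclidean gradient representing a continuous linear form. -/
lemma exists_gradient (l : Rn n →L[ℝ] ℝ) : ∃ g : Rn n, ‖g‖ = ‖l‖ ∧ ∀ v, inner ℝ g v = l v :=
  ⟨(InnerProductSpace.toDual ℝ (Rn n)).symm l, by simp, fun v => by simp⟩

/-- The centre is z = y + rν with ν the normalised gradient of ρ at y. A point y + d of Ω in this
ball satisfies |d|² < 2r⟨d, ν⟩, while ρ(y + d) < 0 ≤ ρ(y) and the K-Lipschitz bound on the gradient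
give |∇ρ(y)|⟨d, ν⟩ < K|d|². For r small compared with |∇ρ|/K the two are incompatible. -/
lemma exists_local_exterior_ball (hC2 : HasC2Boundary Ω) {x₀ : Rn n}
    (hx₀ : x₀ ∈ frontier (Ω : Set (Rn n))) :
    ∃ R > 0, ∃ r₀ > 0, ∀ y ∈ frontier (Ω : Set (Rn n)), y ∈ Metric.ball x₀ R →
      ∀ r, 0 < r → r ≤ r₀ → ∃ z, dist y z = r ∧ Disjoint (Metric.ball z r) (Ω : Set (Rn n)) := by
  obtain ⟨U, ρ, hU, hxU, hρ, hρ0, hΩ⟩ := hC2 x₀ hx₀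
  have hcd : ContDiffAt ℝ 1 (fderiv ℝ ρ) x₀ :=
    (hρ.contDiffAt (hU.mem_nhds hxU)).fderiv_right (m := 1) (by norm_num)
  obtain ⟨K, t, ht, hK⟩ := hcd.exists_lipschitzOnWith
  have hm0 : 0 < ‖fderiv ℝ ρ x₀‖ := norm_pos_iff.2 (hρ0 x₀ hxU)
  set m := ‖fderiv ℝ ρ x₀‖ / 2 with hm
  have hmpos : 0 < m := by positivity
  have hcont : ∀ᶠ y in 𝓝 x₀, m < ‖fderiv ℝ ρ y‖ :=
    hcd.continuousAt.norm.eventually (lt_mem_nhds (by rw [hm]; linarith))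
  obtain ⟨R, hR, hRs⟩ := Metric.mem_nhds_iff.1 (inter_mem (inter_mem (hU.mem_nhds hxU) ht) hcont)
  have hK0 : (0 : ℝ) ≤ K := K.2
  -- The bound R / 4 keeps points within 2r of y inside the ball where the gradient is controlled; K
  -- + 1 in place of K avoids a zero denominator.
  refine ⟨R / 2, by positivity, min (R / 4) (m / (2 * (K + 1))), by positivity, ?_⟩
  intro y hy hyR r hr hrr
  have hr1 : r ≤ R / 4 := hrr.trans (min_le_left _ _)
  have hr2 : r * (2 * (K + 1)) ≤ m := by
    rw [← le_div_iff₀ (by positivity)]; exact hrr.trans (min_le_right _ _)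
  have hyR' : y ∈ Metric.ball x₀ R := Metric.ball_subset_ball (by linarith) hyR
  have hmy : m < ‖fderiv ℝ ρ y‖ := (hRs hyR').2
  obtain ⟨g, hg1, hg2⟩ := exists_gradient (fderiv ℝ ρ y)
  have hgpos : 0 < ‖g‖ := by rw [hg1]; linarith
  have hnz : ‖(r / ‖g‖) • g‖ = r := by
    rw [norm_smul, Real.norm_of_nonneg (by positivity), div_mul_cancel₀ _ hgpos.ne']
  refine ⟨y + (r / ‖g‖) • g, by rw [dist_self_add_right, hnz], ?_⟩
  rw [Set.disjoint_left]
  intro x hx hxΩ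
  rw [Metric.mem_ball, dist_eq_norm] at hx
  set d := x - y with hd
  have hxd : x - (y + (r / ‖g‖) • g) = d - (r / ‖g‖) • g := by rw [hd]; abel
  rw [hxd] at hx
  have hdn : ‖d‖ < 2 * r := by
    calc ‖d‖ = ‖(d - (r / ‖g‖) • g) + (r / ‖g‖) • g‖ := by rw [sub_add_cancel]
      _ ≤ _ := norm_add_le _ _
      _ < 2 * r := by rw [hnz]; linarith
  have hsub : Metric.closedBall y ‖d‖ ⊆ Metric.ball x₀ R := by
    intro ξ hξ
    rw [Metric.mem_closedBall] at hξ
    rw [Metric.mem_ball] at hyR ⊢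
    linarith [dist_triangle ξ y x₀]
  have hxcl : x ∈ Metric.closedBall y ‖d‖ := by
    rw [Metric.mem_closedBall, dist_eq_norm]
  have htaylor : ‖ρ x - ρ y - fderiv ℝ ρ y (x - y)‖ ≤ (K * ‖d‖) * ‖x - y‖ := by
    refine (convex_closedBall y ‖d‖).norm_image_sub_le_of_norm_fderiv_le' (𝕜 := ℝ) ?_ ?_
      (Metric.mem_closedBall_self (norm_nonneg _)) hxcl
    · intro ξ hξ
      exact ((hρ.contDiffAt (hU.mem_nhds (hRs (hsub hξ)).1.1)).differentiableAt (by norm_num))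
    · intro ξ hξ
      have := hK.norm_sub_le (hRs (hsub hξ)).1.2 (hRs hyR').1.2
      refine this.trans (mul_le_mul_of_nonneg_left ?_ hK0)
      simpa [dist_eq_norm] using hξ
  have hsq : ‖d - (r / ‖g‖) • g‖ ^ 2 < r ^ 2 := by
    have := norm_nonneg (d - (r / ‖g‖) • g)
    nlinarith
  rw [norm_sub_sq_real, hnz, inner_smul_right, real_inner_comm, hg2] at hsq
  have hkey : ‖g‖ * ‖d‖ ^ 2 < 2 * r * fderiv ℝ ρ y d := by
    have h1 : ‖d‖ ^ 2 < 2 * (r / ‖g‖ * fderiv ℝ ρ y d) := by linarith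
    have h2 := mul_lt_mul_of_pos_left h1 hgpos
    have h3 : ‖g‖ * (2 * (r / ‖g‖ * fderiv ℝ ρ y d)) = 2 * r * fderiv ℝ ρ y d := by
      field_simp
    linarith
  have hρy : 0 ≤ ρ y := by
    by_contra! h
    exact notMem_of_mem_frontier hy ((hΩ y (hRs hyR').1.1).2 h)
  have hρx : ρ x < 0 := (hΩ x (hRs (hsub hxcl)).1.1).1 hxΩ
  have ht2 := (abs_le.1 htaylor).1
  rw [← hd] at ht2
  have h4 : fderiv ℝ ρ y d < K * ‖d‖ * ‖d‖ := by linarith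
  have h5 : m * ‖d‖ ^ 2 ≤ ‖g‖ * ‖d‖ ^ 2 :=
    mul_le_mul_of_nonneg_right (by rw [hg1]; exact hmy.le) (sq_nonneg _)
  have h6 : 2 * r * fderiv ℝ ρ y d ≤ 2 * r * (K * ‖d‖ * ‖d‖) :=
    mul_le_mul_of_nonneg_left h4.le (by linarith)
  have h7 : r * (2 * (K + 1)) * ‖d‖ ^ 2 ≤ m * ‖d‖ ^ 2 :=
    mul_le_mul_of_nonneg_right hr2 (sq_nonneg _)
  nlinarith [mul_nonneg hr.le (sq_nonneg ‖d‖)]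

/-- Compactness of the frontier makes the radius uniform. The local statement covers all smaller
radii, so that a minimum can be taken over a union of two sets. -/
lemma exists_exterior_ball (hb : Bornology.IsBounded (Ω : Set (Rn n))) (hC2 : HasC2Boundary Ω) :
    ∃ r > 0, ∀ y ∈ frontier (Ω : Set (Rn n)),
      ∃ z, dist y z = r ∧ Disjoint (Metric.ball z r) (Ω : Set (Rn n)) := by
  have key : ∃ r₀ > 0, ∀ y ∈ frontier (Ω : Set (Rn n)), y ∈ frontier (Ω : Set (Rn n)) →
      ∀ r, 0 < r → r ≤ r₀ → ∃ z, dist y z = r ∧ Disjoint (Metric.ball z r) (Ω : Set (Rn n)) := by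
    refine (isCompact_frontier hb).induction_on (p := fun s => ∃ r₀ > 0, ∀ y ∈ s,
      y ∈ frontier (Ω : Set (Rn n)) → ∀ r, 0 < r → r ≤ r₀ →
        ∃ z, dist y z = r ∧ Disjoint (Metric.ball z r) (Ω : Set (Rn n))) ?_ ?_ ?_ ?_
    · exact ⟨1, one_pos, fun y hy => hy.elim⟩
    · rintro s t hst ⟨r₀, h0, h⟩
      exact ⟨r₀, h0, fun y hy => h y (hst hy)⟩
    · rintro s t ⟨r₁, h1, hs⟩ ⟨r₂, h2, ht⟩
      refine ⟨min r₁ r₂, lt_min h1 h2, fun y hy hyf r hr hrr => ?_⟩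
      rcases hy with hy | hy
      · exact hs y hy hyf r hr (hrr.trans (min_le_left _ _))
      · exact ht y hy hyf r hr (hrr.trans (min_le_right _ _))
    · intro x hx
      obtain ⟨R, hR, r₀, hr₀, h⟩ := exists_local_exterior_ball hC2 hx
      exact ⟨_, mem_nhdsWithin_of_mem_nhds (Metric.ball_mem_nhds x hR), r₀, hr₀,
        fun y hy hyf => h y hyf hy⟩
  obtain ⟨r₀, h0, h⟩ := key
  exact ⟨r₀, h0, fun y hy => h y hy hy r₀ h0 le_rfl⟩

/-- The distance to the boundary is touched from above, at every point of `Ω`, by the distance to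
a ball of fixed radius `r`. -/
lemma exists_touching_ball (hn : 1 ≤ n) (hne : (Ω : Set (Rn n)).Nonempty)
    (hb : Bornology.IsBounded (Ω : Set (Rn n))) (hC2 : HasC2Boundary Ω) :
    ∃ r > 0, ∀ x ∈ Ω, ∃ z, ‖x - z‖ = bdist Ω x + r ∧ ∀ x' ∈ Ω, bdist Ω x' ≤ ‖x' - z‖ - r := by
  obtain ⟨r, hr, hball⟩ := exists_exterior_ball hb hC2
  refine ⟨r, hr, fun x hx => ?_⟩
  obtain ⟨y, hy, hxy⟩ := (isCompact_frontier hb).exists_infDist_eq_dist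
    (frontier_nonempty hn hne hb) x
  obtain ⟨z, hyz, hz⟩ := hball y hy
  -- On its way from x' to z the segment meets the frontier at a point w, which lies at distance at
  -- least r from z because the ball misses the closure of Ω.
  have hle : ∀ x' ∈ Ω, bdist Ω x' ≤ ‖x' - z‖ - r := by
    intro x' hx'
    have hzΩ : z ∉ Ω := fun h => Set.disjoint_left.1 hz (Metric.mem_ball_self hr) h
    obtain ⟨w, hw, hwf⟩ := exists_segment_mem_frontier hx' hzΩ
    have h1 : bdist Ω x' ≤ dist x' w := Metric.infDist_le_dist_of_mem hwf
    have h2 := dist_add_dist_of_mem_segment hw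
    have h3 : r ≤ dist w z := by
      by_contra! hlt
      have hdis := (hz.closure_right Metric.isOpen_ball)
      exact Set.disjoint_left.1 hdis hlt (frontier_subset_closure hwf)
    rw [← dist_eq_norm]
    linarith
  refine ⟨z, le_antisymm ?_ (by linarith [hle x hx]), hle⟩
  rw [← dist_eq_norm, bdist, hxy, ← hyz]
  exact dist_triangle _ _ _

end BoundaryGeometry

/-! ### The distribution of the boundary distance -/

section TubularNeighbourhood

variable {n : ℕ} {Ω : Opens (Rn n)}

/-- Near a boundary point, the distance to the boundary grows linearly in some direction. -/
lemma exists_growth_direction (hne : (frontier (Ω : Set (Rn n))).Nonempty)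
    (hC2 : HasC2Boundary Ω) {x₀ : Rn n} (hx₀ : x₀ ∈ frontier (Ω : Set (Rn n))) :
    ∃ R > 0, ∃ e : Rn n, ‖e‖ = 1 ∧ ∀ x ∈ Ω, x ∈ Metric.ball x₀ R → ∀ s, 0 ≤ s → s < 2 * R →
      bdist Ω x + s / 4 ≤ bdist Ω (x + s • e) := by
  obtain ⟨U, ρ, hU, hxU, hρ, hρ0, hΩ⟩ := hC2 x₀ hx₀
  have hcd : ContDiffAt ℝ 1 (fderiv ℝ ρ) x₀ :=
    (hρ.contDiffAt (hU.mem_nhds hxU)).fderiv_right (m := 1) (by norm_num)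
  obtain ⟨g, hg1, hg2⟩ := exists_gradient (fderiv ℝ ρ x₀)
  have hm : 0 < ‖g‖ := by rw [hg1]; exact norm_pos_iff.2 (hρ0 x₀ hxU)
  have hclose : ∀ᶠ y in 𝓝 x₀, ‖fderiv ℝ ρ y - fderiv ℝ ρ x₀‖ < ‖g‖ / 4 := by
    have h1 : Tendsto (fun y => ‖fderiv ℝ ρ y - fderiv ℝ ρ x₀‖) (𝓝 x₀) (𝓝 0) := by
      simpa using (hcd.continuousAt.tendsto.sub_const (fderiv ℝ ρ x₀)).norm
    exact h1.eventually (gt_mem_nhds (by positivity))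
  obtain ⟨R, hR, hRs⟩ := Metric.mem_nhds_iff.1 (inter_mem (hU.mem_nhds hxU) hclose)
  -- The direction is the inward normal at x₀. The factor 1 / 8 keeps x, p and w below within R of
  -- x₀.
  refine ⟨R / 8, by positivity, -((‖g‖)⁻¹ • g), ?_, ?_⟩
  · rw [norm_neg, norm_smul, norm_inv, norm_norm, inv_mul_cancel₀ hm.ne']
  set e : Rn n := -((‖g‖)⁻¹ • g) with he
  have hen : ‖e‖ = 1 := by
    rw [he, norm_neg, norm_smul, norm_inv, norm_norm, inv_mul_cancel₀ hm.ne']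
  have hge : fderiv ℝ ρ x₀ e = -‖g‖ := by
    rw [← hg2, he, inner_neg_right, inner_smul_right, real_inner_self_eq_norm_sq]
    field_simp
  intro x hxΩ hxR s hs0 hsR
  rcases hs0.eq_or_lt with rfl | hs
  · simp
  set d := bdist Ω x with hd
  have hdpos : 0 < d := bdist_pos hne hxΩ
  have hdR : d < R / 8 := by
    have h1 : d ≤ dist x x₀ := Metric.infDist_le_dist_of_mem hx₀
    exact h1.trans_lt hxR
  refine le_bdist_of_ball_subset hne fun w hw => ?_
  rw [Metric.mem_ball, dist_eq_norm] at hw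
  set v := w - (x + s • e) with hv
  have hw' : w = x + s • e + v := by rw [hv]; abel
  -- The displacement v, shorter than d + s/4, is split in proportion d : s/4. The first piece leads
  -- from x to a point p still in Ω. From p to w the defining function drops, because the term s • e
  -- outweighs both the second piece and the variation of the gradient.
  set a := d / (d + s / 4) with ha
  have ha0 : 0 < a := by positivity
  have h1a : 1 - a = (s / 4) / (d + s / 4) := by rw [ha]; field_simp; ring
  have hp1 : ‖a • v‖ < d := by
    rw [norm_smul, Real.norm_of_nonneg ha0.le, ha, div_mul_eq_mul_div, div_lt_iff₀ (by positivity)]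
    exact mul_lt_mul_of_pos_left hw hdpos
  have hp2 : ‖(1 - a) • v‖ ≤ s / 4 := by
    rw [norm_smul, h1a, Real.norm_of_nonneg (by positivity), div_mul_eq_mul_div,
      div_le_iff₀ (by positivity)]
    exact mul_le_mul_of_nonneg_left hw.le (by positivity)
  set p := x + a • v with hp
  have hpΩ : p ∈ Ω := by
    refine ball_bdist_subset hxΩ ?_
    rw [Metric.mem_ball, dist_eq_norm, hp, add_sub_cancel_left]
    exact hp1
  have hwp : w - p = s • e + (1 - a) • v := by rw [hw', hp]; module
  have hwpn : ‖w - p‖ ≤ s + s / 4 := by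
    rw [hwp]
    refine (norm_add_le _ _).trans (add_le_add ?_ hp2)
    rw [norm_smul, hen, mul_one, Real.norm_of_nonneg hs.le]
  have hpball : p ∈ Metric.ball x₀ R := by
    rw [Metric.mem_ball] at hxR ⊢
    have : dist p x = ‖a • v‖ := by rw [dist_eq_norm, hp, add_sub_cancel_left]
    linarith [dist_triangle p x x₀]
  have hwball : w ∈ Metric.ball x₀ R := by
    rw [Metric.mem_ball] at hxR ⊢
    have h1 : dist p x = ‖a • v‖ := by rw [dist_eq_norm, hp, add_sub_cancel_left]
    have h2 : dist w p = ‖w - p‖ := dist_eq_norm _ _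
    linarith [dist_triangle p x x₀, dist_triangle w p x₀]
  have hmv : ‖ρ w - ρ p - fderiv ℝ ρ x₀ (w - p)‖ ≤ (‖g‖ / 4) * ‖w - p‖ := by
    refine (convex_ball x₀ R).norm_image_sub_le_of_norm_fderiv_le' (𝕜 := ℝ) ?_ ?_ hpball hwball
    · exact fun ξ hξ =>
        (hρ.contDiffAt (hU.mem_nhds (hRs hξ).1)).differentiableAt (by norm_num)
    · exact fun ξ hξ => (hRs hξ).2.le
  have hlin : fderiv ℝ ρ x₀ (w - p) ≤ -‖g‖ * s + ‖g‖ * (s / 4) := by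
    rw [hwp, map_add, map_smul, hge, smul_eq_mul]
    have h1 : fderiv ℝ ρ x₀ ((1 - a) • v) ≤ ‖fderiv ℝ ρ x₀‖ * ‖(1 - a) • v‖ :=
      (le_abs_self _).trans ((fderiv ℝ ρ x₀).le_opNorm ((1 - a) • v))
    rw [← hg1] at h1
    have h2 := mul_le_mul_of_nonneg_left hp2 hm.le
    linarith
  have hρp : ρ p < 0 := (hΩ p (hRs hpball).1).1 hpΩ
  have h3 := (abs_le.1 hmv).2
  have h4 : ‖g‖ / 4 * ‖w - p‖ ≤ ‖g‖ / 4 * (s + s / 4) :=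
    mul_le_mul_of_nonneg_left hwpn (by positivity)
  refine (hΩ w (hRs hwball).1).2 ?_
  nlinarith [mul_pos hm hs]

/-- An expanding map of a set of reals does not decrease its measure by more than a factor. -/
lemma volume_le_of_expanding {T E : Set ℝ} {k : ℝ → ℝ} {c : ℝ} (hc : 0 < c)
    (hk : ∀ s ∈ T, ∀ s' ∈ T, |s - s'| ≤ c * |k s - k s'|) (hE : Set.MapsTo k T E) :
    volume T ≤ ENNReal.ofReal c * volume E := by
  have hinj : Set.InjOn k T := by
    intro s hs s' hs' h
    have := hk s hs s' hs'
    rw [h, sub_self, abs_zero, mul_zero] at this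
    exact sub_eq_zero.1 (abs_nonpos_iff.1 this)
  -- The inverse of k on its image is c-Lipschitz. One-dimensional Hausdorff measure is Lebesgue
  -- measure, and its behaviour under Lipschitz maps requires no measurability of the image.
  have hlip : LipschitzOnWith c.toNNReal (Function.invFunOn k T) (k '' T) := by
    refine LipschitzOnWith.of_dist_le_mul ?_
    rintro _ ⟨s, hs, rfl⟩ _ ⟨s', hs', rfl⟩
    rw [hinj.leftInvOn_invFunOn hs, hinj.leftInvOn_invFunOn hs', Real.coe_toNNReal _ hc.le]
    exact hk s hs s' hs'
  have himg : Function.invFunOn k T '' (k '' T) = T := hinj.leftInvOn_invFunOn.image_image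
  have := hlip.hausdorffMeasure_image_le (d := 1) zero_le_one
  rw [himg, hausdorffMeasure_real, ENNReal.rpow_one] at this
  exact this.trans (mul_le_mul_right (measure_mono hE.image_subset) _)

/-- Along lines in the growth direction the distance increases at rate at least 1/4, so the
parameters at which it lies in E have measure at most 4|E|. Integrating over the lines gives the
bound on the volume. -/
lemma exists_local_tube_bound (hne : (frontier (Ω : Set (Rn n))).Nonempty)
    (hC2 : HasC2Boundary Ω) {x₀ : Rn n} (hx₀ : x₀ ∈ frontier (Ω : Set (Rn n))) :
    ∃ R > 0, ∃ A : ℝ≥0∞, A ≠ ⊤ ∧ ∀ E : Set ℝ, MeasurableSet E →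
      volume {x | x ∈ Ω ∧ x ∈ Metric.ball x₀ R ∧ bdist Ω x ∈ E} ≤ A * volume E := by
  obtain ⟨R, hR, e, he, hgrow⟩ := exists_growth_direction hne hC2 hx₀
  refine ⟨R, hR, (ENNReal.ofReal R)⁻¹ * (ENNReal.ofReal 4 * volume (Metric.ball x₀ (2 * R))), ?_, ?_⟩
  · have h1 : volume (Metric.ball x₀ (2 * R)) ≠ ⊤ := measure_ball_lt_top.ne
    have h2 : ENNReal.ofReal R ≠ 0 := by simpa using hR
    finiteness
  intro E hE
  set S := {x | x ∈ Ω ∧ x ∈ Metric.ball x₀ R ∧ bdist Ω x ∈ E} with hS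
  have hSm : MeasurableSet S :=
    Ω.isOpen.measurableSet.inter
      (Metric.isOpen_ball.measurableSet.inter (continuous_bdist.measurable hE))
  have hind : Measurable (S.indicator (1 : Rn n → ℝ≥0∞)) := measurable_one.indicator hSm
  have hfiber : ∀ x, ∫⁻ s in Set.Ioo 0 R, S.indicator (1 : Rn n → ℝ≥0∞) (x + s • e)
      ≤ (Metric.ball x₀ (2 * R)).indicator (fun _ => ENNReal.ofReal 4 * volume E) x := by
    intro x
    set T := {s | s ∈ Set.Ioo 0 R ∧ x + s • e ∈ S} with hT
    have hTm : MeasurableSet T := by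
      have : Measurable fun s : ℝ => x + s • e := by fun_prop
      exact measurableSet_Ioo.inter (this hSm)
    have h1 : ∫⁻ s in Set.Ioo 0 R, S.indicator (1 : Rn n → ℝ≥0∞) (x + s • e) = volume T := by
      rw [← lintegral_indicator measurableSet_Ioo, ← lintegral_indicator_one hTm]
      refine lintegral_congr fun s => ?_
      by_cases h1 : s ∈ Set.Ioo 0 R
      · by_cases h2 : x + s • e ∈ S
        · rw [Set.indicator_of_mem h1, Set.indicator_of_mem h2,
            Set.indicator_of_mem (show s ∈ T from ⟨h1, h2⟩)]
          rfl
        · rw [Set.indicator_of_mem h1, Set.indicator_of_notMem h2,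
            Set.indicator_of_notMem (fun h : s ∈ T => h2 h.2)]
      · rw [Set.indicator_of_notMem h1, Set.indicator_of_notMem (fun h : s ∈ T => h1 h.1)]
    rw [h1]
    by_cases hx : x ∈ Metric.ball x₀ (2 * R)
    · rw [Set.indicator_of_mem hx]
      have hmono : ∀ s ∈ T, ∀ s' ∈ T, s ≤ s' →
          s' - s ≤ 4 * (bdist Ω (x + s' • e) - bdist Ω (x + s • e)) := by
        intro s hs s' hs' hss
        have h2 := hgrow _ hs.2.1 hs.2.2.1 (s' - s) (by linarith) (by linarith [hs.1.1, hs'.1.2])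
        have h3 : x + s • e + (s' - s) • e = x + s' • e := by module
        rw [h3] at h2
        linarith
      refine volume_le_of_expanding (k := fun s => bdist Ω (x + s • e)) (by norm_num) ?_
        fun s hs => hs.2.2.2
      intro s hs s' hs'
      rcases le_total s s' with h | h
      · have := hmono s hs s' hs' h
        rw [abs_sub_comm, abs_of_nonneg (by linarith), abs_sub_comm]
        exact this.trans (mul_le_mul_of_nonneg_left (le_abs_self _) (by norm_num))
      · have := hmono s' hs' s hs h
        rw [abs_of_nonneg (by linarith)]
        exact this.trans (mul_le_mul_of_nonneg_left (le_abs_self _) (by norm_num))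
    · rw [Set.indicator_of_notMem hx]
      have : T = ∅ := by
        rw [Set.eq_empty_iff_forall_notMem]
        intro s hs
        apply hx
        have h2 : dist (x + s • e) x₀ < R := hs.2.2.1
        have h3 : dist x (x + s • e) = s := by
          rw [dist_self_add_right, norm_smul, he, mul_one, Real.norm_of_nonneg hs.1.1.le]
        rw [Metric.mem_ball]
        linarith [dist_triangle x (x + s • e) x₀, hs.1.2]
      simp [this]
  -- Averaging over the shifts s • e replaces a change of coordinates: each shift preserves the
  -- volume of S, so Tonelli yields R times that volume.
  have hswap : volume S * ENNReal.ofReal R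
      = ∫⁻ x, ∫⁻ s in Set.Ioo 0 R, S.indicator (1 : Rn n → ℝ≥0∞) (x + s • e) := by
    rw [lintegral_lintegral_swap]
    · have : ∀ s : ℝ, ∫⁻ x, S.indicator (1 : Rn n → ℝ≥0∞) (x + s • e) = volume S := by
        intro s
        rw [lintegral_add_right_eq_self (S.indicator (1 : Rn n → ℝ≥0∞)), lintegral_indicator_one hSm]
      simp_rw [this]
      simp
    · have : Measurable fun q : Rn n × ℝ => q.1 + q.2 • e := by fun_prop
      exact (hind.comp this).aemeasurable
  have hle : volume S * ENNReal.ofReal R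
      ≤ ENNReal.ofReal 4 * volume E * volume (Metric.ball x₀ (2 * R)) := by
    rw [hswap]
    refine (lintegral_mono hfiber).trans_eq ?_
    rw [lintegral_indicator Metric.isOpen_ball.measurableSet, setLIntegral_const]
  have hR0 : ENNReal.ofReal R ≠ 0 := by simpa using hR
  calc volume S = (ENNReal.ofReal R)⁻¹ * (volume S * ENNReal.ofReal R) := by
        rw [mul_comm (volume S), ← mul_assoc, ENNReal.inv_mul_cancel hR0 ENNReal.ofReal_ne_top,
          one_mul]
    _ ≤ (ENNReal.ofReal R)⁻¹ *
        (ENNReal.ofReal 4 * volume E * volume (Metric.ball x₀ (2 * R))) := by gcongr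
    _ = _ := by ring

/-- The image of Lebesgue measure under the distance to the boundary is bounded by a multiple of
Lebesgue measure near `0`. -/
lemma exists_tube_bound (hne : (frontier (Ω : Set (Rn n))).Nonempty)
    (hb : Bornology.IsBounded (Ω : Set (Rn n))) (hC2 : HasC2Boundary Ω) :
    ∃ t₁ > 0, ∃ A : ℝ≥0∞, A ≠ ⊤ ∧ ∀ E : Set ℝ, MeasurableSet E →
      volume {x | x ∈ Ω ∧ bdist Ω x < t₁ ∧ bdist Ω x ∈ E} ≤ A * volume E := by
  have key : ∃ O : Set (Rn n), IsOpen O ∧ frontier (Ω : Set (Rn n)) ⊆ O ∧ ∃ A : ℝ≥0∞, A ≠ ⊤ ∧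
      ∀ E : Set ℝ, MeasurableSet E → volume {x | x ∈ Ω ∧ x ∈ O ∧ bdist Ω x ∈ E} ≤ A * volume E := by
    refine (isCompact_frontier hb).induction_on (p := fun s => ∃ O : Set (Rn n), IsOpen O ∧
      s ⊆ O ∧ ∃ A : ℝ≥0∞, A ≠ ⊤ ∧ ∀ E : Set ℝ, MeasurableSet E →
        volume {x | x ∈ Ω ∧ x ∈ O ∧ bdist Ω x ∈ E} ≤ A * volume E) ?_ ?_ ?_ ?_
    · exact ⟨∅, isOpen_empty, le_rfl, 0, by simp, fun E _ => by simp⟩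
    · rintro s t hst ⟨O, hO, htO, h⟩
      exact ⟨O, hO, hst.trans htO, h⟩
    · rintro s t ⟨O₁, hO₁, hs, A₁, hA₁, h₁⟩ ⟨O₂, hO₂, ht, A₂, hA₂, h₂⟩
      refine ⟨O₁ ∪ O₂, hO₁.union hO₂, Set.union_subset_union hs ht, A₁ + A₂, by finiteness,
        fun E hE => ?_⟩
      have hsub : {x | x ∈ Ω ∧ x ∈ O₁ ∪ O₂ ∧ bdist Ω x ∈ E}
          ⊆ {x | x ∈ Ω ∧ x ∈ O₁ ∧ bdist Ω x ∈ E} ∪ {x | x ∈ Ω ∧ x ∈ O₂ ∧ bdist Ω x ∈ E} := by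
        rintro x ⟨hx, hx1 | hx1, hx2⟩
        · exact Or.inl ⟨hx, hx1, hx2⟩
        · exact Or.inr ⟨hx, hx1, hx2⟩
      refine (measure_mono hsub).trans ((measure_union_le _ _).trans ?_)
      rw [add_mul]
      exact add_le_add (h₁ E hE) (h₂ E hE)
    · intro x hx
      obtain ⟨R, hR, A, hA, h⟩ := exists_local_tube_bound hne hC2 hx
      exact ⟨_, mem_nhdsWithin_of_mem_nhds (Metric.ball_mem_nhds x hR), _, Metric.isOpen_ball,
        le_rfl, A, hA, h⟩
  obtain ⟨O, hO, hfO, A, hA, h⟩ := key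
  obtain ⟨t₁, ht₁, hsub⟩ := (isCompact_frontier hb).exists_thickening_subset_open hO hfO
  refine ⟨t₁, ht₁, A, hA, fun E hE => (measure_mono ?_).trans (h E hE)⟩
  rintro x ⟨hx, hx1, hx2⟩
  refine ⟨hx, hsub ?_, hx2⟩
  rw [Metric.mem_thickening_iff_infDist_lt hne]
  exact hx1

end TubularNeighbourhood

/-! ### Lipschitz functions on intervals and Taylor bounds -/

section LipschitzOnIntervals

/-- `h` is Lipschitz on `[α, β]`. -/
def LipOn (h : ℝ → ℝ) (α β : ℝ) : Prop :=
  ∃ K : ℝ, ∀ s ∈ Set.Icc α β, ∀ t ∈ Set.Icc α β, |h s - h t| ≤ K * |s - t|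

variable {h k : ℝ → ℝ} {α β : ℝ}

lemma LipOn.bounded (hh : LipOn h α β) : ∃ C : ℝ, 0 ≤ C ∧ ∀ s ∈ Set.Icc α β, |h s| ≤ C := by
  obtain ⟨K, hK⟩ := hh
  refine ⟨|h α| + |K| * |β - α|, by positivity, fun s hs => ?_⟩
  have hα : α ∈ Set.Icc α β := ⟨le_rfl, hs.1.trans hs.2⟩
  have h1 := hK s hs α hα
  have h2 : |s - α| ≤ |β - α| := by
    rw [abs_of_nonneg (by linarith [hs.1]), abs_of_nonneg (by linarith [hs.1, hs.2])]
    linarith [hs.2]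
  have h3 : K * |s - α| ≤ |K| * |β - α| :=
    mul_le_mul (le_abs_self K) h2 (abs_nonneg _) (abs_nonneg _)
  have h4 : |h s| ≤ |h α| + |h s - h α| := by
    calc |h s| = |h α + (h s - h α)| := by ring_nf
      _ ≤ _ := abs_add_le _ _
  linarith

lemma LipOn.add (hh : LipOn h α β) (hk : LipOn k α β) : LipOn (fun t => h t + k t) α β := by
  obtain ⟨K, hK⟩ := hh
  obtain ⟨L, hL⟩ := hk
  refine ⟨K + L, fun s hs t ht => ?_⟩
  calc |h s + k s - (h t + k t)| = |(h s - h t) + (k s - k t)| := by ring_nf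
    _ ≤ _ := abs_add_le _ _
    _ ≤ K * |s - t| + L * |s - t| := add_le_add (hK s hs t ht) (hL s hs t ht)
    _ = _ := by ring

lemma LipOn.mul (hh : LipOn h α β) (hk : LipOn k α β) : LipOn (fun t => h t * k t) α β := by
  obtain ⟨C, hC0, hC⟩ := hh.bounded
  obtain ⟨D, hD0, hD⟩ := hk.bounded
  obtain ⟨K, hK⟩ := hh
  obtain ⟨L, hL⟩ := hk
  refine ⟨C * L + D * K, fun s hs t ht => ?_⟩
  calc |h s * k s - h t * k t| = |h s * (k s - k t) + k t * (h s - h t)| := by ring_nf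
    _ ≤ |h s * (k s - k t)| + |k t * (h s - h t)| := abs_add_le _ _
    _ = |h s| * |k s - k t| + |k t| * |h s - h t| := by rw [abs_mul, abs_mul]
    _ ≤ C * (L * |s - t|) + D * (K * |s - t|) :=
        add_le_add (mul_le_mul (hC s hs) (hL s hs t ht) (abs_nonneg _) hC0)
          (mul_le_mul (hD t ht) (hK s hs t ht) (abs_nonneg _) hD0)
    _ = _ := by ring

lemma lipOn_of_hasDerivAt {h' : ℝ → ℝ} (hd : ∀ t ∈ Set.Icc α β, HasDerivAt h (h' t) t)
    (hc : ContinuousOn h' (Set.Icc α β)) : LipOn h α β := by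
  obtain ⟨C, hC⟩ := isCompact_Icc.exists_bound_of_continuousOn hc
  refine ⟨C, fun s hs t ht => ?_⟩
  exact (convex_Icc α β).norm_image_sub_le_of_norm_hasDerivWithin_le
    (fun x hx => (hd x hx).hasDerivWithinAt) hC ht hs

lemma LipOn.continuousOn (hh : LipOn h α β) : ContinuousOn h (Set.Icc α β) := by
  obtain ⟨K, hK⟩ := hh
  refine (LipschitzOnWith.of_dist_le_mul (K := K.toNNReal) fun s hs t ht => ?_).continuousOn
  rw [Real.dist_eq, Real.dist_eq]
  exact (hK s hs t ht).trans (mul_le_mul_of_nonneg_right (Real.le_coe_toNNReal K) (abs_nonneg _))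

/-- Second order upper Taylor bound for a function with Lipschitz derivative. -/
lemma taylor_le_of_lipschitz_deriv {h' : ℝ → ℝ} {K s t : ℝ}
    (hd : ∀ r ∈ Set.uIcc t s, HasDerivAt h (h' r) r)
    (hK : ∀ r ∈ Set.uIcc t s, |h' r - h' t| ≤ K * |s - t|) :
    |h s - h t - h' t * (s - t)| ≤ K * |s - t| ^ 2 := by
  have h1 : ∀ r ∈ Set.uIcc t s, HasDerivWithinAt (fun r => h r - h' t * r) (h' r - h' t)
      (Set.uIcc t s) r := fun r hr => by
    have e : HasDerivAt (fun r => h' t * r) (h' t) r := by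
      simpa using (hasDerivAt_id r).const_mul (h' t)
    exact ((hd r hr).sub e).hasDerivWithinAt
  have := (convex_uIcc t s).norm_image_sub_le_of_norm_hasDerivWithin_le h1
    (fun r hr => hK r hr) Set.left_mem_uIcc Set.right_mem_uIcc
  simp only [Real.norm_eq_abs] at this
  calc |h s - h t - h' t * (s - t)| = |h s - h' t * s - (h t - h' t * t)| := by ring_nf
    _ ≤ _ := this
    _ = _ := by ring

/-- After subtracting (c/2)(r - t)², the derivative differs from `h' t` by at most ε|r - t|.
Differentiability of `h'` at the single point t is enough, as the second derivatives used later
exist only almost everywhere. -/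
lemma eventually_taylor_le {h' : ℝ → ℝ} {c t : ℝ} (hd : ∀ᶠ r in 𝓝 t, HasDerivAt h (h' r) r)
    (hc : HasDerivAt h' c t) {ε : ℝ} (hε : 0 < ε) :
    ∀ᶠ s in 𝓝 t, h s ≤ h t + h' t * (s - t) + (c / 2 + ε) * (s - t) ^ 2 := by
  have h1 : ∀ᶠ r in 𝓝 t, |h' r - h' t - c * (r - t)| ≤ ε * |r - t| := by
    have := (hasDerivAt_iff_isLittleO.1 hc).bound hε
    filter_upwards [this] with r hr
    simpa [mul_comm] using hr
  obtain ⟨δ, hδ, hball⟩ := Metric.eventually_nhds_iff_ball.1 (hd.and h1)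
  filter_upwards [Metric.ball_mem_nhds t hδ] with s hs
  have hsub : ∀ r ∈ Set.uIcc t s, r ∈ Metric.ball t δ := by
    intro r hr
    have : Set.uIcc t s ⊆ Metric.ball t δ :=
      (convex_ball t δ).ordConnected.uIcc_subset (Metric.mem_ball_self hδ) hs
    exact this hr
  have habs : ∀ r ∈ Set.uIcc t s, |r - t| ≤ |s - t| := fun r hr =>
    Set.abs_sub_left_of_mem_uIcc hr
  have := taylor_le_of_lipschitz_deriv (h := fun r => h r - c / 2 * (r - t) ^ 2)
    (h' := fun r => h' r - c * (r - t)) (K := ε) (s := s) (t := t) (fun r hr => ?_) (fun r hr => ?_)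
  · simp only [sub_self, mul_zero, sub_zero, ne_eq, OfNat.ofNat_ne_zero, not_false_eq_true,
      zero_pow, sq_abs] at this
    have := (abs_le.1 this).2
    linarith
  · have h2 : HasDerivAt (fun r => c / 2 * (r - t) ^ 2) (c * (r - t)) r :=
      ((((hasDerivAt_id' r).sub_const t).pow 2).const_mul (c / 2)).congr_deriv (by norm_num; ring)
    exact (hball r (hsub r hr)).1.sub h2
  · simp only [sub_self, mul_zero, sub_zero]
    have h3 := (hball r (hsub r hr)).2
    have h4 := mul_le_mul_of_nonneg_left (habs r hr) hε.le
    rw [show h' r - c * (r - t) - h' t = h' r - h' t - c * (r - t) by ring]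
    exact h3.trans h4

end LipschitzOnIntervals

/-! ### Reduction of order with a cutoff -/

section Profile

/-- `φ` is a positive solution on `(0, a)` of `φ'' ≤ W φ`, with logarithmic derivative `y`. -/
structure Comparison (a C : ℝ) (W φ y : ℝ → ℝ) : Prop where
  C_nonneg : 0 ≤ C
  pos : ∀ t ∈ Set.Ioo 0 a, 0 < φ t
  hasDeriv : ∀ t ∈ Set.Ioo 0 a, HasDerivAt φ (y t * φ t) t
  lip : ∀ α β, 0 < α → β < a → LipOn y α β
  riccati : ∀ᵐ t, t ∈ Set.Ioo 0 a → ∃ y', HasDerivAt y y' t ∧ y' + y t ^ 2 ≤ W t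
  lower : ∀ t ∈ Set.Ioo 0 a, -1 ≤ 2 * t * y t
  upper : ∀ t ∈ Set.Ioo 0 a, 2 * y t + C ≤ 0

/-- The weight `φ⁻² e^{-Cs}`. -/
def wgt (C : ℝ) (φ : ℝ → ℝ) (s : ℝ) : ℝ := (φ s ^ 2)⁻¹ * Real.exp (-(C * s))

/-- The function `φ²`, cut off to `(ε₀, ε₁]`. -/
def cutSq (φ : ℝ → ℝ) (ε₀ ε₁ : ℝ) : ℝ → ℝ := (Set.Ioc ε₀ ε₁).indicator fun s => φ s ^ 2

/-- The cutoff function that increases from `0` at `ε₀` to `1` at `ε₁` with density `φ²`. -/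
def cutoff (φ : ℝ → ℝ) (ε₀ ε₁ t : ℝ) : ℝ :=
  (∫ s in ε₀..t, cutSq φ ε₀ ε₁ s) / ∫ s in ε₀..ε₁, φ s ^ 2

/-- The primitive of the cut off weight. -/
def cutPrim (C : ℝ) (φ : ℝ → ℝ) (ε₀ ε₁ t : ℝ) : ℝ :=
  ∫ s in ε₀..t, cutoff φ ε₀ ε₁ s * wgt C φ s

/-- The cut off second solution. -/
def cutSol (C : ℝ) (φ : ℝ → ℝ) (ε₀ ε₁ t : ℝ) : ℝ := φ t * cutPrim C φ ε₀ ε₁ t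

/-- The derivative of `cutSol`. -/
def cutSol' (C : ℝ) (φ y : ℝ → ℝ) (ε₀ ε₁ t : ℝ) : ℝ :=
  y t * φ t * cutPrim C φ ε₀ ε₁ t + φ t * (cutoff φ ε₀ ε₁ t * wgt C φ t)

variable {a C ε₀ ε₁ : ℝ} {W φ y : ℝ → ℝ}

namespace Comparison

lemma continuousOn (hc : Comparison a C W φ y) : ContinuousOn φ (Set.Ioo 0 a) :=
  fun t ht => (hc.hasDeriv t ht).continuousAt.continuousWithinAt

lemma continuousOn_y (hc : Comparison a C W φ y) : ContinuousOn y (Set.Ioo 0 a) := by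
  intro t ht
  have h1 := (hc.lip (t / 2) ((t + a) / 2) (by linarith [ht.1]) (by linarith [ht.2])).continuousOn
  exact (h1.continuousAt (Icc_mem_nhds (by linarith [ht.1])
    (by linarith [ht.2]))).continuousWithinAt

lemma lipOn_phi (hc : Comparison a C W φ y) {α β : ℝ} (hα : 0 < α) (hβ : β < a) : LipOn φ α β := by
  have hsub : Set.Icc α β ⊆ Set.Ioo 0 a := fun t ht => ⟨hα.trans_le ht.1, ht.2.trans_lt hβ⟩
  exact lipOn_of_hasDerivAt (fun t ht => hc.hasDeriv t (hsub ht))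
    ((hc.continuousOn_y.mul hc.continuousOn).mono hsub)

lemma wgt_pos (hc : Comparison a C W φ y) {t : ℝ} (ht : t ∈ Set.Ioo 0 a) : 0 < wgt C φ t := by
  have := hc.pos t ht
  unfold wgt
  positivity

lemma hasDerivAt_wgt (hc : Comparison a C W φ y) {t : ℝ} (ht : t ∈ Set.Ioo 0 a) :
    HasDerivAt (wgt C φ) (-(2 * y t + C) * wgt C φ t) t := by
  have hp := hc.pos t ht
  have h1 := ((hc.hasDeriv t ht).pow 2).inv (pow_ne_zero 2 hp.ne')
  have h2 : HasDerivAt (fun s => Real.exp (-(C * s))) (Real.exp (-(C * t)) * (-C)) t := by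
    have : HasDerivAt (fun s => -(C * s)) (-C) t :=
      ((hasDerivAt_id t).const_mul C).neg.congr_deriv (by simp)
    exact this.exp
  refine (h1.mul h2).congr_deriv ?_
  simp only [wgt, Pi.pow_apply, Pi.inv_apply]
  field_simp
  ring

lemma continuousOn_wgt (hc : Comparison a C W φ y) : ContinuousOn (wgt C φ) (Set.Ioo 0 a) :=
  fun _ ht => (hc.hasDerivAt_wgt ht).continuousAt.continuousWithinAt

lemma lipOn_wgt (hc : Comparison a C W φ y) {α β : ℝ} (hα : 0 < α) (hβ : β < a) :
    LipOn (wgt C φ) α β := by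
  have hsub : Set.Icc α β ⊆ Set.Ioo 0 a := fun t ht => ⟨hα.trans_le ht.1, ht.2.trans_lt hβ⟩
  refine lipOn_of_hasDerivAt (fun t ht => hc.hasDerivAt_wgt (hsub ht)) ?_
  exact ((((continuousOn_const.mul hc.continuousOn_y).add continuousOn_const).neg).mul
    hc.continuousOn_wgt).mono hsub

/-- The logarithmic derivative of the weight is -(2y + C), which is nonnegative by `upper`. -/
lemma monotoneOn_wgt (hc : Comparison a C W φ y) : MonotoneOn (wgt C φ) (Set.Ioo 0 a) := by
  refine monotoneOn_of_hasDerivWithinAt_nonneg (f' := fun t => -(2 * y t + C) * wgt C φ t)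
    (convex_Ioo 0 a) hc.continuousOn_wgt ?_ ?_
  · intro t ht
    rw [interior_Ioo] at ht ⊢
    exact (hc.hasDerivAt_wgt ht).hasDerivWithinAt
  · intro t ht
    rw [interior_Ioo] at ht
    exact mul_nonneg (by linarith [hc.upper t ht]) (hc.wgt_pos ht).le

lemma intervalIntegrable_sq (hc : Comparison a C W φ y) {s t : ℝ} (hs : s ∈ Set.Ioo 0 a)
    (ht : t ∈ Set.Ioo 0 a) : IntervalIntegrable (fun s => φ s ^ 2) volume s t := by
  refine ContinuousOn.intervalIntegrable ((hc.continuousOn.pow 2).mono ?_)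
  exact Set.ordConnected_Ioo.uIcc_subset hs ht

lemma integral_sq_pos (hc : Comparison a C W φ y) (h₀ : 0 < ε₀) (h₁ : ε₀ < ε₁) (h₂ : ε₁ < a) :
    0 < ∫ s in ε₀..ε₁, φ s ^ 2 := by
  refine intervalIntegral.intervalIntegral_pos_of_pos_on
    (hc.intervalIntegrable_sq ⟨h₀, h₁.trans h₂⟩ ⟨h₀.trans h₁, h₂⟩) (fun t ht => ?_) h₁
  have := hc.pos t ⟨h₀.trans ht.1, ht.2.trans h₂⟩
  positivity

lemma integrable_cutSq (hc : Comparison a C W φ y) (h₀ : 0 < ε₀) (h₁ : ε₀ < ε₁) (h₂ : ε₁ < a) :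
    Integrable (cutSq φ ε₀ ε₁) := by
  rw [cutSq, integrable_indicator_iff measurableSet_Ioc]
  exact (intervalIntegrable_iff_integrableOn_Ioc_of_le h₁.le).1
    (hc.intervalIntegrable_sq ⟨h₀, h₁.trans h₂⟩ ⟨h₀.trans h₁, h₂⟩)

lemma cutSq_nonneg (t : ℝ) : 0 ≤ cutSq φ ε₀ ε₁ t :=
  Set.indicator_nonneg (fun _ _ => sq_nonneg _) t

lemma cutoff_of_le {t : ℝ} (ht : t ≤ ε₀) : cutoff φ ε₀ ε₁ t = 0 := by
  have : ∫ s in ε₀..t, cutSq φ ε₀ ε₁ s = 0 := by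
    rw [intervalIntegral.integral_of_ge ht]
    have h : ∀ s ∈ Set.Ioc t ε₀, cutSq φ ε₀ ε₁ s = 0 := fun s hs =>
      Set.indicator_of_notMem (fun h => absurd h.1 (not_lt.2 hs.2)) _
    rw [setIntegral_congr_fun measurableSet_Ioc h]
    simp
  rw [cutoff, this, zero_div]

lemma monotone_cutoff (hc : Comparison a C W φ y) (h₀ : 0 < ε₀) (h₁ : ε₀ < ε₁) (h₂ : ε₁ < a) :
    Monotone (cutoff φ ε₀ ε₁) := by
  intro s t hst
  have hi := hc.integrable_cutSq h₀ h₁ h₂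
  refine div_le_div_of_nonneg_right ?_ (hc.integral_sq_pos h₀ h₁ h₂).le
  have := intervalIntegral.integral_interval_sub_left (a := ε₀) (b := t) (c := s) (μ := volume)
    (f := cutSq φ ε₀ ε₁) hi.intervalIntegrable hi.intervalIntegrable
  have h3 : 0 ≤ ∫ r in s..t, cutSq φ ε₀ ε₁ r :=
    intervalIntegral.integral_nonneg hst fun r _ => cutSq_nonneg r
  linarith

lemma cutoff_nonneg (hc : Comparison a C W φ y) (h₀ : 0 < ε₀) (h₁ : ε₀ < ε₁) (h₂ : ε₁ < a)
    (t : ℝ) : 0 ≤ cutoff φ ε₀ ε₁ t := by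
  rcases le_total t ε₀ with h | h
  · rw [cutoff_of_le h]
  · rw [← cutoff_of_le (φ := φ) (ε₁ := ε₁) (le_refl ε₀)]
    exact hc.monotone_cutoff h₀ h₁ h₂ h

lemma one_le_cutoff (hc : Comparison a C W φ y) (h₀ : 0 < ε₀) (h₁ : ε₀ < ε₁) (h₂ : ε₁ < a)
    {t : ℝ} (ht : ε₁ ≤ t) : 1 ≤ cutoff φ ε₀ ε₁ t := by
  refine le_trans (le_of_eq ?_) (hc.monotone_cutoff h₀ h₁ h₂ ht)
  have : ∫ s in ε₀..ε₁, cutSq φ ε₀ ε₁ s = ∫ s in ε₀..ε₁, φ s ^ 2 := by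
    rw [intervalIntegral.integral_of_le h₁.le, intervalIntegral.integral_of_le h₁.le]
    exact setIntegral_congr_fun measurableSet_Ioc fun s hs => Set.indicator_of_mem hs _
  rw [cutoff, this, div_self (hc.integral_sq_pos h₀ h₁ h₂).ne']

lemma lipOn_cutoff (hc : Comparison a C W φ y) (h₀ : 0 < ε₀) (h₁ : ε₀ < ε₁) (h₂ : ε₁ < a)
    (α β : ℝ) : LipOn (cutoff φ ε₀ ε₁) α β := by
  obtain ⟨D, hD0, hD⟩ := (hc.lipOn_phi h₀ h₂).bounded
  have hb : ∀ s, |cutSq φ ε₀ ε₁ s| ≤ D ^ 2 := by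
    intro s
    by_cases hs : s ∈ Set.Ioc ε₀ ε₁
    · rw [cutSq, Set.indicator_of_mem hs, abs_pow]
      exact pow_le_pow_left₀ (abs_nonneg _) (hD s ⟨hs.1.le, hs.2⟩) 2
    · rw [cutSq, Set.indicator_of_notMem hs, abs_zero]
      positivity
  have hi := hc.integrable_cutSq h₀ h₁ h₂
  have hM := hc.integral_sq_pos h₀ h₁ h₂
  refine ⟨D ^ 2 / ∫ s in ε₀..ε₁, φ s ^ 2, fun s _ t _ => ?_⟩
  have h3 := intervalIntegral.integral_interval_sub_left (a := ε₀) (b := s) (c := t)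
    (μ := volume) (f := cutSq φ ε₀ ε₁) hi.intervalIntegrable hi.intervalIntegrable
  rw [cutoff, cutoff, ← sub_div, h3, abs_div, abs_of_pos hM, div_mul_eq_mul_div]
  refine div_le_div_of_nonneg_right ?_ hM.le
  exact intervalIntegral.norm_integral_le_of_norm_le_const (f := cutSq φ ε₀ ε₁) fun r _ => hb r

lemma continuous_cutoff (hc : Comparison a C W φ y) (h₀ : 0 < ε₀) (h₁ : ε₀ < ε₁) (h₂ : ε₁ < a) :
    Continuous (cutoff φ ε₀ ε₁) := by
  refine continuous_iff_continuousAt.2 fun t => ?_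
  exact (hc.lipOn_cutoff h₀ h₁ h₂ (t - 1) (t + 1)).continuousOn.continuousAt
    (Icc_mem_nhds (by linarith) (by linarith))

lemma hasDerivAt_cutoff (hc : Comparison a C W φ y) (h₀ : 0 < ε₀) (h₁ : ε₀ < ε₁) (h₂ : ε₁ < a)
    {t : ℝ} (ht₀ : t ≠ ε₀) (ht₁ : t ≠ ε₁) :
    HasDerivAt (cutoff φ ε₀ ε₁)
      ((Set.Ioo ε₀ ε₁).indicator (fun s => φ s ^ 2) t / ∫ s in ε₀..ε₁, φ s ^ 2) t := by
  have hi := hc.integrable_cutSq h₀ h₁ h₂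
  refine HasDerivAt.div_const ?_ _
  have hval : (Set.Ioo ε₀ ε₁).indicator (fun s => φ s ^ 2) t = cutSq φ ε₀ ε₁ t := by
    by_cases hs : t ∈ Set.Ioo ε₀ ε₁
    · rw [Set.indicator_of_mem hs, cutSq, Set.indicator_of_mem (show t ∈ Set.Ioc ε₀ ε₁ from ⟨hs.1, hs.2.le⟩)]
    · rw [Set.indicator_of_notMem hs, cutSq, Set.indicator_of_notMem]
      exact fun h => hs ⟨h.1, lt_of_le_of_ne h.2 ht₁⟩
  have hcont : ContinuousAt (cutSq φ ε₀ ε₁) t := by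
    rcases lt_or_gt_of_ne ht₀ with h | h
    · have : cutSq φ ε₀ ε₁ =ᶠ[𝓝 t] fun _ => 0 := by
        filter_upwards [Iio_mem_nhds h] with s hs
        exact Set.indicator_of_notMem (fun h' => lt_asymm h'.1 hs) _
      exact continuousAt_const.congr this.symm
    rcases lt_or_gt_of_ne ht₁ with h' | h'
    · have : cutSq φ ε₀ ε₁ =ᶠ[𝓝 t] fun s => φ s ^ 2 := by
        filter_upwards [Ioo_mem_nhds h h'] with s hs
        exact Set.indicator_of_mem (show s ∈ Set.Ioc ε₀ ε₁ from ⟨hs.1, hs.2.le⟩) _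
      exact (((hc.hasDeriv t ⟨h₀.trans h, h'.trans h₂⟩).continuousAt).pow 2).congr this.symm
    · have : cutSq φ ε₀ ε₁ =ᶠ[𝓝 t] fun _ => 0 := by
        filter_upwards [Ioi_mem_nhds h'] with s hs
        exact Set.indicator_of_notMem (fun h' => absurd h'.2 (not_le.2 hs)) _
      exact continuousAt_const.congr this.symm
  rw [hval]
  exact intervalIntegral.integral_hasDerivAt_right hi.intervalIntegrable
    hi.1.stronglyMeasurableAtFilter hcont

/-- The whole half-line below a is allowed, including t ≤ 0 where nothing is known about φ, because
the cutoff vanishes up to ε₀. -/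
lemma continuousOn_integrand (hc : Comparison a C W φ y) (h₀ : 0 < ε₀) (h₁ : ε₀ < ε₁)
    (h₂ : ε₁ < a) : ContinuousOn (fun s => cutoff φ ε₀ ε₁ s * wgt C φ s) (Set.Iio a) := by
  intro t ht
  rcases lt_or_ge t ε₀ with h | h
  · have : (fun s => cutoff φ ε₀ ε₁ s * wgt C φ s) =ᶠ[𝓝 t] fun _ => 0 := by
      filter_upwards [Iio_mem_nhds h] with s hs
      rw [cutoff_of_le (le_of_lt hs), zero_mul]
    exact (continuousAt_const.congr this.symm).continuousWithinAt
  · exact ((hc.continuous_cutoff h₀ h₁ h₂).continuousAt.mul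
      (hc.hasDerivAt_wgt ⟨h₀.trans_le h, ht⟩).continuousAt).continuousWithinAt

lemma integrand_nonneg (hc : Comparison a C W φ y) (h₀ : 0 < ε₀) (h₁ : ε₀ < ε₁)
    (h₂ : ε₁ < a) {t : ℝ} (ht : t < a) : 0 ≤ cutoff φ ε₀ ε₁ t * wgt C φ t := by
  rcases le_total t ε₀ with h | h
  · rw [cutoff_of_le h, zero_mul]
  · exact mul_nonneg (hc.cutoff_nonneg h₀ h₁ h₂ t) (hc.wgt_pos ⟨h₀.trans_le h, ht⟩).le

lemma monotoneOn_integrand (hc : Comparison a C W φ y) (h₀ : 0 < ε₀) (h₁ : ε₀ < ε₁)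
    (h₂ : ε₁ < a) : MonotoneOn (fun s => cutoff φ ε₀ ε₁ s * wgt C φ s) (Set.Iio a) := by
  intro s hs t ht hst
  rcases le_total s ε₀ with h | h
  · simp only
    rw [cutoff_of_le h, zero_mul]
    exact hc.integrand_nonneg h₀ h₁ h₂ ht
  · have hs' : s ∈ Set.Ioo 0 a := ⟨h₀.trans_le h, hs⟩
    have ht' : t ∈ Set.Ioo 0 a := ⟨h₀.trans_le (h.trans hst), ht⟩
    exact mul_le_mul (hc.monotone_cutoff h₀ h₁ h₂ hst) (hc.monotoneOn_wgt hs' ht' hst)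
      (hc.wgt_pos hs').le (hc.cutoff_nonneg h₀ h₁ h₂ t)

lemma intervalIntegrable_integrand (hc : Comparison a C W φ y) (h₀ : 0 < ε₀) (h₁ : ε₀ < ε₁)
    (h₂ : ε₁ < a) {s t : ℝ} (hs : s < a) (ht : t < a) :
    IntervalIntegrable (fun s => cutoff φ ε₀ ε₁ s * wgt C φ s) volume s t := by
  refine ContinuousOn.intervalIntegrable ((hc.continuousOn_integrand h₀ h₁ h₂).mono ?_)
  exact Set.ordConnected_Iio.uIcc_subset hs ht

lemma hasDerivAt_cutPrim (hc : Comparison a C W φ y) (h₀ : 0 < ε₀) (h₁ : ε₀ < ε₁)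
    (h₂ : ε₁ < a) {t : ℝ} (ht : t < a) :
    HasDerivAt (cutPrim C φ ε₀ ε₁) (cutoff φ ε₀ ε₁ t * wgt C φ t) t := by
  refine intervalIntegral.integral_hasDerivAt_right
    (hc.intervalIntegrable_integrand h₀ h₁ h₂ (h₁.trans h₂) ht) ?_
    ((hc.continuousOn_integrand h₀ h₁ h₂).continuousAt (Iio_mem_nhds ht))
  exact (hc.continuousOn_integrand h₀ h₁ h₂).stronglyMeasurableAtFilter isOpen_Iio t ht

lemma cutPrim_of_le {t : ℝ} (ht : t ≤ ε₀) : cutPrim C φ ε₀ ε₁ t = 0 := by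
  rw [cutPrim, intervalIntegral.integral_of_ge ht]
  have h : ∀ s ∈ Set.Ioc t ε₀, cutoff φ ε₀ ε₁ s * wgt C φ s = 0 := fun s hs => by
    rw [cutoff_of_le hs.2, zero_mul]
  rw [setIntegral_congr_fun measurableSet_Ioc h]
  simp

lemma cutPrim_nonneg (hc : Comparison a C W φ y) (h₀ : 0 < ε₀) (h₁ : ε₀ < ε₁)
    (h₂ : ε₁ < a) {t : ℝ} (ht : t < a) : 0 ≤ cutPrim C φ ε₀ ε₁ t := by
  rcases le_total t ε₀ with h | h
  · rw [cutPrim_of_le h]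
  · exact intervalIntegral.integral_nonneg h fun s hs =>
      hc.integrand_nonneg h₀ h₁ h₂ (hs.2.trans_lt ht)

/-- The integrand is a product of nondecreasing nonnegative factors, so its integral is at most
length times final value. -/
lemma cutPrim_le (hc : Comparison a C W φ y) (h₀ : 0 < ε₀) (h₁ : ε₀ < ε₁)
    (h₂ : ε₁ < a) {t : ℝ} (ht₀ : ε₀ ≤ t) (ht : t < a) :
    cutPrim C φ ε₀ ε₁ t ≤ t * (cutoff φ ε₀ ε₁ t * wgt C φ t) := by
  have h3 : cutPrim C φ ε₀ ε₁ t ≤ ∫ _ in ε₀..t, cutoff φ ε₀ ε₁ t * wgt C φ t := by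
    refine intervalIntegral.integral_mono_on ht₀
      (hc.intervalIntegrable_integrand h₀ h₁ h₂ (h₁.trans h₂) ht) (by simp) fun s hs => ?_
    exact hc.monotoneOn_integrand h₀ h₁ h₂ (hs.2.trans_lt ht) ht hs.2
  rw [intervalIntegral.integral_const, smul_eq_mul] at h3
  have := hc.integrand_nonneg h₀ h₁ h₂ ht
  nlinarith

lemma hasDerivAt_cutSol (hc : Comparison a C W φ y) (h₀ : 0 < ε₀) (h₁ : ε₀ < ε₁)
    (h₂ : ε₁ < a) {t : ℝ} (ht : t < a) :
    HasDerivAt (cutSol C φ ε₀ ε₁) (cutSol' C φ y ε₀ ε₁ t) t := by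
  rcases lt_or_ge t ε₀ with h | h
  · have h3 : cutSol C φ ε₀ ε₁ =ᶠ[𝓝 t] fun _ => 0 := by
      filter_upwards [Iio_mem_nhds h] with s hs
      rw [cutSol, cutPrim_of_le (le_of_lt hs), mul_zero]
    rw [cutSol', cutPrim_of_le h.le, cutoff_of_le h.le, mul_zero, zero_mul, mul_zero, add_zero]
    exact (hasDerivAt_const t (0 : ℝ)).congr_of_eventuallyEq h3
  · exact (hc.hasDeriv t ⟨h₀.trans_le h, ht⟩).mul (hc.hasDerivAt_cutPrim h₀ h₁ h₂ ht)

lemma cutSol'_of_le {t : ℝ} (ht : t ≤ ε₀) : cutSol' C φ y ε₀ ε₁ t = 0 := by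
  rw [cutSol', cutPrim_of_le ht, cutoff_of_le ht, mul_zero, zero_mul, mul_zero, add_zero]

/-- With S the primitive and k its integrand, the derivative is φ(yS + k). Since 2ty ≥ -1 and S ≤
tk, the term yS is at least -k/2. -/
lemma cutSol'_nonneg (hc : Comparison a C W φ y) (h₀ : 0 < ε₀) (h₁ : ε₀ < ε₁)
    (h₂ : ε₁ < a) {t : ℝ} (ht : t < a) : 0 ≤ cutSol' C φ y ε₀ ε₁ t := by
  rcases le_total t ε₀ with h | h
  · rw [cutSol'_of_le h]
  · have ht0 : 0 < t := h₀.trans_le h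
    have hp := hc.pos t ⟨ht0, ht⟩
    have h3 := hc.cutPrim_le h₀ h₁ h₂ h ht
    have h4 := hc.lower t ⟨ht0, ht⟩
    have h5 := hc.integrand_nonneg h₀ h₁ h₂ ht
    have h6 := hc.cutPrim_nonneg h₀ h₁ h₂ ht
    set S := cutPrim C φ ε₀ ε₁ t
    set k := cutoff φ ε₀ ε₁ t * wgt C φ t
    have h7 : cutSol' C φ y ε₀ ε₁ t = φ t * (y t * S + k) := by
      rw [cutSol']; ring
    rw [h7]
    refine mul_nonneg hp.le ?_
    have h8 : 0 ≤ 2 * t * (y t * S + k) := by nlinarith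
    exact nonneg_of_mul_nonneg_right h8 (by positivity)

lemma monotoneOn_cutSol (hc : Comparison a C W φ y) (h₀ : 0 < ε₀) (h₁ : ε₀ < ε₁)
    (h₂ : ε₁ < a) : MonotoneOn (cutSol C φ ε₀ ε₁) (Set.Iio a) := by
  refine monotoneOn_of_hasDerivWithinAt_nonneg (f' := cutSol' C φ y ε₀ ε₁) (convex_Iio a)
    (fun t ht => (hc.hasDerivAt_cutSol h₀ h₁ h₂ ht).continuousAt.continuousWithinAt) ?_ ?_
  · intro t ht
    rw [interior_Iio] at ht ⊢
    exact (hc.hasDerivAt_cutSol h₀ h₁ h₂ ht).hasDerivWithinAt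
  · intro t ht
    rw [interior_Iio] at ht
    exact hc.cutSol'_nonneg h₀ h₁ h₂ ht

/-- On [ε₀, t₂] the derivative is a sum of products of Lipschitz functions; it vanishes up to and
including ε₀, so the bound extends to the left. -/
lemma exists_lipschitz_cutSol' (hc : Comparison a C W φ y) (h₀ : 0 < ε₀) (h₁ : ε₀ < ε₁)
    (h₂ : ε₁ < a) {t₂ : ℝ} (ht₂ : t₂ < a) :
    ∃ K, 0 ≤ K ∧ ∀ s ≤ t₂, ∀ t ≤ t₂,
      |cutSol' C φ y ε₀ ε₁ s - cutSol' C φ y ε₀ ε₁ t| ≤ K * |s - t| := by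
  have hα : 0 < ε₀ := h₀
  have hS : LipOn (cutPrim C φ ε₀ ε₁) ε₀ t₂ :=
    lipOn_of_hasDerivAt (fun t ht => hc.hasDerivAt_cutPrim h₀ h₁ h₂ (ht.2.trans_lt ht₂))
      ((hc.continuousOn_integrand h₀ h₁ h₂).mono fun t ht => ht.2.trans_lt ht₂)
  obtain ⟨K, hK⟩ := (((hc.lip ε₀ t₂ hα ht₂).mul (hc.lipOn_phi hα ht₂)).mul hS).add
    ((hc.lipOn_phi hα ht₂).mul ((hc.lipOn_cutoff h₀ h₁ h₂ ε₀ t₂).mul (hc.lipOn_wgt hα ht₂)))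
  have hK' : ∀ s ∈ Set.Icc ε₀ t₂, ∀ t ∈ Set.Icc ε₀ t₂,
      |cutSol' C φ y ε₀ ε₁ s - cutSol' C φ y ε₀ ε₁ t| ≤ |K| * |s - t| := fun s hs t ht =>
    (hK s hs t ht).trans (mul_le_mul_of_nonneg_right (le_abs_self K) (abs_nonneg _))
  have hK'' : ∀ s ≤ t₂, ∀ t ≤ t₂, s ≤ t →
      |cutSol' C φ y ε₀ ε₁ s - cutSol' C φ y ε₀ ε₁ t| ≤ |K| * |s - t| := by
    intro s hs t ht hst
    rcases le_total ε₀ s with h | h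
    · exact hK' s ⟨h, hs⟩ t ⟨h.trans hst, ht⟩
    · rcases le_total ε₀ t with h' | h'
      · rw [cutSol'_of_le h, ← cutSol'_of_le (C := C) (φ := φ) (y := y) (ε₁ := ε₁) (le_refl ε₀)]
        refine (hK' ε₀ ⟨le_rfl, h'.trans ht⟩ t ⟨h', ht⟩).trans
          (mul_le_mul_of_nonneg_left ?_ (abs_nonneg _))
        rw [abs_sub_comm, abs_sub_comm s, abs_of_nonneg (by linarith), abs_of_nonneg (by linarith)]
        linarith
      · rw [cutSol'_of_le h, cutSol'_of_le h', sub_self, abs_zero]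
        positivity
  refine ⟨|K|, abs_nonneg _, fun s hs t ht => ?_⟩
  rcases le_total s t with h | h
  · exact hK'' s hs t ht h
  · rw [abs_sub_comm, abs_sub_comm s]
    exact hK'' t ht s hs h

/-- For η = φS with S' = θw, the factor w = φ⁻²e^(-Ct) is chosen so that 2φ'θw + φθw' = -Cφθw, which
cancels against the same term in Cη'. What remains is φ''S + Cφ'S + φθ'w: the first term is at most
Wη by the Riccati inequality, the second is nonpositive since φ decreases, and the third is
φe^(-Ct)/M on (ε₀, ε₁). -/
lemma ae_hasDerivAt_cutSol' (hc : Comparison a C W φ y) (h₀ : 0 < ε₀) (h₁ : ε₀ < ε₁)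
    (h₂ : ε₁ < a) :
    ∀ᵐ t, t ∈ Set.Ioo 0 a → ∃ c, HasDerivAt (cutSol' C φ y ε₀ ε₁) c t ∧
      c + C * cutSol' C φ y ε₀ ε₁ t ≤ W t * cutSol C φ ε₀ ε₁ t
        + (Set.Ioo ε₀ ε₁).indicator φ t / ∫ s in ε₀..ε₁, φ s ^ 2 := by
  have hn : ∀ r : ℝ, ∀ᵐ t, t ≠ r := fun r => by simp [ae_iff, measure_singleton]
  filter_upwards [hc.riccati, hn ε₀, hn ε₁] with t hric ht₀ ht₁ ht
  obtain ⟨y', hy', hle⟩ := hric ht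
  have hp := hc.pos t ht
  have hM := hc.integral_sq_pos h₀ h₁ h₂
  have dφ := hc.hasDeriv t ht
  have dS := hc.hasDerivAt_cutPrim h₀ h₁ h₂ ht.2
  have dθ := hc.hasDerivAt_cutoff h₀ h₁ h₂ ht₀ ht₁
  have dw := hc.hasDerivAt_wgt ht
  have hS0 := hc.cutPrim_nonneg h₀ h₁ h₂ ht.2
  refine ⟨_, (((hy'.mul dφ).mul dS).add (dφ.mul (dθ.mul dw))), ?_⟩
  have hind : (Set.Ioo ε₀ ε₁).indicator (fun s => φ s ^ 2) t
      = φ t * (Set.Ioo ε₀ ε₁).indicator φ t := by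
    by_cases h : t ∈ Set.Ioo ε₀ ε₁
    · simp only [Set.indicator_of_mem h]; ring
    · simp only [Set.indicator_of_notMem h, mul_zero]
  have hind0 : 0 ≤ (Set.Ioo ε₀ ε₁).indicator φ t :=
    Set.indicator_nonneg (fun s hs => (hc.pos s ⟨h₀.trans hs.1, hs.2.trans h₂⟩).le) t
  have hw : φ t * (φ t * wgt C φ t) = Real.exp (-(C * t)) := by
    rw [wgt]
    field_simp
  have hexp : Real.exp (-(C * t)) ≤ 1 := by
    rw [Real.exp_le_one_iff]
    have := mul_nonneg hc.C_nonneg ht.1.le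
    linarith
  rw [cutSol', cutSol, hind]
  set S := cutPrim C φ ε₀ ε₁ t
  set θ := cutoff φ ε₀ ε₁ t
  set I := (Set.Ioo ε₀ ε₁).indicator φ t
  set M := ∫ s in ε₀..ε₁, φ s ^ 2
  set w := wgt C φ t
  simp only [Pi.mul_apply]
  have e1 : φ t * (φ t * I / M * w) = Real.exp (-(C * t)) * (I / M) := by
    rw [← hw]; ring
  have e2 : Real.exp (-(C * t)) * (I / M) ≤ I / M :=
    mul_le_of_le_one_left (div_nonneg hind0 hM.le) hexp
  have e3 : (y' + y t ^ 2 + C * y t) * (φ t * S) ≤ W t * (φ t * S) := by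
    refine mul_le_mul_of_nonneg_right ?_ (mul_nonneg hp.le hS0)
    have h5 := hc.upper t ht
    have h6 : C * y t ≤ 0 := by nlinarith [hc.C_nonneg]
    linarith
  linarith [e1, e2, e3]

end Comparison

end Profile

/-! ### Truncated profiles and their upper jets -/

section TruncatedProfile

/-- `H` is a bounded nondecreasing function with second order upper jets `(q, b)`. -/
structure IsProfile (H q b : ℝ → ℝ) (Λ h₀ : ℝ) : Prop where
  mono : Monotone H
  cont : Continuous H
  nonneg : ∀ t, 0 ≤ H t
  meas_q : Measurable q
  meas_b : Measurable b
  q_nonneg : ∀ t, 0 ≤ q t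
  q_le : ∀ t, q t ≤ Λ
  b_le : ∀ t, |b t| ≤ Λ
  h₀_pos : 0 < h₀
  jet : ∀ t s, |s - t| ≤ h₀ → H s ≤ H t + q t * (s - t) + Λ * (s - t) ^ 2
  ae_jet : ∀ᵐ t, ∀ ε > 0, ∀ᶠ s in 𝓝 t, H s ≤ H t + q t * (s - t) + (b t / 2 + ε) * (s - t) ^ 2

variable {a C ε₀ ε₁ : ℝ} {W φ y : ℝ → ℝ}

/-- Truncation of the cut off second solution at height `κ` and at `t₁`. -/
def truncSol (C : ℝ) (φ : ℝ → ℝ) (ε₀ ε₁ t₁ κ t : ℝ) : ℝ :=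
  min (cutSol C φ ε₀ ε₁ (min t t₁)) κ

namespace Comparison

lemma truncSol_le (hc : Comparison a C W φ y) (h₀ : 0 < ε₀) (h₁ : ε₀ < ε₁) (h₂ : ε₁ < a)
    {t₁ κ t : ℝ} (ht : t < a) :
    truncSol C φ ε₀ ε₁ t₁ κ t ≤ cutSol C φ ε₀ ε₁ t :=
  (min_le_left _ _).trans (hc.monotoneOn_cutSol h₀ h₁ h₂ (show min t t₁ < a from
    (min_le_left _ _).trans_lt ht) ht (min_le_left _ _))

/-- Since κ is at most the value at t₁, freezing the argument at t₁ has no effect below height κ. -/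
lemma truncSol_of_lt {t₁ κ t : ℝ} (hκ : κ ≤ cutSol C φ ε₀ ε₁ t₁)
    (ht : truncSol C φ ε₀ ε₁ t₁ κ t < κ) :
    t < t₁ ∧ truncSol C φ ε₀ ε₁ t₁ κ t = cutSol C φ ε₀ ε₁ t := by
  have h1 : t < t₁ := by
    by_contra! h
    rw [truncSol, min_eq_right h, min_eq_right hκ] at ht
    exact lt_irrefl _ ht
  refine ⟨h1, ?_⟩
  rw [truncSol, min_eq_left h1.le] at ht ⊢
  rcases min_lt_iff.1 ht with h | h
  · exact min_eq_left h.le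
  · exact absurd h (lt_irrefl _)

/-- Taking a minimum produces only concave corners, which are harmless for upper bounds. At height κ
the zero jet works because H never exceeds κ; below κ the Taylor polynomial of the untruncated
solution works, because that solution lies above H and touches it there. -/
lemma isProfile_truncSol (hc : Comparison a C W φ y) (h₀ : 0 < ε₀) (h₁ : ε₀ < ε₁) (h₂ : ε₁ < a)
    {t₁ κ : ℝ} (hκ0 : 0 ≤ κ) (ht₁ : t₁ < a) (hκ : κ ≤ cutSol C φ ε₀ ε₁ t₁) :
    ∃ Λ h, IsProfile (truncSol C φ ε₀ ε₁ t₁ κ)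
      (fun t => if truncSol C φ ε₀ ε₁ t₁ κ t < κ then deriv (cutSol C φ ε₀ ε₁) t else 0)
      (fun t => if truncSol C φ ε₀ ε₁ t₁ κ t < κ then
        deriv (deriv (cutSol C φ ε₀ ε₁)) t else 0) Λ h := by
  -- The gap between t₁ and t₂ is the admissible step: from t < t₁ it stays where the derivative is
  -- Lipschitz, away from a.
  set t₂ := (t₁ + a) / 2 with ht₂
  have h12 : t₁ < t₂ := by rw [ht₂]; linarith
  have h2a : t₂ < a := by rw [ht₂]; linarith
  set η := cutSol C φ ε₀ ε₁ with hη
  set η' := cutSol' C φ y ε₀ ε₁ with hη'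
  set H := truncSol C φ ε₀ ε₁ t₁ κ with hH
  have hder : ∀ t < a, HasDerivAt η (η' t) t := fun t ht => hc.hasDerivAt_cutSol h₀ h₁ h₂ ht
  have hdereq : ∀ t < a, deriv η t = η' t := fun t ht => (hder t ht).deriv
  have hmono : Monotone H := fun s t hst => by
    refine min_le_min_right _ (hc.monotoneOn_cutSol h₀ h₁ h₂ ?_ ?_ (min_le_min_right _ hst))
    · exact (min_le_right _ _).trans_lt ht₁
    · exact (min_le_right _ _).trans_lt ht₁
  have hcont : Continuous H := by
    have h3 : Continuous fun t => η (min t t₁) := by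
      refine continuous_iff_continuousAt.2 fun t => ?_
      have h4 : ContinuousAt η (min t t₁) :=
        (hder _ ((min_le_right _ _).trans_lt ht₁)).continuousAt
      exact ContinuousAt.comp (f := fun t => min t t₁) h4 (by fun_prop)
    exact h3.min continuous_const
  obtain ⟨K, hK0, hK⟩ := hc.exists_lipschitz_cutSol' h₀ h₁ h₂ h2a
  have hη'b : ∃ D, ∀ t ≤ t₂, η' t ≤ D := by
    refine ⟨K * |t₂ - ε₀|, fun t ht => ?_⟩
    rcases le_total t ε₀ with h | h
    · rw [hη', cutSol'_of_le h]; positivity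
    · have h3 := hK t ht ε₀ (h.trans ht)
      rw [cutSol'_of_le le_rfl, sub_zero] at h3
      refine (le_abs_self _).trans (h3.trans (mul_le_mul_of_nonneg_left ?_ hK0))
      rw [abs_of_nonneg (by linarith), abs_of_nonneg (by linarith)]
      linarith
  obtain ⟨D, hD⟩ := hη'b
  have hderd : ∀ t < t₂, deriv η =ᶠ[𝓝 t] η' := fun t ht => by
    filter_upwards [Iio_mem_nhds ht] with s hs using hdereq s (lt_trans hs h2a)
  have hΛ0 : 0 ≤ max D K := hK0.trans (le_max_right _ _)
  refine ⟨max D K, t₂ - t₁, ?_⟩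
  refine
    { mono := hmono
      cont := hcont
      nonneg := fun t => ?_
      meas_q := ?_
      meas_b := ?_
      q_nonneg := fun t => ?_
      q_le := fun t => ?_
      b_le := fun t => ?_
      h₀_pos := by linarith
      jet := fun t s hs => ?_
      ae_jet := ?_ }
  · have hta : min t t₁ < a := (min_le_right _ _).trans_lt ht₁
    refine le_min ?_ hκ0
    rcases le_total (min t t₁) ε₀ with h | h
    · rw [cutSol, cutPrim_of_le h, mul_zero]
    · exact mul_nonneg (hc.pos _ ⟨h₀.trans_le h, hta⟩).le (hc.cutPrim_nonneg h₀ h₁ h₂ hta)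
  · exact Measurable.ite (hcont.measurable measurableSet_Iio) (measurable_deriv _) measurable_const
  · exact Measurable.ite (hcont.measurable measurableSet_Iio) (measurable_deriv _) measurable_const
  · split_ifs with h
    · have h3 := (truncSol_of_lt hκ h).1.trans ht₁
      rw [hdereq t h3]
      exact hc.cutSol'_nonneg h₀ h₁ h₂ h3
    · exact le_rfl
  · split_ifs with h
    · have h3 := (truncSol_of_lt hκ h).1
      rw [hdereq t (h3.trans ht₁)]
      exact (hD t (h3.trans h12).le).trans (le_max_left _ _)
    · exact hΛ0
  · split_ifs with h
    · have h3 := (truncSol_of_lt hκ h).1.trans h12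
      rw [(hderd t h3).deriv_eq]
      have hlip : LipschitzOnWith K.toNNReal η' (Set.Iio t₂) := by
        refine LipschitzOnWith.of_dist_le_mul fun s hs r hr => ?_
        rw [Real.coe_toNNReal _ hK0]
        exact hK s (le_of_lt hs) r (le_of_lt hr)
      refine (norm_deriv_le_of_lipschitzOn (Iio_mem_nhds h3) hlip).trans ?_
      rw [Real.coe_toNNReal _ hK0]
      exact le_max_right _ _
    · simpa using hΛ0
  · split_ifs with h
    · obtain ⟨h3, h4⟩ : t < t₁ ∧ H t = η t := truncSol_of_lt hκ h
      have hs2 : s ≤ t₂ := by linarith [(abs_le.1 hs).2]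
      rw [h4, hdereq t (h3.trans ht₁)]
      refine (hc.truncSol_le h₀ h₁ h₂ (hs2.trans_lt h2a)).trans ?_
      have hle : ∀ r ∈ Set.uIcc t s, r ≤ t₂ := fun r hr =>
        hr.2.trans (sup_le (h3.trans h12).le hs2)
      have h5 := taylor_le_of_lipschitz_deriv (h := η) (h' := η') (K := K) (s := s) (t := t)
        (fun r hr => hder r ((hle r hr).trans_lt h2a))
        (fun r hr => (hK r (hle r hr) t (h3.trans h12).le).trans
          (mul_le_mul_of_nonneg_left (Set.abs_sub_left_of_mem_uIcc hr) hK0))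
      rw [sq_abs] at h5
      have h6 := (abs_le.1 h5).2
      have h7 : K * (s - t) ^ 2 ≤ max D K * (s - t) ^ 2 :=
        mul_le_mul_of_nonneg_right (le_max_right _ _) (sq_nonneg _)
      linarith
    · have h3 : H t = κ := le_antisymm (min_le_right _ _) (not_lt.1 h)
      have h4 : H s ≤ κ := min_le_right _ _
      have h5 : 0 ≤ max D K * (s - t) ^ 2 := mul_nonneg hΛ0 (sq_nonneg _)
      linarith
  · have hn : ∀ᵐ t : ℝ, t ≠ ε₀ := by simp [ae_iff, measure_singleton]
    filter_upwards [hc.ae_hasDerivAt_cutSol' h₀ h₁ h₂, hn] with t ht ht0 ε hε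
    split_ifs with h
    · obtain ⟨h3, h4⟩ : t < t₁ ∧ H t = η t := truncSol_of_lt hκ h
      have h5 : ∃ c, HasDerivAt η' c t := by
        rcases lt_or_gt_of_ne ht0 with h | h
        · refine ⟨0, (hasDerivAt_const t (0 : ℝ)).congr_of_eventuallyEq ?_⟩
          filter_upwards [Iio_mem_nhds h] with s hs using cutSol'_of_le (le_of_lt hs)
        · obtain ⟨c, hc', -⟩ := ht ⟨h₀.trans h, h3.trans ht₁⟩
          exact ⟨c, hc'⟩
      obtain ⟨c, hc'⟩ := h5
      rw [(hderd t (h3.trans h12)).deriv_eq, hc'.deriv, h4, hdereq t (h3.trans ht₁)]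
      have h6 : ∀ᶠ r in 𝓝 t, HasDerivAt η (η' r) r := by
        filter_upwards [Iio_mem_nhds (h3.trans ht₁)] with r hr using hder r hr
      filter_upwards [eventually_taylor_le h6 hc' hε, Iio_mem_nhds (h3.trans ht₁)] with s hs hsa
      exact (hc.truncSol_le h₀ h₁ h₂ hsa).trans hs
    · refine Eventually.of_forall fun s => ?_
      have h3 : H t = κ := le_antisymm (min_le_right _ _) (not_lt.1 h)
      have h4 : H s ≤ κ := min_le_right _ _
      have h5 : 0 ≤ (0 / 2 + ε) * (s - t) ^ 2 := by positivity
      linarith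

/-- Existence of cut off profiles, bounded below independently of the cutoff. -/
theorem exists_profile (hc : Comparison a C W φ y) (hε₁ : 0 < ε₁) (h₂ : ε₁ < a) :
    ∃ ζ : ℝ → ℝ, (∀ t, ε₁ < t → 0 < ζ t) ∧ ∀ ε₀, 0 < ε₀ → ε₀ < ε₁ →
      ∃ (H q b : ℝ → ℝ) (Λ h : ℝ), IsProfile H q b Λ h ∧ (∀ t ≤ ε₀, H t = 0) ∧
        (∀ t, ε₁ < t → ζ t ≤ H t) ∧ (∀ t, a ≤ t → q t = 0 ∧ b t = 0 ∧ ∀ s, H s ≤ H t) ∧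
        ∀ᵐ t, b t + C * q t ≤ 0 ∨ t ∈ Set.Ioo 0 a ∧ b t + C * q t ≤ W t * H t
          + (Set.Ioo ε₀ ε₁).indicator φ t / ∫ s in ε₀..ε₁, φ s ^ 2 := by
  set t₁ := (ε₁ + a) / 2 with ht₁
  have h1t : ε₁ < t₁ := by rw [ht₁]; linarith
  have hta : t₁ < a := by rw [ht₁]; linarith
  set S₁ : ℝ → ℝ := fun t => ∫ s in ε₁..t, wgt C φ s with hS₁
  have hwint : ∀ t, ε₁ < t → t < a → IntervalIntegrable (wgt C φ) volume ε₁ t := fun t h3 h4 =>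
    ContinuousOn.intervalIntegrable (hc.continuousOn_wgt.mono
      (Set.ordConnected_Ioo.uIcc_subset ⟨hε₁, h₂⟩ ⟨hε₁.trans h3, h4⟩))
  have hS₁pos : ∀ t, ε₁ < t → t < a → 0 < S₁ t := fun t h3 h4 =>
    intervalIntegral.intervalIntegral_pos_of_pos_on (hwint t h3 h4)
      (fun s hs => hc.wgt_pos ⟨hε₁.trans hs.1, hs.2.trans h4⟩) h3
  have hmem : ∀ t, ε₁ < t → ε₁ < min t t₁ ∧ min t t₁ < a := fun t ht =>
    ⟨lt_min ht h1t, (min_le_right _ _).trans_lt hta⟩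
  have hφpos : ∀ t, ε₁ < t → t < a → 0 < φ t := fun t h3 h4 => hc.pos t ⟨hε₁.trans h3, h4⟩
  set κ := φ t₁ * S₁ t₁ with hκ
  have hκpos : 0 < κ := mul_pos (hφpos t₁ h1t hta) (hS₁pos t₁ h1t hta)
  -- Beyond ε₁ the cutoff is at least 1, so the solution dominates φ times the uncut primitive
  -- started at ε₁. Neither this bound nor κ depends on ε₀.
  refine ⟨fun t => min (φ (min t t₁) * S₁ (min t t₁)) κ, fun t ht => ?_, fun ε₀ h₀ h₁ => ?_⟩
  · obtain ⟨h3, h4⟩ := hmem t ht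
    exact lt_min (mul_pos (hφpos _ h3 h4) (hS₁pos _ h3 h4)) hκpos
  have hlow : ∀ t, ε₁ < t → t < a → φ t * S₁ t ≤ cutSol C φ ε₀ ε₁ t := by
    intro t h3 h4
    refine mul_le_mul_of_nonneg_left ?_ (hφpos t h3 h4).le
    have h5 := intervalIntegral.integral_add_adjacent_intervals
      (hc.intervalIntegrable_integrand h₀ h₁ h₂ (h₁.trans h₂) h₂)
      (hc.intervalIntegrable_integrand h₀ h₁ h₂ h₂ h4)
    have h6 := hc.cutPrim_nonneg h₀ h₁ h₂ h₂
    have h7 : S₁ t ≤ ∫ s in ε₁..t, cutoff φ ε₀ ε₁ s * wgt C φ s := by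
      refine intervalIntegral.integral_mono_on h3.le (hwint t h3 h4)
        (hc.intervalIntegrable_integrand h₀ h₁ h₂ h₂ h4) fun s hs => ?_
      exact le_mul_of_one_le_left (hc.wgt_pos ⟨hε₁.trans_le hs.1, hs.2.trans_lt h4⟩).le
        (hc.one_le_cutoff h₀ h₁ h₂ hs.1)
    rw [cutPrim] at h6 ⊢
    linarith
  have hκle : κ ≤ cutSol C φ ε₀ ε₁ t₁ := hlow t₁ h1t hta
  obtain ⟨Λ, h, hprof⟩ := hc.isProfile_truncSol h₀ h₁ h₂ hκpos.le hta hκle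
  refine ⟨_, _, _, Λ, h, hprof, fun t ht => ?_, fun t ht => ?_, fun t ht => ?_, ?_⟩
  · rw [truncSol, cutSol, cutPrim_of_le ((min_le_left _ _).trans ht), mul_zero,
      min_eq_left hκpos.le]
  · obtain ⟨h3, h4⟩ := hmem t ht
    exact min_le_min_right _ (hlow _ h3 h4)
  · have h3 : truncSol C φ ε₀ ε₁ t₁ κ t = κ := by
      rw [truncSol, min_eq_right (hta.le.trans ht), min_eq_right hκle]
    exact ⟨if_neg h3.not_lt, if_neg h3.not_lt, fun s => (min_le_right _ _).trans h3.ge⟩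
  · have hn : ∀ᵐ t : ℝ, t ≠ ε₀ := by simp [ae_iff, measure_singleton]
    filter_upwards [hc.ae_hasDerivAt_cutSol' h₀ h₁ h₂, hn] with t ht ht0
    split_ifs with h
    · obtain ⟨h3, h4⟩ := truncSol_of_lt hκle h
      have hev : deriv (cutSol C φ ε₀ ε₁) =ᶠ[𝓝 t] cutSol' C φ y ε₀ ε₁ := by
        filter_upwards [Iio_mem_nhds (h3.trans hta)] with s hs
          using (hc.hasDerivAt_cutSol h₀ h₁ h₂ hs).deriv
      rw [hev.deriv_eq, hev.self_of_nhds, h4]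
      rcases lt_or_gt_of_ne ht0 with h | h
      · left
        have h5 : cutSol' C φ y ε₀ ε₁ =ᶠ[𝓝 t] fun _ => 0 := by
          filter_upwards [Iio_mem_nhds h] with s hs using cutSol'_of_le (le_of_lt hs)
        rw [h5.deriv_eq, cutSol'_of_le h.le]
        simp
      · right
        have htm : t ∈ Set.Ioo 0 a := ⟨h₀.trans h, h3.trans hta⟩
        obtain ⟨c, hc', hle⟩ := ht htm
        rw [hc'.deriv]
        exact ⟨htm, hle⟩
    · left
      simp

end Comparison

end TruncatedProfile

/-! ### The correction to the logarithmic derivative -/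

section TailIntegral

/-- `√t ∫_t^a F(s) s^{-3/2} ds`, a solution of `g' = g / (2t) - F / t`. -/
def tail (F : ℝ → ℝ) (a t : ℝ) : ℝ := √t * ∫ s in t..a, F s * (s * √s)⁻¹

variable {F : ℝ → ℝ} {a : ℝ}

lemma intervalIntegrable_tail (hF : IntegrableOn F (Set.Ioo 0 a)) {t s : ℝ} (ht : 0 < t)
    (hta : t ≤ a) (hs : 0 < s) (hsa : s ≤ a) :
    IntervalIntegrable (fun s => F s * (s * √s)⁻¹) volume t s := by
  have h1 : IntervalIntegrable F volume 0 a := by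
    rw [intervalIntegrable_iff_integrableOn_Ioo_of_le (ht.le.trans hta)]
    exact hF
  have h2 : IntervalIntegrable F volume t s := h1.mono_set
    (Set.uIcc_subset_uIcc (by rw [Set.uIcc_of_le (ht.le.trans hta)]; exact ⟨ht.le, hta⟩)
      (by rw [Set.uIcc_of_le (ht.le.trans hta)]; exact ⟨hs.le, hsa⟩))
  refine h2.mul_continuousOn fun r hr => ?_
  have hr0 : 0 < r := (lt_min ht hs).trans_le hr.1
  have : r * √r ≠ 0 := by positivity
  exact ContinuousAt.continuousWithinAt (by fun_prop (disch := assumption))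

lemma tail_nonneg (hF0 : ∀ t ∈ Set.Ioo 0 a, 0 ≤ F t) {t : ℝ} (ht : t ∈ Set.Ioo 0 a) :
    0 ≤ tail F a t := by
  refine mul_nonneg (Real.sqrt_nonneg _) ?_
  rw [intervalIntegral.integral_of_le ht.2.le, integral_Ioc_eq_integral_Ioo]
  refine setIntegral_nonneg measurableSet_Ioo fun s hs => ?_
  have hs0 := ht.1.trans hs.1
  exact mul_nonneg (hF0 s ⟨hs0, hs.2⟩) (by positivity)

/-- For s ≥ t one has F(s)s^(-3/2) ≤ B t^(-1/2) s⁻², and the integral of s⁻² from t is at most 1/t.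
-/
lemma mul_tail_le (hF : IntegrableOn F (Set.Ioo 0 a)) {B : ℝ} (hB : 0 ≤ B)
    (hFB : ∀ t ∈ Set.Ioo 0 a, t * F t ≤ B) {t : ℝ} (ht : t ∈ Set.Ioo 0 a) :
    t * tail F a t ≤ B := by
  have hst : 0 < √t := Real.sqrt_pos.2 ht.1
  have ha : 0 < a := ht.1.trans ht.2
  have hd : ∀ s ∈ Set.uIcc t a, HasDerivAt (fun s => -(B / √t) * s⁻¹) (B / √t * (s ^ 2)⁻¹) s := by
    intro s hs
    rw [Set.uIcc_of_le ht.2.le] at hs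
    exact ((hasDerivAt_inv (ht.1.trans_le hs.1).ne').const_mul (-(B / √t))).congr_deriv (by ring)
  have hci : IntervalIntegrable (fun s => B / √t * (s ^ 2)⁻¹) volume t a := by
    refine ContinuousOn.intervalIntegrable fun s hs => ?_
    rw [Set.uIcc_of_le ht.2.le] at hs
    have : s ^ 2 ≠ 0 := pow_ne_zero 2 (ht.1.trans_le hs.1).ne'
    exact ContinuousAt.continuousWithinAt (by fun_prop (disch := assumption))
  have h1 : ∫ s in t..a, F s * (s * √s)⁻¹ ≤ ∫ s in t..a, B / √t * (s ^ 2)⁻¹ := by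
    refine intervalIntegral.integral_mono_on_of_le_Ioo ht.2.le
      (intervalIntegrable_tail hF ht.1 ht.2.le ha le_rfl) hci fun s hs => ?_
    have hs0 : 0 < s := ht.1.trans hs.1
    have h2 : √t ≤ √s := Real.sqrt_le_sqrt hs.1.le
    have h3 := hFB s ⟨hs0, hs.2⟩
    calc F s * (s * √s)⁻¹ = (s * F s) * (s ^ 2)⁻¹ * (√s)⁻¹ := by field_simp
      _ ≤ B * (s ^ 2)⁻¹ * (√t)⁻¹ := by gcongr
      _ = _ := by ring
  rw [intervalIntegral.integral_eq_sub_of_hasDerivAt hd hci] at h1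
  have h4 : -(B / √t) * a⁻¹ - -(B / √t) * t⁻¹ ≤ B / √t * t⁻¹ := by
    have : 0 ≤ B / √t * a⁻¹ := by positivity
    linarith
  calc t * tail F a t ≤ t * (√t * (B / √t * t⁻¹)) := by
        unfold tail
        have h5 := h1.trans h4
        have := ht.1
        gcongr
    _ = B := by
        have := ht.1
        field_simp

lemma lipOn_tail (hF : IntegrableOn F (Set.Ioo 0 a)) (hF0 : ∀ t ∈ Set.Ioo 0 a, 0 ≤ F t) {B : ℝ}
    (hB : 0 ≤ B) (hFB : ∀ t ∈ Set.Ioo 0 a, t * F t ≤ B) {α β : ℝ} (hα : 0 < α) (hβ : β < a) :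
    LipOn (tail F a) α β := by
  have hsub : Set.Icc α β ⊆ Set.Ioo 0 a := fun t ht => ⟨hα.trans_le ht.1, ht.2.trans_lt hβ⟩
  refine LipOn.mul (h := fun t => √t) (lipOn_of_hasDerivAt
    (fun t ht => Real.hasDerivAt_sqrt (hsub ht).1.ne') fun t ht => ?_) ?_
  · have : 2 * √t ≠ 0 := by have := Real.sqrt_pos.2 (hsub ht).1; positivity
    exact ContinuousAt.continuousWithinAt (by fun_prop (disch := assumption))
  · refine ⟨B * (α ^ 2)⁻¹ * (√α)⁻¹, fun s hs t ht => ?_⟩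
    have ha : 0 < a := (hsub hs).1.trans (hsub hs).2
    have h1 := intervalIntegral.integral_add_adjacent_intervals
      (intervalIntegrable_tail hF (hsub hs).1 (hsub hs).2.le
        (hsub ht).1 (hsub ht).2.le)
      (intervalIntegrable_tail hF (hsub ht).1 (hsub ht).2.le ha le_rfl)
    beta_reduce
    rw [← h1, add_sub_cancel_right, abs_sub_comm s t, ← Real.norm_eq_abs]
    refine intervalIntegral.norm_integral_le_of_norm_le_const fun r hr => ?_
    have hrm : r ∈ Set.Icc α β := Set.ordConnected_Icc.uIcc_subset hs ht (Set.uIoc_subset_uIcc hr)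
    have hr0 := (hsub hrm).1
    have hr1 := hF0 r (hsub hrm)
    have h2 : √α ≤ √r := Real.sqrt_le_sqrt hrm.1
    have h3 := hFB r (hsub hrm)
    have h4 := hrm.1
    have h5 := Real.sqrt_pos.2 hα
    rw [Real.norm_of_nonneg (by positivity)]
    calc F r * (r * √r)⁻¹ = (r * F r) * (r ^ 2)⁻¹ * (√r)⁻¹ := by field_simp
      _ ≤ B * (α ^ 2)⁻¹ * (√α)⁻¹ := by gcongr

/-- F is merely integrable, so Lebesgue differentiation is used, on the countably many intervals
[a/(k+2), a] that exhaust (0, a]. -/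
lemma ae_hasDerivAt_tail (hF : IntegrableOn F (Set.Ioo 0 a)) :
    ∀ᵐ t, t ∈ Set.Ioo 0 a → HasDerivAt (tail F a) (tail F a t / (2 * t) - F t / t) t := by
  rcases le_or_gt a 0 with ha | ha
  · refine Eventually.of_forall fun t ht => ?_
    exact absurd (ht.1.trans ht.2) (not_lt.2 ha)
  have h1 : ∀ᵐ t, ∀ k : ℕ, t ∈ Set.Icc (a / (k + 2)) a →
      HasDerivAt (fun t => ∫ s in a..t, F s * (s * √s)⁻¹) (F t * (t * √t)⁻¹) t := by
    refine ae_all_iff.2 fun k => ?_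
    have hk : 0 < a / (k + 2 : ℝ) := by positivity
    have hka : a / (k + 2 : ℝ) ≤ a := div_le_self ha.le (by linarith [(k.cast_nonneg : (0:ℝ) ≤ k)])
    have := (intervalIntegrable_tail hF hk hka ha le_rfl).ae_hasDerivAt_integral
    rw [Set.uIcc_of_le hka] at this
    filter_upwards [this] with t ht htm
    exact ht htm a ⟨hka, le_rfl⟩
  filter_upwards [h1] with t ht htm
  have ht0 := htm.1
  obtain ⟨k, hk⟩ := exists_nat_gt (a / t)
  have hkt : a / (k + 2) ≤ t := by
    rw [div_lt_iff₀ htm.1] at hk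
    rw [div_le_iff₀ (by positivity)]
    nlinarith [htm.1]
  have h2 := ht k ⟨hkt, htm.2.le⟩
  have h3 : tail F a = fun t => √t * -∫ s in a..t, F s * (s * √s)⁻¹ := by
    funext r
    rw [tail, intervalIntegral.integral_symm]
  have hst : 0 < √t := Real.sqrt_pos.2 htm.1
  rw [h3]
  refine ((Real.hasDerivAt_sqrt htm.1.ne').mul h2.neg).congr_deriv ?_
  have hsq : √t * √t = t := Real.mul_self_sqrt htm.1.le
  rw [show (2 : ℝ) * t = 2 * (√t * √t) by rw [hsq]]
  field_simp
  simp only [Pi.neg_apply]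
  ring

/-- Integrating (s·g)' = (3/2)g - F for g = `tail F a`, with 0 ≤ s·g ≤ B at the endpoints, bounds ∫g
uniformly down to 0. The identity holds only almost everywhere; absolute continuity, from the
Lipschitz bound, justifies integrating it. -/
lemma integral_tail_le (hF : IntegrableOn F (Set.Ioo 0 a)) (hF0 : ∀ t ∈ Set.Ioo 0 a, 0 ≤ F t)
    {B : ℝ} (hB : 0 ≤ B) (hFB : ∀ t ∈ Set.Ioo 0 a, t * F t ≤ B) {t b : ℝ} (ht : 0 < t)
    (htb : t ≤ b) (hba : b < a) :
    ∫ s in t..b, tail F a s ≤ B + ∫ s in Set.Ioo 0 a, F s := by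
  have hsub : Set.Icc t b ⊆ Set.Ioo 0 a := fun r hr => ⟨ht.trans_le hr.1, hr.2.trans_lt hba⟩
  have hlt := lipOn_tail hF hF0 hB hFB ht hba
  have hl : LipOn (fun s => s * tail F a s) t b :=
    LipOn.mul (h := fun s => s) ⟨1, fun s _ t _ => by rw [one_mul]⟩ hlt
  have hac : AbsolutelyContinuousOnInterval (fun s => s * tail F a s) t b := by
    obtain ⟨K, hK⟩ := hl
    refine LipschitzOnWith.absolutelyContinuousOnInterval (K := K.toNNReal) ?_
    rw [Set.uIcc_of_le htb]
    refine LipschitzOnWith.of_dist_le_mul fun s hs r hr => ?_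
    rw [Real.dist_eq, Real.dist_eq]
    exact (hK s hs r hr).trans
      (mul_le_mul_of_nonneg_right (Real.le_coe_toNNReal K) (abs_nonneg _))
  have h1 := hac.integral_deriv_eq_sub
  have hti : IntervalIntegrable (tail F a) volume t b := by
    refine ContinuousOn.intervalIntegrable ?_
    rw [Set.uIcc_of_le htb]
    exact hlt.continuousOn
  have hFi : IntervalIntegrable F volume t b := by
    rw [intervalIntegrable_iff_integrableOn_Ioo_of_le htb]
    exact hF.mono_set (Set.Ioo_subset_Icc_self.trans hsub)
  have h2 : ∫ s in t..b, deriv (fun s => s * tail F a s) s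
      = ∫ s in t..b, ((3 / 2) * tail F a s - F s) := by
    refine intervalIntegral.integral_congr_ae ?_
    filter_upwards [ae_hasDerivAt_tail hF] with s hs hsm
    rw [Set.uIoc_of_le htb] at hsm
    have hsm' := hsub ⟨hsm.1.le, hsm.2⟩
    have hs0 := hsm'.1
    refine HasDerivAt.deriv (((hasDerivAt_id' s).mul (hs hsm')).congr_deriv ?_)
    field_simp
    ring
  rw [h2, intervalIntegral.integral_sub (hti.const_mul _) hFi,
    intervalIntegral.integral_const_mul] at h1
  have h3 := mul_tail_le hF hB hFB (hsub ⟨htb, le_rfl⟩)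
  have h4 : 0 ≤ t * tail F a t :=
    mul_nonneg ht.le (tail_nonneg hF0 (hsub ⟨le_rfl, htb⟩))
  have h5 : ∫ s in t..b, F s ≤ ∫ s in Set.Ioo 0 a, F s := by
    rw [intervalIntegral.integral_of_le htb]
    exact setIntegral_mono_set hF ((ae_restrict_mem measurableSet_Ioo).mono fun s hs => hF0 s hs)
      (LE.le.eventuallyLE (Set.Ioc_subset_Icc_self.trans hsub))
  have h6 : 0 ≤ ∫ s in t..b, tail F a s := intervalIntegral.integral_nonneg htb fun s hs =>
    tail_nonneg hF0 (hsub hs)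
  linarith

end TailIntegral

/-! ### Construction of the comparison function -/

section ConstructComparison

lemma lipOn_of_deriv_le {h h' : ℝ → ℝ} {α β K : ℝ} (hd : ∀ t ∈ Set.Icc α β, HasDerivAt h (h' t) t)
    (hK : ∀ t ∈ Set.Icc α β, |h' t| ≤ K) : LipOn h α β :=
  ⟨K, fun _ hs _ ht => (convex_Icc α β).norm_image_sub_le_of_norm_hasDerivWithin_le
    (fun x hx => (hd x hx).hasDerivWithinAt) hK ht hs⟩

/-- A comparison function for the potential `3/4 t⁻² - σ t⁻² - f t⁻¹`, where `P` is a positive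
solution of `P' = -σ P / t`. -/
theorem exists_comparison {a C : ℝ} {P σ σ' f : ℝ → ℝ} (ha : 0 < a) (hC : 0 ≤ C)
    (hCa : C * a ≤ 1 / 8) (hP : ∀ t ∈ Set.Ioo 0 a, 0 < P t)
    (hP' : ∀ t ∈ Set.Ioo 0 a, HasDerivAt P (-(σ t * P t) / t) t)
    (hσ0 : ∀ t ∈ Set.Ioo 0 a, 0 ≤ σ t) (hσ1 : ∀ t ∈ Set.Ioo 0 a, σ t ≤ 1 / 8)
    (hσ' : ∀ t ∈ Set.Ioo 0 a, HasDerivAt σ (σ' t) t) (hσ'0 : ∀ t ∈ Set.Ioo 0 a, 0 ≤ σ' t)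
    (hσσ' : ∀ t ∈ Set.Ioo 0 a, σ t ^ 2 ≤ 2 * t * σ' t) (hf0 : ∀ t ∈ Set.Ioo 0 a, 0 ≤ f t)
    (hF : ∀ t ∈ Set.Ioo 0 a, t * (f t + σ' t) ≤ 1 / 16)
    (hFi : IntegrableOn (fun t => f t + σ' t) (Set.Ioo 0 a)) :
    ∃ φ y : ℝ → ℝ,
      Comparison a C (fun t => 3 / 4 * (1 / t ^ 2) - 1 / t ^ 2 * σ t - 1 / t * f t) φ y ∧
      ∃ c > 0, ∀ t ∈ Set.Ioo 0 a, c * (t * P t)⁻¹ ≤ φ t ^ 2 := by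
  -- Besides f, the correction has to pay for the term σ'/(2t) that appears when -(1 - σ)/(2t) is
  -- differentiated. Including all of σ' leaves the surplus σ'/(2t), which covers σ²/(4t²) by
  -- `hσσ'`.
  set F : ℝ → ℝ := fun t => f t + σ' t with hFdef
  have hF0 : ∀ t ∈ Set.Ioo 0 a, 0 ≤ F t := fun t ht => add_nonneg (hf0 t ht) (hσ'0 t ht)
  have hB : (0 : ℝ) ≤ 1 / 16 := by norm_num
  set g := tail F a with hg
  have hg0 : ∀ t ∈ Set.Ioo 0 a, 0 ≤ g t := fun t ht => tail_nonneg hF0 ht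
  have hg1 : ∀ t ∈ Set.Ioo 0 a, t * g t ≤ 1 / 16 := fun t ht => mul_tail_le hFi hB hF ht
  have hgc : ContinuousOn g (Set.Ioo 0 a) := fun t ht => by
    have h1 := (lipOn_tail hFi hF0 hB hF (α := t / 2) (β := (t + a) / 2) (by linarith [ht.1])
      (by linarith [ht.2])).continuousOn
    exact (h1.continuousAt (Icc_mem_nhds (by linarith [ht.1])
      (by linarith [ht.2]))).continuousWithinAt
  have ha2 : a / 2 ∈ Set.Ioo 0 a := ⟨by linarith, by linarith⟩
  set G : ℝ → ℝ := fun t => ∫ s in (a / 2)..t, g s with hG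
  have hgi : ∀ t ∈ Set.Ioo 0 a, IntervalIntegrable g volume (a / 2) t := fun t ht =>
    ContinuousOn.intervalIntegrable (hgc.mono (Set.ordConnected_Ioo.uIcc_subset ha2 ht))
  have hGd : ∀ t ∈ Set.Ioo 0 a, HasDerivAt G (g t) t := fun t ht => by
    have hct : ContinuousAt g t := hgc.continuousAt (Ioo_mem_nhds ht.1 ht.2)
    exact intervalIntegral.integral_hasDerivAt_right (hgi t ht)
      (hgc.stronglyMeasurableAtFilter isOpen_Ioo t ht) hct
  set y : ℝ → ℝ := fun t => -((1 - σ t) / (2 * t)) + g t with hy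
  -- The factor (tP)^(-1/2) has logarithmic derivative -(1 - σ)/(2t), and exp G contributes g.
  set φ : ℝ → ℝ := fun t => Real.exp (G t) / √(t * P t) with hφ
  have hpos : ∀ t ∈ Set.Ioo 0 a, 0 < t * P t := fun t ht => mul_pos ht.1 (hP t ht)
  refine ⟨φ, y, ⟨hC, fun t ht => ?_, fun t ht => ?_, fun α β hα hβ => ?_, ?_, fun t ht => ?_,
    fun t ht => ?_⟩, Real.exp (-(2 * (1 / 16 + ∫ s in Set.Ioo 0 a, F s))), Real.exp_pos _,
    fun t ht => ?_⟩
  · have := hpos t ht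
    positivity
  · have h0 := hpos t ht
    have ht0 := ht.1
    have hP0 := hP t ht
    have hs : 0 < √(t * P t) := Real.sqrt_pos.2 h0
    have hsq : √(t * P t) ^ 2 = t * P t := Real.sq_sqrt h0.le
    have h1 := (hGd t ht).exp.div (((hasDerivAt_id' t).mul (hP' t ht)).sqrt h0.ne') hs.ne'
    refine h1.congr_deriv ?_
    simp only [hy, hφ, Pi.mul_apply]
    field_simp
    rw [hsq]
    field_simp
    ring
  · have hsub : Set.Icc α β ⊆ Set.Ioo 0 a := fun t ht => ⟨hα.trans_le ht.1, ht.2.trans_lt hβ⟩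
    refine LipOn.add (h := fun t => -((1 - σ t) / (2 * t))) ?_ (lipOn_tail hFi hF0 hB hF hα hβ)
    refine lipOn_of_deriv_le (K := 1 / (16 * α) / (2 * α) + 1 / (2 * α ^ 2))
      (h' := fun t => σ' t / (2 * t) + (1 - σ t) / (2 * t ^ 2)) (fun t ht => ?_) fun t ht => ?_
    · have ht0 := (hsub ht).1
      refine (((hσ' t (hsub ht)).const_sub 1).div ((hasDerivAt_id' t).const_mul 2)
        (by positivity)).neg.congr_deriv ?_
      field_simp
      ring
    · have ht0 := (hsub ht).1
      have h1 := hσ'0 t (hsub ht)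
      have h2 := hσ0 t (hsub ht)
      have h3 := hσ1 t (hsub ht)
      have hαt := ht.1
      have h4 : σ' t ≤ 1 / (16 * t) := by
        rw [le_div_iff₀ (by positivity)]
        nlinarith [hF t (hsub ht), hf0 t (hsub ht)]
      have h5 : 0 ≤ 1 - σ t := by linarith
      rw [abs_of_nonneg (by positivity)]
      calc σ' t / (2 * t) + (1 - σ t) / (2 * t ^ 2)
          ≤ 1 / (16 * t) / (2 * t) + 1 / (2 * t ^ 2) := by gcongr; linarith
        _ ≤ _ := by gcongr
  · filter_upwards [ae_hasDerivAt_tail hFi] with t ht htm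
    have ht0 := htm.1
    have h1 : HasDerivAt (fun t => -((1 - σ t) / (2 * t)))
        (σ' t / (2 * t) + (1 - σ t) / (2 * t ^ 2)) t := by
      refine (((hσ' t htm).const_sub 1).div ((hasDerivAt_id' t).const_mul 2)
        (by positivity)).neg.congr_deriv ?_
      field_simp
      ring
    refine ⟨_, h1.add (ht htm), ?_⟩
    have h2 := hg0 t htm
    have h3 := hg1 t htm
    have h4 := hσ1 t htm
    have h5 := hσσ' t htm
    -- Exact Riccati surplus. Both summands are nonnegative: the first by `hσσ'`, the second because
    -- σ ≤ 1/8 and t·g ≤ 1/16.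
    have key : 3 / 4 * (1 / t ^ 2) - 1 / t ^ 2 * σ t - 1 / t * f t
        - (σ' t / (2 * t) + (1 - σ t) / (2 * t ^ 2) + (g t / (2 * t) - F t / t) + y t ^ 2)
        = ((2 * t * σ' t - σ t ^ 2) / 4 + t * g t * (1 / 2 - σ t - t * g t)) / t ^ 2 := by
      simp only [hy, hFdef]
      field_simp
      ring
    have h6 : 0 ≤ ((2 * t * σ' t - σ t ^ 2) / 4 + t * g t * (1 / 2 - σ t - t * g t)) / t ^ 2 := by
      have h7 : 0 ≤ t * g t := by positivity
      have h8 : 0 ≤ t * g t * (1 / 2 - σ t - t * g t) := mul_nonneg h7 (by linarith)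
      have h9 : 0 ≤ 2 * t * σ' t - σ t ^ 2 := by linarith
      positivity
    change _ ≤ 3 / 4 * (1 / t ^ 2) - 1 / t ^ 2 * σ t - 1 / t * f t
    linarith
  · have ht0 := ht.1
    have h1 : 2 * t * y t = -(1 - σ t) + 2 * (t * g t) := by
      simp only [hy]
      field_simp
    have h2 : 0 ≤ t * g t := mul_nonneg ht0.le (hg0 t ht)
    linarith [hσ0 t ht]
  · have ht0 := ht.1
    have h1 : 2 * t * y t = -(1 - σ t) + 2 * (t * g t) := by
      simp only [hy]
      field_simp
    have h2 : C * t ≤ C * a := mul_le_mul_of_nonneg_left ht.2.le hC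
    have h3 : t * (2 * y t + C) ≤ 0 := by nlinarith [hσ1 t ht, hg1 t ht]
    exact nonpos_of_mul_nonpos_right h3 ht0
  · have h0 := hpos t ht
    -- G is bounded below down to 0, so the correction costs only a constant factor and φ² stays
    -- comparable from below to (tP)⁻¹.
    have h1 : -(1 / 16 + ∫ s in Set.Ioo 0 a, F s) ≤ G t := by
      have hI : 0 ≤ ∫ s in Set.Ioo 0 a, F s := setIntegral_nonneg measurableSet_Ioo hF0
      rcases le_total t (a / 2) with h | h
      · have := integral_tail_le hFi hF0 hB hF ht.1 h ha2.2
        simp only [hG]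
        rw [intervalIntegral.integral_symm]
        linarith
      · have : 0 ≤ G t := intervalIntegral.integral_nonneg h fun s hs =>
          hg0 s ⟨ha2.1.trans_le hs.1, hs.2.trans_lt ht.2⟩
        linarith
    have h2 : φ t ^ 2 = Real.exp (2 * G t) * (t * P t)⁻¹ := by
      simp only [hφ]
      rw [div_pow, Real.sq_sqrt h0.le, ← Real.exp_nat_mul, div_eq_mul_inv]
      norm_num
    rw [h2]
    gcongr
    linarith

end ConstructComparison

/-! ### Calculus of iterated logarithms -/

section IteratedLogarithms

/-- The product `L₁ ⋯ L_k`. -/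
def logProd (k : ℕ) (t : ℝ) : ℝ := ∏ i ∈ Finset.Icc 1 k, iterLog i t

/-- The sum of the `(L₁ ⋯ L_i)⁻¹` over `1 ≤ i ≤ k`. -/
def logSum (k : ℕ) (t : ℝ) : ℝ := ∑ i ∈ Finset.Icc 1 k, (logProd i t)⁻¹

/-- The derivative of `logSum k`. -/
def logSum' (k : ℕ) (t : ℝ) : ℝ := ∑ i ∈ Finset.Icc 1 k, logSum i t * (logProd i t)⁻¹ / t

lemma logProd_zero (t : ℝ) : logProd 0 t = 1 := by simp [logProd]

lemma logProd_succ (k : ℕ) (t : ℝ) : logProd (k + 1) t = logProd k t * iterLog (k + 1) t :=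
  Finset.prod_Icc_succ_top (by omega) _

lemma logSum_zero (t : ℝ) : logSum 0 t = 0 := by simp [logSum]

lemma logSum_succ (k : ℕ) (t : ℝ) : logSum (k + 1) t = logSum k t + (logProd (k + 1) t)⁻¹ :=
  Finset.sum_Icc_succ_top (by omega) _

lemma logSum'_succ (k : ℕ) (t : ℝ) :
    logSum' (k + 1) t = logSum' k t + logSum (k + 1) t * (logProd (k + 1) t)⁻¹ / t :=
  Finset.sum_Icc_succ_top (by omega) _

lemma sum_inv_prod_iterLog (m : ℕ) (t : ℝ) :
    ∑ j ∈ Finset.Icc 2 (m + 1), (∏ k ∈ Finset.Icc 1 (j - 1), iterLog k t)⁻¹ = logSum m t := by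
  induction m with
  | zero => simp [logSum]
  | succ m ih => rw [Finset.sum_Icc_succ_top (by omega), ih, logSum_succ]; rfl

lemma tendsto_iterLog (k : ℕ) : Tendsto (iterLog k) (𝓝[>] 0) atTop := by
  induction k with
  | zero => exact tendsto_inv_nhdsGT_zero.congr fun t => (one_div t).symm
  | succ k ih => exact Real.tendsto_log_atTop.comp ih

lemma tendsto_logProd_succ (k : ℕ) : Tendsto (logProd (k + 1)) (𝓝[>] 0) atTop := by
  induction k with
  | zero =>
    refine (tendsto_iterLog 1).congr fun t => ?_
    rw [logProd_succ, logProd_zero, one_mul]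
  | succ k ih =>
    refine (ih.atTop_mul_atTop₀ (tendsto_iterLog (k + 2))).congr fun t => ?_
    rw [logProd_succ (k + 1)]

lemma tendsto_logSum (k : ℕ) : Tendsto (logSum k) (𝓝[>] 0) (𝓝 0) := by
  have h : Tendsto (fun t => ∑ i ∈ Finset.Icc 1 k, (logProd i t)⁻¹) (𝓝[>] 0)
      (𝓝 (∑ i ∈ Finset.Icc 1 k, (0 : ℝ))) := by
    refine tendsto_finsetSum _ fun i hi => ?_
    obtain ⟨j, rfl⟩ : ∃ j, i = j + 1 := ⟨i - 1, by have := (Finset.mem_Icc.1 hi).1; omega⟩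
    exact (tendsto_logProd_succ j).inv_tendsto_atTop
  rw [Finset.sum_const_zero] at h
  exact h

lemma eventually_iterLog_pos (k : ℕ) : ∀ᶠ t in 𝓝[>] (0 : ℝ), ∀ i ≤ k, 0 < iterLog i t := by
  have : ∀ᶠ t in 𝓝[>] (0 : ℝ), ∀ i ∈ Finset.range (k + 1), 0 < iterLog i t :=
    (Finset.eventually_all _).2 fun i _ => (tendsto_iterLog i).eventually_gt_atTop 0
  filter_upwards [this] with t ht i hi
  exact ht i (Finset.mem_range.2 (by omega))

lemma iterLog_at_zero (k : ℕ) : iterLog k 0 = 0 := by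
  induction k with
  | zero => simp [iterLog]
  | succ k ih => rw [iterLog, ih, Real.log_zero]

/-- The default values 1/0 = 0, log 0 = 0 and 0⁻¹ = 0 produce exactly the limit at 0⁺, so `logSum k`
is continuous from the right at 0. -/
lemma logSum_at_zero (k : ℕ) : logSum k 0 = 0 := by
  refine Finset.sum_eq_zero fun i hi => ?_
  obtain ⟨j, rfl⟩ : ∃ j, i = j + 1 := ⟨i - 1, by have := (Finset.mem_Icc.1 hi).1; omega⟩
  rw [logProd_succ, iterLog_at_zero, mul_zero, inv_zero]

variable {k : ℕ} {t : ℝ}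

lemma logProd_pos (h : ∀ i ≤ k, 0 < iterLog i t) : 0 < logProd k t :=
  Finset.prod_pos fun i hi => h i (Finset.mem_Icc.1 hi).2

lemma logSum_nonneg (h : ∀ i ≤ k, 0 < iterLog i t) : 0 ≤ logSum k t :=
  Finset.sum_nonneg fun _ hi => inv_nonneg.2
    (logProd_pos fun j hj => h j (hj.trans (Finset.mem_Icc.1 hi).2)).le

lemma hasDerivAt_iterLog_succ (ht : 0 < t) (h : ∀ i ≤ k, 0 < iterLog i t) :
    HasDerivAt (iterLog (k + 1)) (-(t * logProd k t)⁻¹) t := by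
  induction k with
  | zero =>
    have h1 : HasDerivAt (iterLog 0) (-(t ^ 2)⁻¹) t :=
      (hasDerivAt_inv ht.ne').congr_of_eventuallyEq (Eventually.of_forall fun s => one_div s)
    refine (h1.log (h 0 le_rfl).ne').congr_deriv ?_
    rw [logProd_zero, iterLog]
    field_simp
  | succ k ih =>
    have h1 := ih fun i hi => h i (hi.trans (Nat.le_succ k))
    refine (h1.log (h (k + 1) le_rfl).ne').congr_deriv ?_
    rw [logProd_succ]
    have := h (k + 1) le_rfl
    field_simp

lemma hasDerivAt_logProd (ht : 0 < t) (h : ∀ i ≤ k, 0 < iterLog i t) :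
    HasDerivAt (logProd k) (-(logSum k t * logProd k t) / t) t := by
  induction k with
  | zero =>
    refine ((hasDerivAt_const t (1 : ℝ)).congr_of_eventuallyEq
      (Eventually.of_forall fun s => logProd_zero s)).congr_deriv ?_
    rw [logSum_zero]
    simp
  | succ k ih =>
    have hk : ∀ i ≤ k, 0 < iterLog i t := fun i hi => h i (hi.trans (Nat.le_succ k))
    have h1 := (ih hk).mul (hasDerivAt_iterLog_succ ht hk)
    have hp := logProd_pos hk
    have hl := h (k + 1) le_rfl
    refine (h1.congr_of_eventuallyEq
      (Eventually.of_forall fun s => logProd_succ k s)).congr_deriv ?_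
    rw [logSum_succ, logProd_succ]
    field_simp
    ring

lemma hasDerivAt_logSum (ht : 0 < t) (h : ∀ i ≤ k, 0 < iterLog i t) :
    HasDerivAt (logSum k) (logSum' k t) t := by
  have h1 : ∀ i ∈ Finset.Icc 1 k,
      HasDerivAt (fun s => (logProd i s)⁻¹) (logSum i t * (logProd i t)⁻¹ / t) t := by
    intro i hi
    have hi' : ∀ j ≤ i, 0 < iterLog j t := fun j hj => h j (hj.trans (Finset.mem_Icc.1 hi).2)
    have hp := logProd_pos hi'
    refine ((hasDerivAt_logProd ht hi').inv hp.ne').congr_deriv ?_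
    field_simp
  exact HasDerivAt.fun_sum h1

/-- With xᵢ = (L₁⋯Lᵢ)⁻¹, t·σ' is the sum of xᵢxⱼ over j ≤ i. For nonnegative xᵢ this lies between
half the square of the total and the full square. -/
lemma logSum'_bounds (ht : 0 < t) (h : ∀ i ≤ k, 0 < iterLog i t) :
    0 ≤ logSum' k t ∧ logSum k t ^ 2 ≤ 2 * t * logSum' k t ∧ t * logSum' k t ≤ logSum k t ^ 2 := by
  induction k with
  | zero => simp [logSum', logSum]
  | succ k ih =>
    have hk : ∀ i ≤ k, 0 < iterLog i t := fun i hi => h i (hi.trans (Nat.le_succ k))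
    obtain ⟨h1, h2, h3⟩ := ih hk
    have hx : 0 < (logProd (k + 1) t)⁻¹ := inv_pos.2 (logProd_pos h)
    have hs := logSum_nonneg hk
    have e : t * logSum' (k + 1) t = t * logSum' k t
        + (logSum k t + (logProd (k + 1) t)⁻¹) * (logProd (k + 1) t)⁻¹ := by
      rw [logSum'_succ, logSum_succ]
      field_simp
    refine ⟨?_, ?_, ?_⟩
    · rw [logSum'_succ, logSum_succ]
      positivity
    · rw [mul_assoc, e, logSum_succ]
      nlinarith
    · rw [e, logSum_succ]
      nlinarith [mul_nonneg hs hx.le]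

lemma integral_inv_mul_logProd {α β : ℝ} (hα : 0 < α) (hαβ : α ≤ β)
    (h : ∀ t ∈ Set.Icc α β, ∀ i ≤ k, 0 < iterLog i t) :
    IntervalIntegrable (fun t => (t * logProd k t)⁻¹) volume α β ∧
      ∫ t in α..β, (t * logProd k t)⁻¹ = iterLog (k + 1) α - iterLog (k + 1) β := by
  have hci : IntervalIntegrable (fun t => (t * logProd k t)⁻¹) volume α β := by
    refine ContinuousOn.intervalIntegrable fun t ht => ?_
    rw [Set.uIcc_of_le hαβ] at ht
    have ht0 : 0 < t := hα.trans_le ht.1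
    have h1 := (hasDerivAt_logProd ht0 (h t ht)).continuousAt
    exact ((continuousAt_id.mul h1).inv₀
      (mul_pos ht0 (logProd_pos (h t ht))).ne').continuousWithinAt
  refine ⟨hci, ?_⟩
  have hd : ∀ t ∈ Set.uIcc α β, HasDerivAt (fun t => -iterLog (k + 1) t) (t * logProd k t)⁻¹ t := by
    intro t ht
    rw [Set.uIcc_of_le hαβ] at ht
    exact (hasDerivAt_iterLog_succ (hα.trans_le ht.1) (h t ht)).neg.congr_deriv (neg_neg _)
  rw [intervalIntegral.integral_eq_sub_of_hasDerivAt hd hci]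
  ring

/-- A comparison function for the potential with iterated logarithms, not square integrable
at `0`. -/
theorem exists_comparison_iterLog {p : ℕ} (hp : 2 ≤ p) {f : ℝ → ℝ}
    (hf_nonneg : ∀ᶠ u in 𝓝[>] 0, 0 ≤ f u)
    (hf_lim : Tendsto (fun u => u * f u) (𝓝[>] 0) (𝓝 0))
    (hf_int : IntegrableAtFilter f (𝓝[>] 0) volume) {C a₀ : ℝ} (hC : 0 ≤ C) (ha₀ : 0 < a₀) :
    ∃ a, 0 < a ∧ a < a₀ ∧ ∃ φ y : ℝ → ℝ,
      Comparison a C (fun t => 3 / 4 * (1 / t ^ 2) - 1 / t ^ 2 *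
        ∑ j ∈ Finset.Icc 2 p, (∏ k ∈ Finset.Icc 1 (j - 1), iterLog k t)⁻¹ - 1 / t * f t) φ y ∧
      ∀ ε₁ ∈ Set.Ioo 0 a, Tendsto (fun ε₀ => ∫ s in ε₀..ε₁, φ s ^ 2) (𝓝[>] 0) atTop := by
  -- The sum over 2 ≤ j ≤ p involves products of at most p - 1 = m logarithms, which shifts the
  -- index to `logSum m`.
  obtain ⟨m, rfl⟩ : ∃ m, p = m + 1 := ⟨p - 1, by omega⟩
  obtain ⟨S, hS, hfS⟩ := hf_int
  have hev : ∀ᶠ t in 𝓝[>] (0 : ℝ), (0 ≤ f t ∧ t * f t ≤ 1 / 32) ∧ t ∈ S ∧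
      (∀ i ≤ m, 0 < iterLog i t) ∧ logSum m t ≤ 1 / 8 := by
    filter_upwards [hf_nonneg, hf_lim.eventually_le_const (show (0 : ℝ) < 1 / 32 by norm_num), hS,
      eventually_iterLog_pos m,
      (tendsto_logSum m).eventually_le_const (show (0 : ℝ) < 1 / 8 by norm_num)]
      with t h1 h2 h3 h4 h5 using ⟨⟨h1, h2⟩, h3, h4, h5⟩
  obtain ⟨u, hu, hsub⟩ := mem_nhdsGT_iff_exists_Ioo_subset.1 hev
  have hu0 : (0 : ℝ) < u := hu
  -- The last bound gives C·a ≤ 1/8; halving makes the inequalities with u and a₀ strict.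
  set a := min u (min a₀ (1 / (8 * (C + 1)))) / 2 with ha_def
  have hm0 : 0 < min u (min a₀ (1 / (8 * (C + 1)))) := by positivity
  have ha : 0 < a := by positivity
  have hau : a < u := by have := min_le_left u (min a₀ (1 / (8 * (C + 1)))); linarith
  have haa : a < a₀ := by
    have := (min_le_right u (min a₀ (1 / (8 * (C + 1))))).trans (min_le_left _ _)
    linarith
  have haC : a ≤ 1 / (8 * (C + 1)) := by
    have := (min_le_right u (min a₀ (1 / (8 * (C + 1))))).trans (min_le_right _ _)
    linarith
  have hCa : C * a ≤ 1 / 8 := by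
    rw [le_div_iff₀ (by positivity)] at haC
    nlinarith
  have hQ : ∀ t ∈ Set.Ioc 0 a, (0 ≤ f t ∧ t * f t ≤ 1 / 32) ∧ t ∈ S ∧
      (∀ i ≤ m, 0 < iterLog i t) ∧ logSum m t ≤ 1 / 8 := fun t ht =>
    hsub ⟨ht.1, ht.2.trans_lt hau⟩
  have hQ' : ∀ t ∈ Set.Ioo 0 a, (0 ≤ f t ∧ t * f t ≤ 1 / 32) ∧ t ∈ S ∧
      (∀ i ≤ m, 0 < iterLog i t) ∧ logSum m t ≤ 1 / 8 := fun t ht => hQ t ⟨ht.1, ht.2.le⟩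
  have hσc : ContinuousOn (logSum m) (Set.Icc 0 a) := by
    intro t ht
    rcases ht.1.eq_or_lt with h0 | h0
    · subst h0
      have h1 : ContinuousWithinAt (logSum m) (Set.Ioi 0) 0 := by
        rw [ContinuousWithinAt, logSum_at_zero]
        exact tendsto_logSum m
      exact (continuousWithinAt_Ioi_iff_Ici.1 h1).mono Set.Icc_subset_Ici_self
    · exact (hasDerivAt_logSum h0 (hQ t ⟨h0, ht.2⟩).2.2.1).continuousAt.continuousWithinAt
  -- A nonnegative derivative of a function continuous up to the endpoint 0 is integrable.
  have hσi : IntegrableOn (logSum' m) (Set.Ioo 0 a) :=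
    (intervalIntegral.integrableOn_deriv_of_nonneg hσc
      (fun t ht => hasDerivAt_logSum ht.1 (hQ' t ht).2.2.1)
      (fun t ht => (logSum'_bounds ht.1 (hQ' t ht).2.2.1).1)).mono_set Set.Ioo_subset_Ioc_self
  obtain ⟨φ, y, hcmp, c, hc, hlow⟩ := exists_comparison (P := logProd m) (σ := logSum m)
    (σ' := logSum' m) (f := f) ha hC hCa (fun t ht => logProd_pos (hQ' t ht).2.2.1)
    (fun t ht => hasDerivAt_logProd ht.1 (hQ' t ht).2.2.1)
    (fun t ht => logSum_nonneg (hQ' t ht).2.2.1) (fun t ht => (hQ' t ht).2.2.2)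
    (fun t ht => hasDerivAt_logSum ht.1 (hQ' t ht).2.2.1)
    (fun t ht => (logSum'_bounds ht.1 (hQ' t ht).2.2.1).1)
    (fun t ht => (logSum'_bounds ht.1 (hQ' t ht).2.2.1).2.1) (fun t ht => (hQ' t ht).1.1)
    (fun t ht => by
      have h1 := (logSum'_bounds ht.1 (hQ' t ht).2.2.1).2.2
      have h2 := logSum_nonneg (hQ' t ht).2.2.1
      have h3 := (hQ' t ht).2.2.2
      have h4 := (hQ' t ht).1.2
      nlinarith)
    ((hfS.mono_set fun t ht => (hQ' t ht).2.1).add hσi)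
  refine ⟨a, ha, haa, φ, y, ?_, fun ε₁ hε₁ => ?_⟩
  · simpa only [sum_inv_prod_iterLog] using hcmp
  · have h1 : Tendsto (fun ε₀ => c * (iterLog (m + 1) ε₀ + -iterLog (m + 1) ε₁)) (𝓝[>] 0) atTop :=
      ((tendsto_iterLog (m + 1)).atTop_add tendsto_const_nhds).const_mul_atTop hc
    refine tendsto_atTop_mono' _ ?_ h1
    filter_upwards [Ioo_mem_nhdsGT hε₁.1] with ε₀ hε₀
    have hmem : ∀ t ∈ Set.Icc ε₀ ε₁, t ∈ Set.Ioo 0 a := fun t ht =>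
      ⟨hε₀.1.trans_le ht.1, ht.2.trans_lt hε₁.2⟩
    obtain ⟨h2, h3⟩ := integral_inv_mul_logProd (k := m) hε₀.1 hε₀.2.le
      fun t ht => (hQ' t (hmem t ht)).2.2.1
    rw [← sub_eq_add_neg, ← h3, ← intervalIntegral.integral_const_mul]
    refine intervalIntegral.integral_mono_on hε₀.2.le (h2.const_mul c) ?_
      fun t ht => hlow t (hmem t ht)
    refine ContinuousOn.intervalIntegrable ((hcmp.continuousOn.mono ?_).pow 2)
    rw [Set.uIcc_of_le hε₀.2.le]
    exact hmem

end IteratedLogarithms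

/-! ### Second differences of functions of the boundary distance -/

section DistanceProfile

variable {n : ℕ} {Ω : Opens (Rn n)}

/-- The two squared norms on the left sum to 2‖v‖² + 2‖e‖²; each is bounded below by its tangent, s²
≥ 2s‖v‖ - ‖v‖². Summed over n coordinate directions with ‖v‖ ≥ r this is the source of the constant
n/r. -/
lemma norm_add_add_norm_sub_le {E : Type*} [NormedAddCommGroup E] [InnerProductSpace ℝ E]
    {v e : E} (hv : 0 < ‖v‖) : ‖v + e‖ + ‖v - e‖ - 2 * ‖v‖ ≤ ‖e‖ ^ 2 / ‖v‖ := by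
  rw [le_div_iff₀ hv]
  have h1 := norm_add_sq_real v e
  have h2 := norm_sub_sq_real v e
  nlinarith [sq_nonneg (‖v + e‖ - ‖v‖), sq_nonneg (‖v - e‖ - ‖v‖)]

/-- The quadratic variation of the norm at `v` along the coordinate directions. -/
def normVar (v : Rn n) (h : ℝ) : ℝ :=
  ∑ i, ((‖v + h • EuclideanSpace.single i (1 : ℝ)‖ - ‖v‖) ^ 2
    + (‖v - h • EuclideanSpace.single i (1 : ℝ)‖ - ‖v‖) ^ 2)

/-- The norm has a unit gradient, whose squared components add up to 1; the two signs of the step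
account for the value 2. -/
lemma tendsto_normVar {v : Rn n} (hv : 0 < ‖v‖) :
    Tendsto (fun h => (h ^ 2)⁻¹ * normVar v h) (𝓝[>] 0) (𝓝 2) := by
  set e : Fin n → Rn n := fun i => EuclideanSpace.single i (1 : ℝ) with he
  have hexact : ∀ i : Fin n, ∀ h : ℝ,
      (‖v + h • e i‖ - ‖v‖) * (‖v + h • e i‖ + ‖v‖) = h * (2 * v i + h) := by
    intro i h
    have h1 := norm_add_sq_real v (h • e i)
    have h2 : inner ℝ v (h • e i) = h * v i := by
      rw [inner_smul_right, he, EuclideanSpace.inner_single_right]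
      simp
    have h3 : ‖h • e i‖ ^ 2 = h ^ 2 := by
      rw [norm_smul]
      simp [he]
    rw [h2, h3] at h1
    linear_combination h1
  have hq : ∀ i : Fin n, ∀ h : ℝ, h ≠ 0 →
      (h ^ 2)⁻¹ * (‖v + h • e i‖ - ‖v‖) ^ 2 = ((2 * v i + h) / (‖v + h • e i‖ + ‖v‖)) ^ 2 := by
    intro i h hh
    have hpos : 0 < ‖v + h • e i‖ + ‖v‖ := by positivity
    have : ‖v + h • e i‖ - ‖v‖ = h * (2 * v i + h) / (‖v + h • e i‖ + ‖v‖) := by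
      rw [eq_div_iff hpos.ne', hexact]
    rw [this]
    field_simp
  have hlim : ∀ i : Fin n, Tendsto (fun h : ℝ => ((2 * v i + h) / (‖v + h • e i‖ + ‖v‖)) ^ 2)
      (𝓝 0) (𝓝 ((v i / ‖v‖) ^ 2)) := by
    intro i
    have hne : ‖v + (0 : ℝ) • e i‖ + ‖v‖ ≠ 0 := by positivity
    have hc : ContinuousAt (fun h : ℝ => ((2 * v i + h) / (‖v + h • e i‖ + ‖v‖)) ^ 2) 0 := by
      fun_prop (disch := assumption)
    have := hc.tendsto
    convert this using 2
    rw [zero_smul, add_zero, add_zero]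
    field_simp
    ring
  have hlim' : ∀ i : Fin n, Tendsto (fun h : ℝ => (h ^ 2)⁻¹ * (‖v + h • e i‖ - ‖v‖) ^ 2
      + (h ^ 2)⁻¹ * (‖v - h • e i‖ - ‖v‖) ^ 2) (𝓝[>] 0) (𝓝 (2 * (v i / ‖v‖) ^ 2)) := by
    intro i
    have h1 : Tendsto (fun h : ℝ => -h) (𝓝[>] 0) (𝓝 0) := by
      have := (continuous_neg (G := ℝ)).tendsto 0
      rw [neg_zero] at this
      exact this.mono_left nhdsWithin_le_nhds
    have h2 := ((hlim i).mono_left (nhdsWithin_le_nhds (s := Set.Ioi 0))).add ((hlim i).comp h1)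
    rw [← two_mul] at h2
    refine h2.congr' ?_
    filter_upwards [self_mem_nhdsWithin] with h hh
    have hh0 : h ≠ 0 := ne_of_gt hh
    have h3 := hq i (-h) (neg_ne_zero.2 hh0)
    rw [neg_sq, neg_smul, ← sub_eq_add_neg] at h3
    rw [hq i h hh0, h3]
    simp only [Function.comp_apply, neg_smul, ← sub_eq_add_neg]
  have hsum := tendsto_finsetSum (Finset.univ : Finset (Fin n)) fun i _ => hlim' i
  have h2 : ∑ i, 2 * (v i / ‖v‖) ^ 2 = 2 := by
    simp only [div_pow]
    rw [← Finset.mul_sum, ← Finset.sum_div]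
    have : ∑ i, v i ^ 2 = ‖v‖ ^ 2 := by
      rw [EuclideanSpace.norm_sq_eq]
      simp
    rw [this, div_self (by positivity), mul_one]
  rw [h2] at hsum
  refine hsum.congr fun h => ?_
  rw [normVar, Finset.mul_sum]
  exact Finset.sum_congr rfl fun i _ => by rw [mul_add]

/-- The function `H(d(x))` on `Ω`, extended by zero. -/
def bump (Ω : Opens (Rn n)) (H : ℝ → ℝ) : Rn n → ℝ :=
  (Ω : Set (Rn n)).indicator fun x => H (bdist Ω x)

variable {H q b : ℝ → ℝ} {Λ h₀ ε₀ r : ℝ}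

lemma bump_of_notMem {x : Rn n} (hx : x ∉ Ω) : bump Ω H x = 0 := Set.indicator_of_notMem hx _

lemma bump_of_mem {x : Rn n} (hx : x ∈ Ω) : bump Ω H x = H (bdist Ω x) :=
  Set.indicator_of_mem (s := (Ω : Set (Rn n))) hx _

lemma bump_nonneg (hH : ∀ t, 0 ≤ H t) (x : Rn n) : 0 ≤ bump Ω H x :=
  Set.indicator_nonneg (fun _ _ => hH _) x

lemma bdist_le_of_notMem {x x' : Rn n} (hx : x ∉ Ω) (hx' : x' ∈ Ω) : bdist Ω x' ≤ dist x x' := by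
  by_contra! h
  exact hx (ball_bdist_subset hx' h)

lemma bump_eq_zero_near (hH0 : ∀ t ≤ ε₀, H t = 0) {x x' : Rn n} (hx : x ∉ Ω)
    (hd : dist x x' ≤ ε₀) : bump Ω H x' = 0 := by
  by_cases hx' : x' ∈ Ω
  · rw [bump_of_mem hx']
    exact hH0 _ ((bdist_le_of_notMem hx hx').trans hd)
  · exact bump_of_notMem hx'

lemma continuous_bump (hH : Continuous H) (hε₀ : 0 < ε₀) (hH0 : ∀ t ≤ ε₀, H t = 0) :
    Continuous (bump Ω H) := by
  refine continuous_iff_continuousAt.2 fun x => ?_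
  by_cases hx : x ∈ Ω
  · have h1 : (fun x => H (bdist Ω x)) =ᶠ[𝓝 x] bump Ω H := by
      filter_upwards [Ω.isOpen.mem_nhds hx] with y hy using (bump_of_mem hy).symm
    exact ((hH.comp continuous_bdist).continuousAt).congr h1
  · have h1 : (fun _ => (0 : ℝ)) =ᶠ[𝓝 x] bump Ω H := by
      filter_upwards [Metric.ball_mem_nhds x hε₀] with y hy
      exact (bump_eq_zero_near hH0 hx (by rw [dist_comm]; exact (Metric.mem_ball.1 hy).le)).symm
    exact continuousAt_const.congr h1

lemma tsupport_bump_subset (hε₀ : 0 < ε₀) (hH0 : ∀ t ≤ ε₀, H t = 0) :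
    tsupport (bump Ω H) ⊆ Ω := by
  intro x hx
  by_contra hxΩ
  refine (notMem_tsupport_iff_eventuallyEq.2 ?_) hx
  filter_upwards [Metric.ball_mem_nhds x hε₀] with y hy
  exact bump_eq_zero_near hH0 hxΩ (by rw [dist_comm]; exact (Metric.mem_ball.1 hy).le)

lemma hasCompactSupport_bump (hb : Bornology.IsBounded (Ω : Set (Rn n))) :
    HasCompactSupport (bump Ω H) :=
  HasCompactSupport.of_support_subset_isCompact hb.isCompact_closure
    (Set.support_indicator_subset.trans subset_closure)

/-- Second differences of `bump` are controlled by the distance to a touching ball. -/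
lemma dlap_bump_le (hH : IsProfile H q b Λ h₀) {x z : Rn n} (hr : 0 < r) (hx : x ∈ Ω)
    (hz : ‖x - z‖ = bdist Ω x + r) (hz' : ∀ x' ∈ Ω, bdist Ω x' ≤ ‖x' - z‖ - r) {h B : ℝ}
    (hh : 0 < h)
    (hB : ∀ s, |s - bdist Ω x| ≤ h → H s ≤ H (bdist Ω x) + q (bdist Ω x) * (s - bdist Ω x)
      + B * (s - bdist Ω x) ^ 2) :
    dlap h (bump Ω H) x ≤ n / r * q (bdist Ω x) + B * ((h ^ 2)⁻¹ * normVar (x - z) h) := by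
  set d := bdist Ω x with hd
  have hd0 : 0 ≤ d := bdist_nonneg x
  have hle : ∀ x', bump Ω H x' ≤ H (‖x' - z‖ - r) := fun x' => by
    by_cases hx' : x' ∈ Ω
    · rw [bump_of_mem hx']
      exact hH.mono (hz' x' hx')
    · rw [bump_of_notMem hx']
      exact hH.nonneg _
  have hterm : ∀ i : Fin n, bump Ω H (x + h • EuclideanSpace.single i (1 : ℝ))
      + bump Ω H (x - h • EuclideanSpace.single i (1 : ℝ)) - (2 : ℝ) • bump Ω H x
      ≤ q d * (h ^ 2 / r) + B * ((‖x - z + h • EuclideanSpace.single i (1 : ℝ)‖ - ‖x - z‖) ^ 2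
        + (‖x - z - h • EuclideanSpace.single i (1 : ℝ)‖ - ‖x - z‖) ^ 2) := by
    intro i
    set e : Rn n := h • EuclideanSpace.single i (1 : ℝ) with he
    have hen : ‖e‖ = h := by
      rw [he, norm_smul, Real.norm_of_nonneg hh.le]
      simp
    have h1 := hle (x + e)
    have h2 := hle (x - e)
    rw [show x + e - z = x - z + e by abel] at h1
    rw [show x - e - z = x - z - e by abel] at h2
    have a1 : |‖x - z + e‖ - ‖x - z‖| ≤ h := by
      have := abs_norm_sub_norm_le (x - z + e) (x - z)
      rwa [add_sub_cancel_left, hen] at this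
    have a2 : |‖x - z - e‖ - ‖x - z‖| ≤ h := by
      have := abs_norm_sub_norm_le (x - z - e) (x - z)
      rwa [sub_sub_cancel_left, norm_neg, hen] at this
    have e1 : ‖x - z + e‖ - r - d = ‖x - z + e‖ - ‖x - z‖ := by rw [hz]; ring
    have e2 : ‖x - z - e‖ - r - d = ‖x - z - e‖ - ‖x - z‖ := by rw [hz]; ring
    have b1 := hB (‖x - z + e‖ - r) (by rw [e1]; exact a1)
    have b2 := hB (‖x - z - e‖ - r) (by rw [e2]; exact a2)
    rw [e1] at b1
    rw [e2] at b2
    have hv : 0 < ‖x - z‖ := by rw [hz]; positivity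
    have h3 := norm_add_add_norm_sub_le (e := e) hv
    rw [hen] at h3
    have h4 : h ^ 2 / ‖x - z‖ ≤ h ^ 2 / r := by
      gcongr
      rw [hz]
      linarith
    have h5 := mul_le_mul_of_nonneg_left (h3.trans h4) (hH.q_nonneg d)
    rw [bump_of_mem hx, smul_eq_mul]
    linarith
  rw [dlap, smul_eq_mul]
  calc _ ≤ (h ^ 2)⁻¹ * ∑ i : Fin n, (q d * (h ^ 2 / r)
        + B * ((‖x - z + h • EuclideanSpace.single i (1 : ℝ)‖ - ‖x - z‖) ^ 2
        + (‖x - z - h • EuclideanSpace.single i (1 : ℝ)‖ - ‖x - z‖) ^ 2)) := by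
        gcongr with i _
        exact hterm i
    _ = _ := by
        rw [Finset.sum_add_distrib, Finset.sum_const, Finset.card_univ, Fintype.card_fin,
          ← Finset.mul_sum, normVar, nsmul_eq_mul]
        field_simp

lemma dlap_bump_of_notMem (hH0 : ∀ t ≤ ε₀, H t = 0) {x : Rn n} (hx : x ∉ Ω) {h : ℝ} (hh : 0 < h)
    (hhε : h ≤ ε₀) : dlap h (bump Ω H) x = 0 := by
  have h1 : ∀ i : Fin n, ‖h • (EuclideanSpace.single i (1 : ℝ) : Rn n)‖ = h := fun i => by
    rw [norm_smul, Real.norm_of_nonneg hh.le]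
    simp
  rw [dlap, Finset.sum_eq_zero, smul_zero]
  intro i _
  rw [bump_eq_zero_near hH0 hx (by rw [dist_self_add_right, h1]; exact hhε),
    bump_eq_zero_near hH0 hx (by rw [dist_eq_norm, sub_sub_cancel, h1]; exact hhε),
    bump_of_notMem hx]
  simp

lemma normVar_le (v : Rn n) {h : ℝ} (hh : 0 < h) : (h ^ 2)⁻¹ * normVar v h ≤ 2 * n := by
  rw [inv_mul_le_iff₀ (by positivity)]
  have : ∀ i : Fin n, (‖v + h • EuclideanSpace.single i (1 : ℝ)‖ - ‖v‖) ^ 2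
      + (‖v - h • EuclideanSpace.single i (1 : ℝ)‖ - ‖v‖) ^ 2 ≤ 2 * h ^ 2 := by
    intro i
    set e : Rn n := h • EuclideanSpace.single i (1 : ℝ) with he
    have hen : ‖e‖ = h := by
      rw [he, norm_smul, Real.norm_of_nonneg hh.le]
      simp
    have a1 := abs_norm_sub_norm_le (v + e) v
    rw [add_sub_cancel_left, hen] at a1
    have a2 := abs_norm_sub_norm_le (v - e) v
    rw [sub_sub_cancel_left, norm_neg, hen] at a2
    have c1 := sq_le_sq' (by linarith [abs_le.1 a1]) (abs_le.1 a1).2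
    have c2 := sq_le_sq' (by linarith [abs_le.1 a2]) (abs_le.1 a2).2
    linarith
  calc normVar v h ≤ ∑ _i : Fin n, 2 * h ^ 2 := Finset.sum_le_sum fun i _ => this i
    _ = _ := by
      rw [Finset.sum_const, Finset.card_univ, Fintype.card_fin, nsmul_eq_mul]
      ring

/-- The pointwise upper bound for the Laplacian of `bump`. -/
def bumpLap (Ω : Opens (Rn n)) (C : ℝ) (q b : ℝ → ℝ) : Rn n → ℝ :=
  (Ω : Set (Rn n)).indicator fun x => b (bdist Ω x) + C * q (bdist Ω x)

lemma measurable_bumpLap (hH : IsProfile H q b Λ h₀) (C : ℝ) : Measurable (bumpLap Ω C q b) :=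
  Measurable.indicator ((hH.meas_b.comp continuous_bdist.measurable).add
    ((hH.meas_q.comp continuous_bdist.measurable).const_mul C)) Ω.isOpen.measurableSet

lemma IsProfile.Λ_nonneg (hH : IsProfile H q b Λ h₀) : 0 ≤ Λ := (hH.q_nonneg 0).trans (hH.q_le 0)

lemma abs_bumpLap_le (hH : IsProfile H q b Λ h₀) {C : ℝ} (hC : 0 ≤ C) (x : Rn n) :
    |bumpLap Ω C q b x| ≤ Λ + C * Λ := by
  have hΛ := hH.Λ_nonneg
  by_cases hx : x ∈ (Ω : Set (Rn n))
  · rw [bumpLap, Set.indicator_of_mem hx]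
    refine (abs_add_le _ _).trans (add_le_add (hH.b_le _) ?_)
    rw [abs_of_nonneg (mul_nonneg hC (hH.q_nonneg _))]
    exact mul_le_mul_of_nonneg_left (hH.q_le _) hC
  · rw [bumpLap, Set.indicator_of_notMem hx, abs_zero]
    positivity

lemma dlap_bump_le_const (hH : IsProfile H q b Λ h₀) (hH0 : ∀ t ≤ ε₀, H t = 0) (hr : 0 < r)
    (hball : ∀ x ∈ Ω, ∃ z, ‖x - z‖ = bdist Ω x + r ∧ ∀ x' ∈ Ω, bdist Ω x' ≤ ‖x' - z‖ - r)
    {h : ℝ} (hh : 0 < h) (hhh : h < min h₀ ε₀) (x : Rn n) :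
    dlap h (bump Ω H) x ≤ n / r * Λ + Λ * (2 * n) := by
  have hΛ := hH.Λ_nonneg
  by_cases hx : x ∈ Ω
  · obtain ⟨z, hz, hz'⟩ := hball x hx
    refine (dlap_bump_le hH hr hx hz hz' hh fun s hs =>
      hH.jet _ s (hs.trans (hhh.le.trans (min_le_left _ _)))).trans ?_
    exact add_le_add (mul_le_mul_of_nonneg_left (hH.q_le _) (by positivity))
      (mul_le_mul_of_nonneg_left (normVar_le _ hh) hΛ)
  · rw [dlap_bump_of_notMem hH0 hx hh (hhh.le.trans (min_le_right _ _))]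
    positivity

/-- Insert the jet at d(x) into the barrier bound. The quadratic coefficient b/2 + ε/4 is doubled by
the limit of `normVar`, giving b + ε/2 and leaving ε/2 to spare. -/
lemma eventually_dlap_bump_le (hH : IsProfile H q b Λ h₀) (hr : 0 < r)
    (hball : ∀ x ∈ Ω, ∃ z, ‖x - z‖ = bdist Ω x + r ∧ ∀ x' ∈ Ω, bdist Ω x' ≤ ‖x' - z‖ - r)
    {x : Rn n} (hx : x ∈ Ω)
    (hjet : ∀ ε > 0, ∀ᶠ s in 𝓝 (bdist Ω x), H s ≤ H (bdist Ω x)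
      + q (bdist Ω x) * (s - bdist Ω x) + (b (bdist Ω x) / 2 + ε) * (s - bdist Ω x) ^ 2)
    {ε : ℝ} (hε : 0 < ε) :
    ∀ᶠ h in 𝓝[>] (0 : ℝ), dlap h (bump Ω H) x ≤ bumpLap Ω (n / r) q b x + ε := by
  obtain ⟨z, hz, hz'⟩ := hball x hx
  have hv : 0 < ‖x - z‖ := by
    rw [hz]
    have := bdist_nonneg (Ω := Ω) x
    positivity
  set B := b (bdist Ω x) / 2 + ε / 4 with hB
  obtain ⟨η, hη, hηs⟩ := Metric.eventually_nhds_iff.1 (hjet (ε / 4) (by positivity))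
  have h1 : Tendsto (fun h => n / r * q (bdist Ω x) + B * ((h ^ 2)⁻¹ * normVar (x - z) h)) (𝓝[>] 0)
      (𝓝 (n / r * q (bdist Ω x) + B * 2)) :=
    ((tendsto_normVar hv).const_mul B).const_add _
  have h2 : n / r * q (bdist Ω x) + B * 2 < bumpLap Ω (n / r) q b x + ε := by
    rw [bumpLap, Set.indicator_of_mem (show x ∈ (Ω : Set (Rn n)) from hx), hB]
    linarith
  filter_upwards [h1.eventually_le_const h2, Ioo_mem_nhdsGT hη] with h h3 h4
  refine (dlap_bump_le hH hr hx hz hz' h4.1 fun s hs => ?_).trans h3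
  exact hηs (by rw [Real.dist_eq]; exact hs.trans_lt h4.2)

end DistanceProfile

/-! ### Vanishing of square integrable weak solutions -/

section WeakSolutions

variable {n : ℕ} {Ω : Opens (Rn n)}

/-- The distribution of the boundary distance on the tube `{d < t₁}` is bounded by `A` times
Lebesgue measure. -/
def TubeBound (Ω : Opens (Rn n)) (t₁ : ℝ) (A : ℝ≥0∞) : Prop :=
  ∀ E : Set ℝ, MeasurableSet E →
    volume {x | x ∈ Ω ∧ bdist Ω x < t₁ ∧ bdist Ω x ∈ E} ≤ A * volume E

variable {t₁ : ℝ} {A : ℝ≥0∞}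

/-- Null sets of distances pull back to null sets of points, so the profile's inequalities may hold
merely for almost every t. -/
lemma TubeBound.ae_bdist (hA : TubeBound Ω t₁ A) {P : ℝ → Prop} (hP : ∀ᵐ t, P t) :
    ∀ᵐ x : Rn n, x ∈ Ω → bdist Ω x < t₁ → P (bdist Ω x) := by
  obtain ⟨E, hE, hEm, hE0⟩ := exists_measurable_superset_of_null (ae_iff.1 hP)
  rw [ae_iff]
  refine measure_mono_null ?_ (le_antisymm ((hA E hEm).trans (by rw [hE0, mul_zero])) bot_le)
  intro x hx
  simp only [Set.mem_ofPred_eq, Classical.not_imp] at hx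
  exact ⟨hx.1, hx.2.1, hE hx.2.2⟩

lemma measurableSet_tube (Ω : Opens (Rn n)) (t₁ : ℝ) :
    MeasurableSet {x | x ∈ Ω ∧ bdist Ω x < t₁} :=
  Ω.isOpen.measurableSet.inter (continuous_bdist.measurable measurableSet_Iio)

/-- On the tube the image measure of d is at most A times Lebesgue measure; outside it g(d)
vanishes. -/
lemma TubeBound.integral_le (hA : TubeBound Ω t₁ A) (hAt : A ≠ ⊤) {g : ℝ → ℝ} (hg : Measurable g)
    (hg0 : ∀ t, 0 ≤ g t) (hgi : Integrable g) (hgt : ∀ t, t₁ ≤ t → g t = 0) :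
    ∫ x in (Ω : Set (Rn n)), g (bdist Ω x) ≤ A.toReal * ∫ t, g t := by
  set T := {x | x ∈ Ω ∧ bdist Ω x < t₁} with hT
  have hTm : MeasurableSet T := measurableSet_tube Ω t₁
  have hmap : (volume.restrict T).map (bdist Ω) ≤ A • volume := by
    refine Measure.le_iff.2 fun E hE => ?_
    rw [Measure.map_apply continuous_bdist.measurable hE, Measure.restrict_apply
      (continuous_bdist.measurable hE), Measure.smul_apply, smul_eq_mul]
    refine (measure_mono ?_).trans (hA E hE)
    exact fun x hx => ⟨hx.2.1, hx.2.2, hx.1⟩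
  have h1 : ∫ x in (Ω : Set (Rn n)), g (bdist Ω x) = ∫ x in T, g (bdist Ω x) := by
    refine (setIntegral_eq_of_subset_of_forall_sdiff_eq_zero Ω.isOpen.measurableSet
      (fun x (hx : x ∈ T) => hx.1) fun x hx => hgt _ ?_)
    by_contra! h
    exact hx.2 ⟨hx.1, h⟩
  rw [h1, ← integral_map (φ := bdist Ω) continuous_bdist.measurable.aemeasurable
    hg.aestronglyMeasurable]
  refine (integral_mono_measure hmap (Eventually.of_forall hg0) (hgi.smul_measure hAt)).trans_eq ?_
  rw [integral_smul_measure, smul_eq_mul]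

variable {W φ y : ℝ → ℝ} {a r δ : ℝ}

/-- The weighted `L¹` bound for weak solutions of `(-Δ + c) w = 0` that follows from a comparison
function. -/
lemma integral_norm_mul_bump_le {H q b : ℝ → ℝ} {Λ h₀ ε₀ ε₁ : ℝ}
    (hb : Bornology.IsBounded (Ω : Set (Rn n)))
    (hr : 0 < r)
    (hball : ∀ x ∈ Ω, ∃ z, ‖x - z‖ = bdist Ω x + r ∧ ∀ x' ∈ Ω, bdist Ω x' ≤ ‖x' - z‖ - r)
    (hA : TubeBound Ω t₁ A) (hAt : A ≠ ⊤) (hat : a < t₁) (haδ : a ≤ δ)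
    {w : Rn n → ℂ} (hw : Integrable w) (hw2 : Integrable fun x => ‖w x‖ ^ 2)
    (hwΩ : ∀ x ∉ Ω, w x = 0) {c : Rn n → ℝ} (hcl : LocEssBdd Ω c)
    (hsol : ∀ φ : 𝓓(Ω, ℂ), ∫ x, w x * (-Δ (φ : Rn n → ℂ) x + (c x : ℂ) * φ x) = 0)
    (hc : ∀ᵐ x, x ∈ Ω → 1 ≤ c x ∧ (bdist Ω x < δ → W (bdist Ω x) + 1 ≤ c x))
    (hcmp : Comparison a (n / r) W φ y) (h₁ : 0 < ε₀) (h₂ : ε₀ < ε₁) (h₃ : ε₁ < a)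
    (hH : IsProfile H q b Λ h₀) (hH0 : ∀ t ≤ ε₀, H t = 0)
    (hHa : ∀ t, a ≤ t → q t = 0 ∧ b t = 0 ∧ ∀ s, H s ≤ H t)
    (hHW : ∀ᵐ t, b t + n / r * q t ≤ 0 ∨ t ∈ Set.Ioo 0 a ∧ b t + n / r * q t ≤ W t * H t
      + (Set.Ioo ε₀ ε₁).indicator φ t / ∫ s in ε₀..ε₁, φ s ^ 2)
    (hM : 0 < ∫ s in ε₀..ε₁, φ s ^ 2) :
    Integrable (fun x => ‖w x‖ * bump Ω H x) ∧
    ∫ x, ‖w x‖ * bump Ω H x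
      ≤ ((∫ x, ‖w x‖ ^ 2) + A.toReal) / √(∫ s in ε₀..ε₁, φ s ^ 2) := by
  set M := ∫ s in ε₀..ε₁, φ s ^ 2 with hMdef
  set g := (Set.Ioo ε₀ ε₁).indicator φ with hg
  set b' := bumpLap Ω (n / r) q b with hb'
  have hsub : Set.Icc ε₀ ε₁ ⊆ Set.Ioo 0 a := fun t ht => ⟨h₁.trans_le ht.1, ht.2.trans_lt h₃⟩
  have hφc : ContinuousOn φ (Set.Icc ε₀ ε₁) := hcmp.continuousOn.mono hsub
  have hgm : Measurable g := by
    classical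
    have := (hφc.mono Set.Ioo_subset_Icc_self).measurable_piecewise
      (continuousOn_const (c := (0 : ℝ)) (s := (Set.Ioo ε₀ ε₁)ᶜ)) measurableSet_Ioo
    rw [hg, ← Set.piecewise_eq_indicator]
    exact this
  have hg0 : ∀ t, 0 ≤ g t := fun t => Set.indicator_nonneg
    (fun s hs => (hcmp.pos s (hsub (Set.Ioo_subset_Icc_self hs))).le) t
  obtain ⟨D, hD⟩ := isCompact_Icc.exists_bound_of_continuousOn hφc
  have hD0 : 0 ≤ D := (norm_nonneg _).trans (hD ε₀ ⟨le_rfl, h₂.le⟩)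
  have hgD : ∀ t, |g t| ≤ D := fun t => by
    by_cases ht : t ∈ Set.Ioo ε₀ ε₁
    · rw [hg, Set.indicator_of_mem ht]
      exact hD t (Set.Ioo_subset_Icc_self ht)
    · rw [hg, Set.indicator_of_notMem ht, abs_zero]
      exact hD0
  have hgsq : (fun t => g t ^ 2) = (Set.Ioo ε₀ ε₁).indicator fun t => φ t ^ 2 := by
    funext t
    by_cases ht : t ∈ Set.Ioo ε₀ ε₁
    · rw [hg, Set.indicator_of_mem ht, Set.indicator_of_mem ht]
    · rw [hg, Set.indicator_of_notMem ht, Set.indicator_of_notMem ht]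
      simp
  have hg2i : Integrable fun t => g t ^ 2 := by
    rw [hgsq, integrable_indicator_iff measurableSet_Ioo]
    exact ((hφc.pow 2).integrableOn_Icc).mono_set Set.Ioo_subset_Icc_self
  have hg2 : ∫ t, g t ^ 2 = M := by
    rw [hgsq, integral_indicator measurableSet_Ioo, hMdef, intervalIntegral.integral_of_le h₂.le,
      integral_Ioc_eq_integral_Ioo]
  have hΩm : MeasurableSet (Ω : Set (Rn n)) := Ω.isOpen.measurableSet
  set G : Rn n → ℝ := (Ω : Set (Rn n)).indicator fun x => g (bdist Ω x) with hG
  have hGm : Measurable G := (hgm.comp continuous_bdist.measurable).indicator hΩm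
  have hGD : ∀ x, |G x| ≤ D := fun x => by
    by_cases hx : x ∈ (Ω : Set (Rn n))
    · rw [hG, Set.indicator_of_mem hx]
      exact hgD _
    · rw [hG, Set.indicator_of_notMem hx, abs_zero]
      exact hD0
  have hGsq : (fun x => G x ^ 2) = (Ω : Set (Rn n)).indicator fun x => g (bdist Ω x) ^ 2 := by
    funext x
    by_cases hx : x ∈ (Ω : Set (Rn n))
    · rw [hG, Set.indicator_of_mem hx, Set.indicator_of_mem hx]
    · rw [hG, Set.indicator_of_notMem hx, Set.indicator_of_notMem hx]
      simp
  have hG2i : Integrable fun x => G x ^ 2 := by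
    rw [hGsq, integrable_indicator_iff hΩm]
    have hfin : volume (Ω : Set (Rn n)) < ⊤ := hb.measure_lt_top
    refine Measure.integrableOn_of_bounded (M := D ^ 2) hfin.ne
      ((hgm.comp continuous_bdist.measurable).pow_const 2).aestronglyMeasurable
      (Eventually.of_forall fun x => ?_)
    rw [norm_pow]
    exact pow_le_pow_left₀ (norm_nonneg _) (hgD _) 2
  have hG2 : ∫ x, G x ^ 2 ≤ A.toReal * M := by
    rw [hGsq, integral_indicator hΩm, ← hg2]
    refine hA.integral_le hAt (g := fun t => g t ^ 2) (hgm.pow_const 2) (fun t => sq_nonneg _) hg2i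
      fun t ht => ?_
    have : t ∉ Set.Ioo ε₀ ε₁ := fun h => by linarith [h.2]
    rw [hg]
    simp [Set.indicator_of_notMem this]
  have hcont : Continuous (bump Ω H) := continuous_bump hH.cont h₁ hH0
  have hHle : ∀ t, H t ≤ H a := fun t => (hHa a le_rfl).2.2 t
  have hbumpb : ∀ x, |bump Ω H x| ≤ H a := fun x => by
    rw [abs_of_nonneg (bump_nonneg hH.nonneg x)]
    by_cases hx : x ∈ Ω
    · rw [bump_of_mem hx]
      exact hHle _
    · rw [bump_of_notMem hx]
      exact hH.nonneg a
  have hlim : ∀ᵐ x, ∀ ε > 0, ∀ᶠ h in 𝓝[>] (0 : ℝ), dlap h (bump Ω H) x ≤ b' x + ε := by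
    filter_upwards [hA.ae_bdist hH.ae_jet] with x hxj ε hε
    by_cases hx : x ∈ Ω
    · refine eventually_dlap_bump_le hH hr hball hx ?_ hε
      rcases lt_or_ge (bdist Ω x) t₁ with h | h
      · exact hxj hx h
      -- Beyond t₁ nothing is known about the distribution of d, but there H is already at its
      -- maximum and the zero jet is valid at every point.
      · intro ε hε
        obtain ⟨e1, e2, e3⟩ := hHa _ (hat.le.trans h)
        refine Eventually.of_forall fun s => ?_
        rw [e1, e2]
        have : 0 ≤ (0 / 2 + ε) * (s - bdist Ω x) ^ 2 := by positivity
        linarith [e3 s]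
    · filter_upwards [Ioo_mem_nhdsGT h₁] with h hh
      rw [dlap_bump_of_notMem hH0 hx hh.1 hh.2.le, hb', bumpLap, Set.indicator_of_notMem hx]
      linarith
  have hkato := kato_inequality hw hcl hsol (χ := bump Ω H) (bump_nonneg hH.nonneg) hcont
    (hasCompactSupport_bump hb) (tsupport_bump_subset h₁ hH0) (b := b') (measurable_bumpLap hH _)
    (abs_bumpLap_le hH hcmp.C_nonneg) (lt_min hH.h₀_pos h₁)
    (fun h hh hhh x => dlap_bump_le_const hH hH0 hr hball hh hhh x) hlim
  obtain ⟨hki, hk⟩ := hkato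
  have i1 : Integrable fun x => ‖w x‖ * bump Ω H x :=
    integrable_bdd_mul hw.norm hcont.aestronglyMeasurable hbumpb
  have i2 : Integrable fun x => ‖w x‖ * b' x :=
    integrable_bdd_mul hw.norm (measurable_bumpLap hH _).aestronglyMeasurable
      (abs_bumpLap_le hH hcmp.C_nonneg)
  have i3 : Integrable fun x => ‖w x‖ * G x :=
    integrable_bdd_mul hw.norm hGm.aestronglyMeasurable hGD
  refine ⟨i1, ?_⟩
  -- The spare 1 in c ≥ W(d) + 1 produces the left side. By Kato's inequality the bracket has
  -- nonpositive integral.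
  have hpt : ∀ᵐ x, ‖w x‖ * bump Ω H x
      ≤ ‖w x‖ * G x / M + (c x * ‖w x‖ * bump Ω H x - ‖w x‖ * b' x) := by
    filter_upwards [hc, hA.ae_bdist hHW] with x hcx hxW
    by_cases hx : x ∈ (Ω : Set (Rn n))
    · have hkey : b' x ≤ (c x - 1) * bump Ω H x + G x / M := by
        rw [bump_of_mem hx, hb', bumpLap, hG, Set.indicator_of_mem hx, Set.indicator_of_mem hx]
        have p1 : 0 ≤ (c x - 1) * H (bdist Ω x) :=
          mul_nonneg (by linarith [(hcx hx).1]) (hH.nonneg _)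
        have p2 : 0 ≤ g (bdist Ω x) / M := div_nonneg (hg0 _) hM.le
        rcases lt_or_ge (bdist Ω x) t₁ with h | h
        · rcases hxW hx h with h' | ⟨h', h''⟩
          · linarith
          · have := (hcx hx).2 (h'.2.trans_le haδ)
            have p3 : W (bdist Ω x) * H (bdist Ω x) ≤ (c x - 1) * H (bdist Ω x) :=
              mul_le_mul_of_nonneg_right (by linarith) (hH.nonneg _)
            linarith
        · obtain ⟨e1, e2, -⟩ := hHa _ (hat.le.trans h)
          rw [e1, e2]
          linarith
      have := mul_le_mul_of_nonneg_left hkey (norm_nonneg (w x))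
      have e : ‖w x‖ * ((c x - 1) * bump Ω H x + G x / M)
        = c x * ‖w x‖ * bump Ω H x - ‖w x‖ * bump Ω H x + ‖w x‖ * G x / M := by ring
      linarith
    · rw [hwΩ x hx]
      simp
  -- Young's inequality is weighted so that both terms integrate to order 1/√M, given ∫G² ≤ A·M.
  have hpt2 : ∀ x, ‖w x‖ * G x / M ≤ ‖w x‖ ^ 2 / √M + G x ^ 2 / (√M * M) := by
    intro x
    have hs : 0 < √M := Real.sqrt_pos.2 hM
    have hsq : M = √M ^ 2 := (Real.sq_sqrt hM.le).symm
    have e : ‖w x‖ ^ 2 / √M + G x ^ 2 / (√M * M) - ‖w x‖ * G x / M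
        = ((‖w x‖ - G x / (2 * √M)) ^ 2 + 3 / 4 * (G x / √M) ^ 2) / √M := by
      generalize √M = s at hs hsq
      rw [hsq]
      field_simp
      ring
    have : 0 ≤ ((‖w x‖ - G x / (2 * √M)) ^ 2 + 3 / 4 * (G x / √M) ^ 2) / √M := by positivity
    linarith
  have i4 : Integrable fun x => ‖w x‖ * G x / M := i3.div_const M
  have i5 : Integrable fun x => c x * ‖w x‖ * bump Ω H x - ‖w x‖ * b' x := hki.sub i2
  have s1 : ∫ x, ‖w x‖ * bump Ω H x
      ≤ (∫ x, ‖w x‖ * G x / M) + ((∫ x, c x * ‖w x‖ * bump Ω H x) - ∫ x, ‖w x‖ * b' x) := by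
    rw [← integral_sub hki i2, ← integral_add i4 i5]
    exact integral_mono_ae i1 (i4.add i5) hpt
  have s2 : ∫ x, ‖w x‖ * G x / M ≤ (∫ x, ‖w x‖ ^ 2) / √M + (∫ x, G x ^ 2) / (√M * M) := by
    have i6 : Integrable fun x => ‖w x‖ ^ 2 / √M := hw2.div_const _
    have i7 : Integrable fun x => G x ^ 2 / (√M * M) := hG2i.div_const _
    rw [← integral_div, ← integral_div, ← integral_add i6 i7]
    exact integral_mono i4 (i6.add i7) hpt2
  have s3 : (∫ x, G x ^ 2) / (√M * M) ≤ A.toReal / √M := by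
    have hs : 0 < √M := Real.sqrt_pos.2 hM
    rw [div_le_div_iff₀ (by positivity) hs]
    nlinarith
  rw [add_div]
  linarith

/-- A function bounded above by members of a sequence of nonnegative functions whose integrals
have infimum zero vanishes. -/
lemma ae_le_zero_of_integral_small {X : Type*} [MeasurableSpace X] {μ : Measure X}
    {F : ℕ → X → ℝ} (hF0 : ∀ k x, 0 ≤ F k x) (hFi : ∀ k, Integrable (F k) μ)
    (hF : ∀ η > 0, ∃ k, ∫ x, F k x ∂μ ≤ η) :
    ∀ᵐ x ∂μ, ∀ t : ℝ, (∀ k, t ≤ F k x) → t ≤ 0 := by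
  have h1 : ∫⁻ x, ⨅ k, ENNReal.ofReal (F k x) ∂μ = 0 := by
    refine le_antisymm (ENNReal.le_of_forall_pos_le_add fun η hη _ => ?_) bot_le
    obtain ⟨k, hk⟩ := hF η hη
    calc ∫⁻ x, ⨅ k, ENNReal.ofReal (F k x) ∂μ ≤ ∫⁻ x, ENNReal.ofReal (F k x) ∂μ :=
          lintegral_mono fun x => iInf_le _ k
      _ = ENNReal.ofReal (∫ x, F k x ∂μ) :=
          (ofReal_integral_eq_lintegral_ofReal (hFi k) (Eventually.of_forall (hF0 k))).symm
      _ ≤ 0 + η := by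
          rw [zero_add]
          exact ENNReal.ofReal_le_of_le_toReal hk
  rw [lintegral_eq_zero_iff' (AEMeasurable.iInf fun k => (hFi k).aemeasurable.ennreal_ofReal)] at h1
  filter_upwards [h1] with x hx t ht
  have : ENNReal.ofReal t ≤ ⨅ k, ENNReal.ofReal (F k x) :=
    le_iInf fun k => ENNReal.ofReal_le_ofReal (ht k)
  rw [hx] at this
  exact ENNReal.ofReal_eq_zero.1 (le_antisymm this bot_le)

/-- Square integrable weak solutions of `(-Δ + c) w = 0` vanish if `c ≥ W(d) + 1` near the boundary
for a potential `W` with a comparison function that is not square integrable at `0`. -/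
theorem ae_eq_zero_of_weak_solution (hb : Bornology.IsBounded (Ω : Set (Rn n)))
    (hne : (frontier (Ω : Set (Rn n))).Nonempty) (hr : 0 < r)
    (hball : ∀ x ∈ Ω, ∃ z, ‖x - z‖ = bdist Ω x + r ∧ ∀ x' ∈ Ω, bdist Ω x' ≤ ‖x' - z‖ - r)
    (hA : TubeBound Ω t₁ A) (hAt : A ≠ ⊤) (ha : 0 < a) (hat : a < t₁) (haδ : a ≤ δ)
    {w : Rn n → ℂ} (hw : Integrable w) (hw2 : Integrable fun x => ‖w x‖ ^ 2)
    (hwΩ : ∀ x ∉ Ω, w x = 0) {c : Rn n → ℝ} (hcl : LocEssBdd Ω c)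
    (hsol : ∀ φ : 𝓓(Ω, ℂ), ∫ x, w x * (-Δ (φ : Rn n → ℂ) x + (c x : ℂ) * φ x) = 0)
    (hc : ∀ᵐ x, x ∈ Ω → 1 ≤ c x ∧ (bdist Ω x < δ → W (bdist Ω x) + 1 ≤ c x))
    (hcmp : Comparison a (n / r) W φ y)
    (hinf : ∀ ε₁ ∈ Set.Ioo 0 a, Tendsto (fun ε₀ => ∫ s in ε₀..ε₁, φ s ^ 2) (𝓝[>] 0) atTop) :
    ∀ᵐ x, w x = 0 := by
  have hstep : ∀ ε₁ ∈ Set.Ioo 0 a, ∀ᵐ x, x ∈ Ω → ε₁ < bdist Ω x → w x = 0 := by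
    intro ε₁ hε₁
    obtain ⟨ζ, hζ, hprof⟩ := hcmp.exists_profile hε₁.1 hε₁.2
    -- The mass is at least (k + 1)² so that its square root beats k + 1.
    have hchoose : ∀ k : ℕ, ∃ ε₀, 0 < ε₀ ∧ ε₀ < ε₁ ∧
        ((k : ℝ) + 1) ^ 2 ≤ ∫ s in ε₀..ε₁, φ s ^ 2 := fun k => by
      obtain ⟨ε₀, h1, h2⟩ := (((hinf ε₁ hε₁).eventually_ge_atTop (((k : ℝ) + 1) ^ 2)).and
        (Ioo_mem_nhdsGT hε₁.1)).exists
      exact ⟨ε₀, h2.1, h2.2, h1⟩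
    choose ε₀ h1 h2 h3 using hchoose
    choose H q b Λ h hH hH0 hHζ hHa hHW using fun k => hprof (ε₀ k) (h1 k) (h2 k)
    have hest : ∀ k, Integrable (fun x => ‖w x‖ * bump Ω (H k) x) ∧
        ∫ x, ‖w x‖ * bump Ω (H k) x ≤ ((∫ x, ‖w x‖ ^ 2) + A.toReal) / (k + 1) := fun k => by
      have hk : (0 : ℝ) < (k : ℝ) + 1 := by positivity
      obtain ⟨j1, j2⟩ := integral_norm_mul_bump_le hb hr hball hA hAt hat haδ hw hw2 hwΩ hcl hsol hc
        hcmp (h1 k) (h2 k) hε₁.2 (hH k) (hH0 k) (hHa k) (hHW k) ((by positivity : (0 : ℝ) <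
          ((k : ℝ) + 1) ^ 2).trans_le (h3 k))
      refine ⟨j1, j2.trans ?_⟩
      have hnn : 0 ≤ (∫ x, ‖w x‖ ^ 2) + A.toReal :=
        add_nonneg (integral_nonneg fun x => sq_nonneg _) ENNReal.toReal_nonneg
      exact div_le_div_of_nonneg_left hnn hk (Real.le_sqrt_of_sq_le (h3 k))
    -- The integrals of ‖w‖·H_k(d) tend to 0. Passing through the infimum of these functions avoids
    -- any measurability of the common lower bound ζ.
    have hsmall := ae_le_zero_of_integral_small (F := fun k x => ‖w x‖ * bump Ω (H k) x)
      (fun k x => mul_nonneg (norm_nonneg _) (bump_nonneg (hH k).nonneg x))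
      (fun k => (hest k).1) (fun η hη => by
        have hlim : Tendsto (fun k : ℕ => ((∫ x, ‖w x‖ ^ 2) + A.toReal) / ((k : ℝ) + 1)) atTop
            (𝓝 0) := by
          have := (tendsto_one_div_add_atTop_nhds_zero_nat (𝕜 := ℝ)).const_mul
            ((∫ x, ‖w x‖ ^ 2) + A.toReal)
          rw [mul_zero] at this
          exact this.congr fun k => by rw [mul_one_div]
        obtain ⟨k, hk⟩ := (hlim.eventually_le_const hη).exists
        exact ⟨k, (hest k).2.trans hk⟩)
    filter_upwards [hsmall] with x hx hxΩ hxε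
    have h5 := hx (‖w x‖ * ζ (bdist Ω x)) fun k =>
      mul_le_mul_of_nonneg_left (by rw [bump_of_mem hxΩ]; exact hHζ k _ hxε) (norm_nonneg _)
    have h6 := hζ _ hxε
    have h7 : ‖w x‖ ≤ 0 := nonpos_of_mul_nonpos_left h5 h6
    exact norm_le_zero_iff.1 h7
  -- The sequence ε₁ = a/(k + 2) lies in (0, a) and tends to 0, so countably many exceptional null
  -- sets suffice.
  have hall : ∀ᵐ x, ∀ k : ℕ, x ∈ Ω → a / (k + 2) < bdist Ω x → w x = 0 :=
    ae_all_iff.2 fun k => hstep _ ⟨by positivity, div_lt_self ha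
      (by linarith [(k.cast_nonneg : (0 : ℝ) ≤ k)])⟩
  filter_upwards [hall] with x hx
  by_cases hxΩ : x ∈ Ω
  · have hd := bdist_pos hne hxΩ
    obtain ⟨k, hk⟩ := exists_nat_gt (a / bdist Ω x)
    refine hx k hxΩ ?_
    rw [div_lt_iff₀ hd] at hk
    rw [div_lt_iff₀ (by positivity)]
    nlinarith
  · exact hwΩ x hxΩ

end WeakSolutions

/-! ### Extension by zero of an element of the kernel -/

section Kernel

variable {n : ℕ} {Ω : Opens (Rn n)}

lemma exists_ae_abs_le {X : Type*} [MeasurableSpace X] {μ : Measure X} {g : X → ℝ}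
    (hg : MemLp g ⊤ μ) : ∃ K : ℝ, ∀ᵐ x ∂μ, |g x| ≤ K := by
  refine ⟨(eLpNormEssSup g μ).toReal, ?_⟩
  have hfin : eLpNormEssSup g μ ≠ ⊤ := by
    rw [← eLpNorm_exponent_top]
    exact hg.2.ne
  filter_upwards [ae_le_eLpNormEssSup (f := g) (μ := μ)] with x hx
  have := ENNReal.toReal_mono hfin hx
  simpa using this

lemma LocEssBdd.add_const {V : Rn n → ℝ} (hV : LocEssBdd Ω V) (lam : ℝ) :
    LocEssBdd Ω fun x => V x + lam := by
  intro K hK hKΩ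
  have : IsFiniteMeasure (volume.restrict K) := ⟨by
    rw [Measure.restrict_apply_univ]
    exact hK.measure_lt_top⟩
  exact (hV K hK hKΩ).add (memLp_const lam)

/-- The extension by zero of the conjugate of a function on `Ω`. -/
def zeroExt (Ω : Opens (Rn n)) (u : Rn n → ℂ) : Rn n → ℂ :=
  (Ω : Set (Rn n)).indicator fun x => (starRingEnd ℂ) (u x)

lemma memLp_zeroExt (u : L2 Ω) : MemLp (zeroExt Ω u) 2 := by
  rw [zeroExt, memLp_indicator_iff_restrict Ω.isOpen.measurableSet]
  exact (Lp.memLp u).star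

lemma integrable_zeroExt (hb : Bornology.IsBounded (Ω : Set (Rn n))) (u : L2 Ω) :
    Integrable (zeroExt Ω u) := by
  rw [zeroExt, integrable_indicator_iff Ω.isOpen.measurableSet]
  have : IsFiniteMeasure (volume.restrict (Ω : Set (Rn n))) := ⟨by
    rw [Measure.restrict_apply_univ]
    exact hb.measure_lt_top⟩
  exact (Lp.memLp u).star.integrable one_le_two

lemma eq_zero_of_zeroExt (u : L2 Ω) (h : ∀ᵐ x, zeroExt Ω u x = 0) : u = 0 := by
  rw [Lp.eq_zero_iff_ae_eq_zero]
  filter_upwards [ae_restrict_of_ae h, ae_restrict_mem Ω.isOpen.measurableSet] with x hx hxΩ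
  rw [zeroExt, Set.indicator_of_mem hxΩ] at hx
  simpa using hx

lemma integral_zeroExt_mul (u : L2 Ω) (g : Rn n → ℂ) :
    ∫ x, zeroExt Ω u x * g x = ∫ x in (Ω : Set (Rn n)), (starRingEnd ℂ) (u x) * g x := by
  rw [← integral_indicator Ω.isOpen.measurableSet]
  refine integral_congr_ae (Eventually.of_forall fun x => ?_)
  exact (Set.indicator_mul_left _ _ _).symm

end Kernel

end

end SchrodingerESA

theorem theorem3 (n : ℕ) (hn : 1 ≤ n) (Ω : Opens (SchrodingerESA.Rn n))
    (hΩ_conn : IsConnected (Ω : Set (SchrodingerESA.Rn n)))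
    (hΩ_bdd : Bornology.IsBounded (Ω : Set (SchrodingerESA.Rn n)))
    (hΩ_C2 : SchrodingerESA.HasC2Boundary Ω)
    (V V₁ V₂ : SchrodingerESA.Rn n → ℝ) (hV : SchrodingerESA.LocEssBdd Ω V)
    (p : ℕ) (hp : 2 ≤ p)
    (f : ℝ → ℝ) (hf_nonneg : ∀ᶠ u in 𝓝[>] 0, 0 ≤ f u)
    (hf_lim : Tendsto (fun u => u * f u) (𝓝[>] 0) (𝓝 0))
    (hf_int : IntegrableAtFilter f (𝓝[>] 0) volume)
    (hV_sum : ∀ᵐ x ∂volume.restrict (Ω : Set (SchrodingerESA.Rn n)), V x = V₁ x + V₂ x)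
    (hV₁_nonneg : ∀ᵐ x ∂volume.restrict (Ω : Set (SchrodingerESA.Rn n)), 0 ≤ V₁ x)
    (hV₂_bdd : MemLp V₂ (⊤ : ℝ≥0∞) (volume.restrict (Ω : Set (SchrodingerESA.Rn n))))
    (δ : ℝ) (hδ : 0 < δ)
    (hV₁_growth : ∀ᵐ x ∂volume.restrict (Ω : Set (SchrodingerESA.Rn n)),
      SchrodingerESA.bdist Ω x < δ →
        3 / 4 * (1 / SchrodingerESA.bdist Ω x ^ 2)
          - 1 / SchrodingerESA.bdist Ω x ^ 2 *
              ∑ j ∈ Finset.Icc 2 p,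
                (∏ k ∈ Finset.Icc 1 (j - 1),
                  SchrodingerESA.iterLog k (SchrodingerESA.bdist Ω x))⁻¹
          - 1 / SchrodingerESA.bdist Ω x * f (SchrodingerESA.bdist Ω x) ≤ V₁ x) :
    SchrodingerESA.IsEssentiallySelfAdjoint (SchrodingerESA.schrodinger Ω V hV) := by
  open SchrodingerESA in
  obtain ⟨K, hK⟩ := exists_ae_abs_le hV₂_bdd
  have hne := frontier_nonempty hn hΩ_conn.nonempty hΩ_bdd
  -- The shift K + 1 absorbs V₂ and leaves 1 over, which serves both coercivity and the strict gain
  -- c ≥ W(d) + 1.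
  have hlow : ∀ᵐ x ∂volume.restrict (Ω : Set (Rn n)), V₁ x + 1 ≤ V x + (K + 1) := by
    filter_upwards [hK, hV_sum] with x h1 h2
    rw [h2]
    linarith [(abs_le.1 h1).1]
  refine isEssentiallySelfAdjoint_of_coercive (A := schrodinger Ω V hV) dense_range_testToL2
    (isFormalAdjoint_schrodinger V hV) (K + 1) (coercive_schrodinger V hV (K + 1) ?_) fun u hu => ?_
  · filter_upwards [hlow, hV₁_nonneg] with x h1 h2
    linarith
  obtain ⟨r, hr, hball⟩ := exists_touching_ball hn hΩ_conn.nonempty hΩ_bdd hΩ_C2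
  obtain ⟨t₁, ht₁, A, hAt, hA⟩ := exists_tube_bound hne hΩ_bdd hΩ_C2
  -- C = n / r is the barrier bound on Δd; a lies below δ, where the growth hypothesis applies, and
  -- below t₁, where the tube bound holds.
  obtain ⟨a, ha, haa, φ, y, hcmp, hinf⟩ := exists_comparison_iterLog hp hf_nonneg hf_lim hf_int
    (C := n / r) (by positivity) (lt_min hδ ht₁)
  refine eq_zero_of_zeroExt u (ae_eq_zero_of_weak_solution hΩ_bdd hne hr hball hA hAt ha
    (haa.trans_le (min_le_right _ _)) (haa.le.trans (min_le_left _ _))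
    (integrable_zeroExt hΩ_bdd u) ((memLp_zeroExt u).integrable_norm_pow two_ne_zero)
    (fun x hx => Set.indicator_of_notMem hx _) (hV.add_const (K + 1)) (fun ψ => ?_) ?_ hcmp hinf)
  -- The inner product is conjugate-linear in its first argument, so orthogonality of u to the range
  -- is the weak equation for its conjugate.
  · rw [integral_zeroExt_mul, ← inner_schrodingerMap V hV (K + 1) u ψ,
      ← schrodinger_apply V hV ψ ⟨ψ, rfl⟩]
    exact hu ⟨testToL2 Ω ψ, ⟨ψ, rfl⟩⟩
  · refine (ae_restrict_iff' Ω.isOpen.measurableSet).1 ?_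
    filter_upwards [hlow, hV₁_nonneg, hV₁_growth] with x h1 h2 h3
    exact ⟨by linarith, fun h => by linarith [h3 h]⟩
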